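/- All graphs are finite, simple and undirected. A path is *shortest* if its length equals the distance of its endpoints; the eccentricity of a path $P$ in $G$ is $\mathrm{ecc}_G(P)=\max_{u\in V(G)}\min_{s\in P}d_G(u,s)$. The Minimum Eccentricity Shortest Path problem (MESP) asks, for a connected graph $G$ and $k\in\mathbb N$, whether $G$ has a shortest path $P$ with $\mathrm{ecc}_G(P)\le k$. Given a pattern graph $T$ and disjoint nonempty graphs $G_i$ $(i\in V(T))$, the *substitution* $T[G_i]$ is the union of the $G_i$ together with all edges $uv$ with $u\in V(G_i)$, $v\in V(G_j)$, $ij\in E(T)$; the sets $V(G_i)$ are its modules. The *modular width* of $G$ is the least $w$ such that $G$ can be built from single vertices by disjoint unions of two graphs, complete joins of two graphs, and substitutions with at most $w$ operands each. **Theorem.** (1) There is an algorithm (a fixed random access machine program with unit-cost operations on words of $O(\log(n+k))$ bits, the graph being given by its adjacency matrix) that solves MESP on every connected graph $G$ with $n$ vertices and every $k\in\mathbb N$ in $O(2^w\cdot n^3)$ steps, where $w$ is the modular width of $G$ (which is not part of the input) and the implied constant is absolute. (2) Let $G=T[G_i]$ be connected, where $T$ has at least $3$ vertices. Then: (a) among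 the shortest paths of $G$ with minimum eccentricity there is one that contains at most one vertex of each $V(G_i)$; (b) if $P$ is a shortest path of $G$ that is not contained in $V(G_i)$, $p\in P\cap V(G_i)$ and $p'\in V(G_i)$, then the sequence $P'$ obtained from $P$ by replacing $p$ by $p'$ satisfies $\mathrm{ecc}_G(P')=\mathrm{ecc}_G(P)$, and if $p$ is the only vertex of $P$ in $V(G_i)$, then $P'$ is again a shortest path of $G$; (c) for any choice of one vertex $r_i\in V(G_i)$ for each $i$ and every $k\in\mathbb N$, $G$ has a shortest path of eccentricity at most $k$ if and only if $T$ has a shortest path $(\pi_1,\dots,\pi_\ell)$ with $\ell\ge 2$ such that $(r_{\pi_1},\dots,r_{\pi_\ell})$ is a shortest path of $G$ of eccentricity at most $k$. -/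

import Mathlib

namespace MESP

/-! ## Shortest paths and eccentricity -/

/-- The list `P` of vertices is a path of `G` that is shortest between its endpoints. -/
def IsShortestPath {V : Type} (G : SimpleGraph V) (P : List V) : Prop :=
  ∃ (u v : V) (p : G.Walk u v), p.length = G.dist u v ∧ p.support = P

/-- The distance from a vertex to a set (`⊤` for the empty set). -/
noncomputable def distToSet {V : Type} (G : SimpleGraph V) (u : V) (S : Set V) : ℕ∞ :=
  ⨅ s ∈ S, G.edist u s

/-- The eccentricity of a set: the largest distance of a vertex of the graph from it. -/
noncomputable def setEcc {V : Type} (G : SimpleGraph V) (S : Set V) : ℕ∞ :=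
  ⨆ u, distToSet G u S

/-- The eccentricity of (the vertex set of) a path. -/
noncomputable def pathEcc {V : Type} (G : SimpleGraph V) (P : List V) : ℕ∞ :=
  setEcc G {v | v ∈ P}

/-- `(G, k)` is a yes-instance of the Minimum Eccentricity Shortest Path problem. -/
def YesInstance {V : Type} (G : SimpleGraph V) (k : ℕ) : Prop :=
  ∃ P : List V, IsShortestPath G P ∧ pathEcc G P ≤ k

/-- `P` is a shortest path whose eccentricity is least among all shortest paths of `G`. -/
def IsMinEccShortestPath {V : Type} (G : SimpleGraph V) (P : List V) : Prop :=
  IsShortestPath G P ∧ ∀ Q : List V, IsShortestPath G Q → pathEcc G P ≤ pathEcc G Q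

/-! ## Modular width -/

/-- The complete join of two disjoint graphs. -/
def joinGraph {V W : Type} (G : SimpleGraph V) (H : SimpleGraph W) : SimpleGraph (V ⊕ W) :=
  SimpleGraph.sum G H ⊔ completeBipartiteGraph V W

/-- The substitution of the vertices `i` of the pattern graph `T` by the graphs `H i`. -/
def substGraph {ι : Type} (T : SimpleGraph ι) {V : ι → Type} (H : ∀ i, SimpleGraph (V i)) :
    SimpleGraph (Σ i, V i) where
  Adj x y := T.Adj x.1 y.1 ∨ ∃ (i : ι) (a b : V i), (H i).Adj a b ∧ x = ⟨i, a⟩ ∧ y = ⟨i, b⟩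
  symm := ⟨by
    rintro x y (h | ⟨i, a, b, h, hx, hy⟩)
    · exact Or.inl h.symm
    · exact Or.inr ⟨i, b, a, h.symm, hy, hx⟩⟩
  loopless := ⟨by
    rintro x (h | ⟨i, a, b, h, rfl, hy⟩)
    · exact h.ne rfl
    · exact h.ne (by simpa using hy)⟩

/-- Algebraic expressions over the operations: isolated vertex, disjoint union, complete join,
substitution into a pattern graph (with at least one operand). -/
inductive ModExpr : Type
  | vertex : ModExpr
  | union (A B : ModExpr) : ModExpr
  | join (A B : ModExpr) : ModExpr
  | subst (r : ℕ) (T : SimpleGraph (Fin (r + 1))) (A : Fin (r + 1) → ModExpr) : ModExpr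

/-- The vertex set of the graph described by an expression. -/
def ModExpr.Carrier : ModExpr → Type
  | .vertex => Unit
  | .union A B => A.Carrier ⊕ B.Carrier
  | .join A B => A.Carrier ⊕ B.Carrier
  | .subst _ _ A => Σ i, (A i).Carrier

/-- The graph described by an expression. -/
def ModExpr.graph : (A : ModExpr) → SimpleGraph A.Carrier
  | .vertex => (⊥ : SimpleGraph Unit)
  | .union A B => SimpleGraph.sum A.graph B.graph
  | .join A B => joinGraph A.graph B.graph
  | .subst _ T A => substGraph T (fun i => (A i).graph)

/-- The width: the maximum number of operands of a substitution in the expression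
(`0` if there is none). -/
def ModExpr.width : ModExpr → ℕ
  | .vertex => 0
  | .union A B => max A.width B.width
  | .join A B => max A.width B.width
  | .subst r _ A => max (r + 1) (Finset.univ.sup fun i => (A i).width)

/-- The modular width of a (finite nonempty) graph: the least `m` such that the graph is
described, up to isomorphism, by an expression of width at most `m`. -/
noncomputable def modularWidth {V : Type} (G : SimpleGraph V) : ℕ :=
  sInf {m | ∃ A : ModExpr, A.width ≤ m ∧ Nonempty (A.graph ≃g G)}

/-- A defining expression exists for every finite nonempty graph, so that `modularWidth` is
attained. -/
theorem exists_modExpr {n : ℕ} (hn : 0 < n) (G : SimpleGraph (Fin n)) :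
    ∃ A : ModExpr, A.width ≤ modularWidth G ∧ Nonempty (A.graph ≃g G) := by
  refine Nat.sInf_mem (s := {m | ∃ A : ModExpr, A.width ≤ m ∧ Nonempty (A.graph ≃g G)}) ?_
  obtain ⟨r, rfl⟩ : ∃ r, n = r + 1 := ⟨n - 1, by omega⟩
  refine ⟨_, .subst r G (fun _ => .vertex), le_rfl, ⟨?_⟩⟩
  refine ⟨⟨fun x => x.1, fun i => ⟨i, ()⟩, fun _ => rfl, fun _ => rfl⟩, ?_⟩
  rintro ⟨i, a⟩ ⟨j, b⟩
  constructor
  · intro h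
    exact Or.inl h
  · rintro (h | ⟨_, _, _, h, _, _⟩)
    · exact h
    · exact h.elim

/-! ## Random access machine programs with unit-cost operations on bounded words -/

/-- A memory state: finitely many of the variables `var x` and of the arrays `arr a` occur in
any given program. -/
structure State where
  var : ℕ → ℕ
  arr : ℕ → ℕ → ℕ

/-- Expressions; `sub` is truncated, `lt` and `eq` return `1` or `0`. -/
inductive Expr : Type
  | const (c : ℕ) : Expr
  | var (x : ℕ) : Expr
  | read (a : ℕ) (i : Expr) : Expr
  | add (e f : Expr) : Expr
  | sub (e f : Expr) : Expr
  | mul (e f : Expr) : Expr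
  | lt (e f : Expr) : Expr
  | eq (e f : Expr) : Expr

/-- The value of an expression. -/
def Expr.eval (s : State) : Expr → ℕ
  | .const c => c
  | .var x => s.var x
  | .read a i => s.arr a (i.eval s)
  | .add e f => e.eval s + f.eval s
  | .sub e f => e.eval s - f.eval s
  | .mul e f => e.eval s * f.eval s
  | .lt e f => if e.eval s < f.eval s then 1 else 0
  | .eq e f => if e.eval s = f.eval s then 1 else 0

/-- The number of operations needed to evaluate an expression. -/
def Expr.cost : Expr → ℕ
  | .const _ => 1
  | .var _ => 1
  | .read _ i => i.cost + 1
  | .add e f => e.cost + f.cost + 1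
  | .sub e f => e.cost + f.cost + 1
  | .mul e f => e.cost + f.cost + 1
  | .lt e f => e.cost + f.cost + 1
  | .eq e f => e.cost + f.cost + 1

/-- No value larger than `W` occurs in the evaluation of an expression. -/
def Expr.Fits (W : ℕ) (s : State) : Expr → Prop
  | .const c => c ≤ W
  | .var x => s.var x ≤ W
  | .read a i => i.Fits W s ∧ s.arr a (i.eval s) ≤ W
  | .add e f => e.Fits W s ∧ f.Fits W s ∧ e.eval s + f.eval s ≤ W
  | .sub e f => e.Fits W s ∧ f.Fits W s
  | .mul e f => e.Fits W s ∧ f.Fits W s ∧ e.eval s * f.eval s ≤ W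
  | .lt e f => e.Fits W s ∧ f.Fits W s ∧ 1 ≤ W
  | .eq e f => e.Fits W s ∧ f.Fits W s ∧ 1 ≤ W

/-- Programs; a condition holds if its value is not `0`. -/
inductive Prog : Type
  | skip : Prog
  | assign (x : ℕ) (e : Expr) : Prog
  | write (a : ℕ) (i e : Expr) : Prog
  | seq (p q : Prog) : Prog
  | ite (e : Expr) (p q : Prog) : Prog
  | while (e : Expr) (p : Prog) : Prog

/-- `Exec W p s s' t`: started in state `s`, the program `p` halts in state `s'` after `t` steps,
and no value larger than `W` is computed (a run that exceeds `W` is stuck). -/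
inductive Exec (W : ℕ) : Prog → State → State → ℕ → Prop
  | skip (s : State) : Exec W .skip s s 1
  | assign (x : ℕ) (e : Expr) (s : State) : e.Fits W s →
      Exec W (.assign x e) s ⟨Function.update s.var x (e.eval s), s.arr⟩ (e.cost + 1)
  | write (a : ℕ) (i e : Expr) (s : State) : i.Fits W s → e.Fits W s →
      Exec W (.write a i e) s
        ⟨s.var, Function.update s.arr a (Function.update (s.arr a) (i.eval s) (e.eval s))⟩
        (i.cost + e.cost + 1)
  | seq (p q : Prog) (s₁ s₂ s₃ : State) (t₁ t₂ : ℕ) : Exec W p s₁ s₂ t₁ → Exec W q s₂ s₃ t₂ →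
      Exec W (.seq p q) s₁ s₃ (t₁ + t₂)
  | ite_true (e : Expr) (p q : Prog) (s s' : State) (t : ℕ) : e.Fits W s → e.eval s ≠ 0 →
      Exec W p s s' t → Exec W (.ite e p q) s s' (e.cost + 1 + t)
  | ite_false (e : Expr) (p q : Prog) (s s' : State) (t : ℕ) : e.Fits W s → e.eval s = 0 →
      Exec W q s s' t → Exec W (.ite e p q) s s' (e.cost + 1 + t)
  | while_true (e : Expr) (p : Prog) (s₁ s₂ s₃ : State) (t₁ t₂ : ℕ) : e.Fits W s₁ →
      e.eval s₁ ≠ 0 → Exec W p s₁ s₂ t₁ → Exec W (.while e p) s₂ s₃ t₂ →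
      Exec W (.while e p) s₁ s₃ (e.cost + 1 + t₁ + t₂)
  | while_false (e : Expr) (p : Prog) (s : State) : e.Fits W s → e.eval s = 0 →
      Exec W (.while e p) s s (e.cost + 1)

open Classical in
/-- The input `(G, k)`: variable `0` holds the number `n` of vertices, variable `1` holds `k`,
array `0` holds the adjacency matrix row by row (entry `(i, j)` in cell `i * n + j`), and
everything else is `0`. -/
noncomputable def inputState {n : ℕ} (G : SimpleGraph (Fin n)) (k : ℕ) : State where
  var x := if x = 0 then n else if x = 1 then k else 0
  arr a c := if a = 0 ∧ ∃ i j : Fin n, c = i.val * n + j.val ∧ G.Adj i j then 1 else 0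

/-- Started on the input `(G, k)` with words bounded by `W`, the program halts after at most `t`
steps with the correct answer, `1` for yes and `0` for no, in variable `0`. -/
def DecidesWithin (p : Prog) {n : ℕ} (G : SimpleGraph (Fin n)) (k W t : ℕ) : Prop :=
  ∃ (s' : State) (t' : ℕ), Exec W p (inputState G k) s' t' ∧ t' ≤ t ∧
    (YesInstance G k → s'.var 0 = 1) ∧ (¬ YesInstance G k → s'.var 0 = 0)

/-! ## Exchanging a vertex of a path -/

open Classical in
/-- The sequence `P` with the vertex `p` replaced by `p'`. -/
noncomputable def exchange {V : Type} (P : List V) (p p' : V) : List V :=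
  P.map fun x => if x = p then p' else x

end MESP

namespace MESP

/-! ## A total-correctness logic for programs -/

/-! Structure. In a substitution over a connected graph, steps inside a module can be dropped from a
walk, and a walk of the pattern can be lifted through arbitrary vertices of the modules. Hence the
distance of vertices in different modules is the distance of the modules in the pattern
(`IsSubst.dist_eq`). If a shortest path meets a module twice, then every vertex of the path outside
that module is equidistant from the two vertices, so it is the midpoint between them. Such a path
has at most one vertex outside the module, and an edge leaving the module does at least as well
(`IsSubst.exists_injOn`). Vertices outside a module do not notice an exchange inside it, and the
vertices of the module itself are within distance one of a neighbour that the path has outside. This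
settles everything unless the eccentricity is `0`, where the path contains all vertices; that case
is excluded separately each time, mostly because there are at least three modules. Parts (a), (b)
and (c) follow.

Algorithm. Distances are computed by the method of Floyd and Warshall. For `k = 0` one asks for two
vertices at distance `n - 1`. For `k ≥ 1` the answer is yes if a vertex or an edge dominates the
graph. Otherwise two proper modules with a common vertex have a proper module as their union,
because two modules that cover the graph yield a dominating edge. So lying in a common proper module
is an equivalence relation. Its classes are the modules of a substitution over a pattern with at
least three vertices (`exists_isSubst`), and part (c) applies to any system of representatives.

The number `t` of classes is at most the modular width `w` (`ModExpr.fewModules`): a disjoint union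
is disconnected, a single vertex or a join is dominated, and a substitution with one operand is that
operand. What remains is a substitution with at least two operands, whose operands are proper
modules, so that representatives of different classes lie in different operands. The program
therefore never has to know `w` or an expression for the graph.

Representatives are found by testing each vertex against the earlier representatives; a test
generates the least module containing two vertices in `O(n ^ 2)` steps, which makes `O(w * n ^ 3)`
in all. Then a binary counter runs through the `2 ^ t` sets of representatives. That a set is the
vertex set of a shortest path of eccentricity at most `k` is a condition with quantifiers nested
three deep (`SetCond`), so it is checked in `O(n ^ 3)` steps. The running time follows from `t ≤ w ≤
2 ^ w`.

Programs are verified with total-correctness rules that carry a step bound and the word bound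
(`Runs`). Conditions on the data are written as formulas with bounded quantifiers, which are
compiled once and for all (`Fm.runs_prog`). -/

/-- The state with the value of one variable changed. -/
def State.setV (s : State) (x v : ℕ) : State := ⟨Function.update s.var x v, s.arr⟩

/-- The state with one array cell changed. -/
def State.setA (s : State) (a i v : ℕ) : State :=
  ⟨s.var, Function.update s.arr a (Function.update (s.arr a) i v)⟩

@[simp] theorem State.setV_var (s : State) (x v y : ℕ) :
    (s.setV x v).var y = if y = x then v else s.var y := by
  simp [State.setV, Function.update_apply]

@[simp] theorem State.setV_arr (s : State) (x v : ℕ) : (s.setV x v).arr = s.arr := rfl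

@[simp] theorem State.setA_var (s : State) (a i v : ℕ) : (s.setA a i v).var = s.var := rfl

@[simp] theorem State.setA_arr (s : State) (a i v b j : ℕ) :
    (s.setA a i v).arr b j = if b = a ∧ j = i then v else s.arr b j := by
  by_cases h : b = a
  · subst h
    simp [State.setA, Function.update_apply]
  · simp [State.setA, h]

/-- Program `p` started in `s` halts within `t` steps in a state satisfying `Q`. -/
def Runs (W : ℕ) (p : Prog) (s : State) (t : ℕ) (Q : State → Prop) : Prop :=
  ∃ (s' : State) (t' : ℕ), Exec W p s s' t' ∧ t' ≤ t ∧ Q s'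

theorem Runs.mono {W : ℕ} {p : Prog} {s : State} {t t' : ℕ} {Q Q' : State → Prop}
    (h : Runs W p s t Q) (ht : t ≤ t') (hQ : ∀ s', Q s' → Q' s') : Runs W p s t' Q' := by
  obtain ⟨s', u, he, hu, hq⟩ := h
  exact ⟨s', u, he, hu.trans ht, hQ _ hq⟩

theorem Runs.skip {W : ℕ} {s : State} {Q : State → Prop} (h : Q s) : Runs W .skip s 1 Q :=
  ⟨s, 1, .skip s, le_rfl, h⟩

theorem Runs.assign {W : ℕ} {s : State} {x : ℕ} {e : Expr} {Q : State → Prop}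
    (hf : e.Fits W s) (h : Q (s.setV x (e.eval s))) : Runs W (.assign x e) s (e.cost + 1) Q :=
  ⟨_, _, .assign x e s hf, le_rfl, h⟩

theorem Runs.write {W : ℕ} {s : State} {a : ℕ} {i e : Expr} {Q : State → Prop}
    (hi : i.Fits W s) (hf : e.Fits W s) (h : Q (s.setA a (i.eval s) (e.eval s))) :
    Runs W (.write a i e) s (i.cost + e.cost + 1) Q :=
  ⟨_, _, .write a i e s hi hf, le_rfl, h⟩

theorem Runs.seq {W : ℕ} {p q : Prog} {s : State} {t₁ t₂ : ℕ} {Q : State → Prop}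
    (h : Runs W p s t₁ (fun s' => Runs W q s' t₂ Q)) : Runs W (.seq p q) s (t₁ + t₂) Q := by
  obtain ⟨s', u, he, hu, s'', u', he', hu', hq⟩ := h
  exact ⟨s'', u + u', .seq p q s s' s'' u u' he he', by omega, hq⟩

theorem Runs.ite {W : ℕ} {e : Expr} {p q : Prog} {s : State} {t : ℕ} {Q : State → Prop}
    (hf : e.Fits W s) (h₁ : e.eval s ≠ 0 → Runs W p s t Q) (h₂ : e.eval s = 0 → Runs W q s t Q) :
    Runs W (.ite e p q) s (e.cost + 1 + t) Q := by
  by_cases h : e.eval s = 0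
  · obtain ⟨s', u, he, hu, hq⟩ := h₂ h
    exact ⟨s', _, .ite_false e p q s s' u hf h he, by omega, hq⟩
  · obtain ⟨s', u, he, hu, hq⟩ := h₁ h
    exact ⟨s', _, .ite_true e p q s s' u hf h he, by omega, hq⟩

/-- The rule for loops; the invariant is indexed by the number of rounds that are left. -/
theorem Runs.while {W : ℕ} {e : Expr} {p : Prog} {t : ℕ} (I : ℕ → State → Prop)
    (hf : ∀ m s, I m s → e.Fits W s)
    (hstep : ∀ m s, I (m + 1) s → e.eval s ≠ 0 ∧ Runs W p s t (I m))
    (hend : ∀ s, I 0 s → e.eval s = 0) (m : ℕ) (s : State) (h : I m s) :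
    Runs W (.while e p) s (m * (e.cost + 1 + t) + (e.cost + 1)) (I 0) := by
  induction m generalizing s with
  | zero => exact ⟨s, _, .while_false e p s (hf 0 s h) (hend s h), by omega, h⟩
  | succ m ih =>
    obtain ⟨hne, s', u, he, hu, hI⟩ := hstep m s h
    obtain ⟨s'', u', he', hu', hQ⟩ := ih s' hI
    refine ⟨s'', _, .while_true e p s s' s'' u u' (hf _ s h) hne he he', ?_, hQ⟩
    rw [Nat.add_mul]
    omega

/-! ### Frames -/

/-- The variables that a program may change. -/
def Prog.wv : Prog → List ℕ
  | .skip => []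
  | .assign x _ => [x]
  | .write _ _ _ => []
  | .seq p q => p.wv ++ q.wv
  | .ite _ p q => p.wv ++ q.wv
  | .while _ p => p.wv

/-- The arrays that a program may change. -/
def Prog.wa : Prog → List ℕ
  | .skip => []
  | .assign _ _ => []
  | .write a _ _ => [a]
  | .seq p q => p.wa ++ q.wa
  | .ite _ p q => p.wa ++ q.wa
  | .while _ p => p.wa

/-- Two states agree on everything that `p` cannot change. -/
def Prog.Frame (p : Prog) (s s' : State) : Prop :=
  (∀ x, x ∉ p.wv → s'.var x = s.var x) ∧ ∀ a, a ∉ p.wa → s'.arr a = s.arr a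

theorem Exec.frame {W : ℕ} {p : Prog} {s s' : State} {t : ℕ} (h : Exec W p s s' t) :
    p.Frame s s' := by
  induction h with
  | skip => exact ⟨fun _ _ => rfl, fun _ _ => rfl⟩
  | assign x e s hf =>
    refine ⟨fun y hy => ?_, fun _ _ => rfl⟩
    have : y ≠ x := by simpa [Prog.wv] using hy
    simp [this]
  | write a i e s hi hf =>
    refine ⟨fun _ _ => rfl, fun b hb => ?_⟩
    have : b ≠ a := by simpa [Prog.wa] using hb
    simp [this]
  | seq p q s₁ s₂ s₃ t₁ t₂ _ _ ih₁ ih₂ =>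
    refine ⟨fun y hy => ?_, fun b hb => ?_⟩
    · simp only [Prog.wv, List.mem_append, not_or] at hy
      rw [ih₂.1 y hy.2, ih₁.1 y hy.1]
    · simp only [Prog.wa, List.mem_append, not_or] at hb
      rw [ih₂.2 b hb.2, ih₁.2 b hb.1]
  | ite_true e p q s s' t _ _ _ ih =>
    refine ⟨fun y hy => ih.1 y fun h => hy ?_, fun b hb => ih.2 b fun h => hb ?_⟩
    · simp [Prog.wv, h]
    · simp [Prog.wa, h]
  | ite_false e p q s s' t _ _ _ ih =>
    refine ⟨fun y hy => ih.1 y fun h => hy ?_, fun b hb => ih.2 b fun h => hb ?_⟩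
    · simp [Prog.wv, h]
    · simp [Prog.wa, h]
  | while_true e p s₁ s₂ s₃ t₁ t₂ _ _ _ _ ih₁ ih₂ =>
    refine ⟨fun y hy => ?_, fun b hb => ?_⟩
    · rw [ih₂.1 y hy, ih₁.1 y hy]
    · rw [ih₂.2 b hb, ih₁.2 b hb]
  | while_false => exact ⟨fun _ _ => rfl, fun _ _ => rfl⟩

/-- A specification need only mention what a program changes. For a concrete program, `decide` shows
that a given variable or array is not among those written. -/
theorem Runs.frame {W : ℕ} {p : Prog} {s : State} {t : ℕ} {Q : State → Prop}
    (h : Runs W p s t Q) : Runs W p s t (fun s' => p.Frame s s' ∧ Q s') := by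
  obtain ⟨s', u, he, hu, hq⟩ := h
  exact ⟨s', u, he, hu, he.frame, hq⟩

/-! ### Counting loops -/

/-- Run `p` for the values `0, …, b - 1` of the variable `x`, where `b` is a variable. -/
def forP (x b : ℕ) (p : Prog) : Prog :=
  .seq (.assign x (.const 0)) (.while (.lt (.var x) (.var b))
    (.seq p (.assign x (.add (.var x) (.const 1)))))

/-- The values of the counter and the bound come from the invariant, not from a syntactic frame.
Programs of formulas need this, since they overwrite variables and restore them later. Each round
adds 4 steps for the test and 4 for the increment; the initial assignment and the last test cost 6.
-/
theorem Runs.forP_of_invariant {W x b N t : ℕ} {p : Prog} {s₀ : State} (I : ℕ → State → Prop)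
    (hN : N ≤ W) (hW : 1 ≤ W)
    (h0 : I 0 (s₀.setV x 0)) (hI : ∀ i s, I i s → s.var x = i ∧ s.var b = N)
    (step : ∀ i s, i < N → I i s →
      Runs W p s t (fun s' => s'.var x = i ∧ I (i + 1) (s'.setV x (i + 1)))) :
    Runs W (forP x b p) s₀ (N * (t + 8) + 6) (I N) := by
  have key : Runs W (.while (.lt (.var x) (.var b))
      (.seq p (.assign x (.add (.var x) (.const 1))))) (s₀.setV x 0)
      (N * (4 + (t + 4)) + 4) (fun s => I (N - 0) s ∧ 0 ≤ N) := by
    refine Runs.while (fun m s => I (N - m) s ∧ m ≤ N) ?_ ?_ ?_ N _ ⟨by simpa using h0, le_rfl⟩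
    · rintro m s ⟨h, hm⟩
      obtain ⟨h1, h2⟩ := hI _ _ h
      simp only [Expr.Fits, h1, h2]
      omega
    · rintro m s ⟨h, hm⟩
      obtain ⟨h1, h2⟩ := hI _ _ h
      refine ⟨by simp only [Expr.eval, h1, h2]; rw [if_pos (by omega)]; exact one_ne_zero, ?_⟩
      refine Runs.seq ((step _ s (by omega) h).mono le_rfl ?_)
      rintro s' ⟨h3, h4⟩
      refine Runs.assign ?_ ⟨?_, by omega⟩
      · simp only [Expr.Fits, Expr.eval, h3]
        omega
      · simp only [Expr.eval, h3]
        rwa [show N - m = N - (m + 1) + 1 by omega]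
    · rintro s ⟨h, -⟩
      obtain ⟨h1, h2⟩ := hI _ _ h
      simp [Expr.eval, h1, h2]
  have := Runs.seq (p := .assign x (.const 0)) (Q := I N)
    (Runs.assign (s := s₀) (x := x) (e := .const 0) (W := W) (by simp [Expr.Fits])
      (key.mono le_rfl fun s h => by simpa using h.1))
  refine this.mono ?_ fun _ h => h
  simp only [Expr.cost]
  have : N * (4 + (t + 4)) = N * (t + 8) := by ring
  omega

/-- The rule for counting loops whose body keeps the counter and the bound. -/
theorem Runs.forP {W x b N t : ℕ} {p : Prog} {s₀ : State} (I : ℕ → State → Prop)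
    (hx : x ∉ p.wv) (hb : b ∉ p.wv) (hxb : b ≠ x) (hbN : s₀.var b = N)
    (hN : N ≤ W) (hW : 1 ≤ W) (h0 : I 0 (s₀.setV x 0))
    (step : ∀ i s, i < N → s.var x = i →
      (∀ y, y ∉ p.wv → y ≠ x → s.var y = s₀.var y) → (∀ a, a ∉ p.wa → s.arr a = s₀.arr a) →
      I i s → Runs W p s t (fun s' => I (i + 1) (s'.setV x (i + 1)))) :
    Runs W (MESP.forP x b p) s₀ (N * (t + 8) + 6) (I N) := by
  refine (Runs.forP_of_invariant (fun i s => s.var x = i ∧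
    (∀ y, y ∉ p.wv → y ≠ x → s.var y = s₀.var y) ∧ (∀ a, a ∉ p.wa → s.arr a = s₀.arr a) ∧ I i s)
    hN hW ?_ ?_ ?_).mono le_rfl fun _ h => h.2.2.2
  · exact ⟨by simp, fun y _ hy => by simp [hy], fun _ _ => rfl, h0⟩
  · rintro i s ⟨h1, h2, -, -⟩
    exact ⟨h1, by rw [h2 b hb hxb, hbN]⟩
  · rintro i s hi ⟨h1, h2, h3, h4⟩
    refine (step i s hi h1 h2 h3 h4).frame.mono le_rfl ?_
    rintro s' ⟨⟨hv, ha⟩, hI⟩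
    refine ⟨by rw [hv x hx, h1], by simp, fun y hy hyx => ?_, fun a hy => ?_, hI⟩
    · simp [hyx, hv y hy, h2 y hy hyx]
    · simp [ha a hy, h3 a hy]

/-! ### Programs that evaluate formulas with bounded quantifiers -/

/-- Formulas; `ex x b φ` says that `φ` holds for some value of the variable `x` that is less than
the value of the variable `b`. -/
inductive Fm : Type
  | atom (e : Expr) : Fm
  | and (φ ψ : Fm) : Fm
  | neg (φ : Fm) : Fm
  | ex (x b : ℕ) (φ : Fm) : Fm

/-- Bounded universal quantification. -/
def Fm.all (x b : ℕ) (φ : Fm) : Fm := .neg (.ex x b (.neg φ))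

def Fm.Holds (s : State) : Fm → Prop
  | .atom e => e.eval s ≠ 0
  | .and φ ψ => φ.Holds s ∧ ψ.Holds s
  | .neg φ => ¬ φ.Holds s
  | .ex x b φ => ∃ i < s.var b, φ.Holds (s.setV x i)

theorem Fm.holds_all (s : State) (x b : ℕ) (φ : Fm) :
    (Fm.all x b φ).Holds s ↔ ∀ i < s.var b, φ.Holds (s.setV x i) := by
  simp [Fm.all, Fm.Holds]

/-- All numbers that occur in the evaluation of a formula fit into words, and the quantifiers
are bounded by `N`. -/
def Fm.Fits (W N : ℕ) (s : State) : Fm → Prop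
  | .atom e => e.Fits W s
  | .and φ ψ => φ.Fits W N s ∧ ψ.Fits W N s
  | .neg φ => φ.Fits W N s
  | .ex x b φ => s.var b ≤ N ∧ ∀ i < s.var b, φ.Fits W N (s.setV x i)

def Fm.qvars : Fm → List ℕ
  | .atom _ => []
  | .and φ ψ => φ.qvars ++ ψ.qvars
  | .neg φ => φ.qvars
  | .ex x _ φ => x :: φ.qvars

/-- All variables of the expression are less than `B`. -/
def Expr.VarsLt (B : ℕ) : Expr → Prop
  | .const _ => True
  | .var x => x < B
  | .read _ i => i.VarsLt B
  | .add e f => e.VarsLt B ∧ f.VarsLt B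
  | .sub e f => e.VarsLt B ∧ f.VarsLt B
  | .mul e f => e.VarsLt B ∧ f.VarsLt B
  | .lt e f => e.VarsLt B ∧ f.VarsLt B
  | .eq e f => e.VarsLt B ∧ f.VarsLt B

/-- All variables of the formula are less than `B`, and nested quantifiers use different ones. -/
def Fm.WF (B : ℕ) : Fm → Prop
  | .atom e => e.VarsLt B
  | .and φ ψ => φ.WF B ∧ ψ.WF B
  | .neg φ => φ.WF B
  | .ex x b φ => x < B ∧ b < B ∧ b ≠ x ∧ x ∉ φ.qvars ∧ φ.WF B

/-- The program that computes the truth value of a formula in the variable `o`, using the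
variables above `o` as scratch space. -/
def Fm.prog : Fm → ℕ → Prog
  | .atom e, o => .assign o (.lt (.const 0) e)
  | .and φ ψ, o => .seq (φ.prog o) (.seq (ψ.prog (o + 1))
      (.assign o (.mul (.var o) (.var (o + 1)))))
  | .neg φ, o => .seq (φ.prog o) (.assign o (.sub (.const 1) (.var o)))
  | .ex x b φ, o => .seq (.assign o (.const 0)) (.seq
      (forP x b (.seq (φ.prog (o + 1))
        (.assign o (.lt (.const 0) (.add (.var o) (.var (o + 1)))))))
      (.assign x (.const 0)))

def Fm.cost (N : ℕ) : Fm → ℕ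
  | .atom e => e.cost + 3
  | .and φ ψ => φ.cost N + ψ.cost N + 4
  | .neg φ => φ.cost N + 4
  | .ex _ _ φ => N * (φ.cost N + 14) + 10

/-- Two states agree on the arrays and on all variables less than `B`. -/
def Agree (B : ℕ) (s s' : State) : Prop := (∀ y < B, s'.var y = s.var y) ∧ s'.arr = s.arr

theorem Agree.setV {B : ℕ} {s s' : State} (h : Agree B s s') (x i : ℕ) :
    Agree B (s.setV x i) (s'.setV x i) :=
  ⟨fun y hy => by simp [h.1 y hy], h.2⟩

theorem Expr.eval_congr {B : ℕ} {s s' : State} (h : Agree B s s') (e : Expr) (he : e.VarsLt B) :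
    e.eval s' = e.eval s := by
  induction e with
  | const c => rfl
  | var x => exact h.1 x he
  | read a i ih => simp only [Expr.eval, ih he, h.2]
  | add e f ih₁ ih₂ | sub e f ih₁ ih₂ | mul e f ih₁ ih₂ | lt e f ih₁ ih₂ | eq e f ih₁ ih₂ =>
    simp only [Expr.eval, ih₁ he.1, ih₂ he.2]

theorem Expr.fits_congr {W B : ℕ} {s s' : State} (h : Agree B s s') (e : Expr)
    (he : e.VarsLt B) : e.Fits W s' ↔ e.Fits W s := by
  induction e with
  | const c => rfl
  | var x => simp only [Expr.Fits, h.1 x he]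
  | read a i ih => simp only [Expr.Fits, ih he, h.2, Expr.eval_congr h i he]
  | add e f ih₁ ih₂ | sub e f ih₁ ih₂ | mul e f ih₁ ih₂ | lt e f ih₁ ih₂ | eq e f ih₁ ih₂ =>
    simp only [Expr.Fits, ih₁ he.1, ih₂ he.2, Expr.eval_congr h e he.1, Expr.eval_congr h f he.2]

theorem Fm.holds_congr {B : ℕ} (φ : Fm) (hφ : φ.WF B) {s s' : State} (h : Agree B s s') :
    φ.Holds s' ↔ φ.Holds s := by
  induction φ generalizing s s' with
  | atom e => simp only [Fm.Holds, Expr.eval_congr h e hφ]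
  | and φ ψ ih₁ ih₂ => simp only [Fm.Holds, ih₁ hφ.1 h, ih₂ hφ.2 h]
  | neg φ ih => simp only [Fm.Holds, ih hφ h]
  | ex x b φ ih =>
    simp only [Fm.Holds, h.1 b hφ.2.1]
    exact exists_congr fun i => and_congr_right fun _ => ih hφ.2.2.2.2 (h.setV x i)

theorem Fm.fits_congr {W N B : ℕ} (φ : Fm) (hφ : φ.WF B) {s s' : State} (h : Agree B s s') :
    φ.Fits W N s' ↔ φ.Fits W N s := by
  induction φ generalizing s s' with
  | atom e => exact Expr.fits_congr h e hφ
  | and φ ψ ih₁ ih₂ => simp only [Fm.Fits, ih₁ hφ.1 h, ih₂ hφ.2 h]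
  | neg φ ih => exact ih hφ h
  | ex x b φ ih =>
    simp only [Fm.Fits, h.1 b hφ.2.1]
    exact and_congr_right fun _ => forall_congr' fun i => imp_congr_right fun _ =>
      ih hφ.2.2.2.2 (h.setV x i)

theorem Fm.qvars_lt {B : ℕ} (φ : Fm) (hφ : φ.WF B) : ∀ x ∈ φ.qvars, x < B := by
  induction φ with
  | atom e => simp [Fm.qvars]
  | and φ ψ ih₁ ih₂ =>
    intro x hx
    rcases List.mem_append.1 hx with h | h
    · exact ih₁ hφ.1 x h
    · exact ih₂ hφ.2 x h
  | neg φ ih => exact ih hφ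
  | ex x b φ ih =>
    intro y hy
    rcases List.mem_cons.1 hy with rfl | h
    · exact hφ.1
    · exact ih hφ.2.2.2.2 y h

-- Only variables from `o` on serve as scratch space, so nested formulas move `o` up instead of
-- saving values. Quantified variables are assumed to be `0` at the start because each loop resets
-- its variable to `0`; this makes the final state agree with the initial one on everything below
-- `o`.
open Classical in
theorem Fm.runs_prog {W N B : ℕ} (hN : N ≤ W) (hW : 2 ≤ W) (φ : Fm) (hφ : φ.WF B) {o : ℕ}
    (ho : B ≤ o) {s : State} (hs : φ.Fits W N s) (hq : ∀ x ∈ φ.qvars, s.var x = 0) :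
    Runs W (φ.prog o) s (φ.cost N)
      (fun s' => Agree o s s' ∧ s'.var o = if φ.Holds s then 1 else 0) := by
  induction φ generalizing o s with
  | atom e =>
    refine (Runs.assign (e := .lt (.const 0) e) ?_ ?_).mono ?_ (fun _ h => h)
    · exact ⟨Nat.zero_le _, hs, by omega⟩
    · refine ⟨⟨fun y hy => by simp [hy.ne], rfl⟩, ?_⟩
      simp only [State.setV_var, if_true, Expr.eval, Fm.Holds, Nat.pos_iff_ne_zero]
      congr
    · simp only [Expr.cost, Fm.cost]
      omega
  | and φ ψ ih₁ ih₂ =>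
    have hq₁ : ∀ x ∈ φ.qvars, s.var x = 0 := fun x hx => hq x (by simp [Fm.qvars, hx])
    have hq₂ : ∀ x ∈ ψ.qvars, s.var x = 0 := fun x hx => hq x (by simp [Fm.qvars, hx])
    refine (Runs.seq ((ih₁ hφ.1 ho hs.1 hq₁).mono le_rfl fun s₁ h₁ =>
      Runs.seq (t₁ := ψ.cost N) (t₂ := 4) ?_)).mono (by simp only [Fm.cost]; omega) fun _ h => h
    obtain ⟨ha₁, hv₁⟩ := h₁
    have hB : Agree B s s₁ := ⟨fun y hy => ha₁.1 y (by omega), ha₁.2⟩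
    -- The second conjunct is evaluated one place higher, so the value of the first one in `o`
    -- survives.
    refine (ih₂ hφ.2 (o := o + 1) (by omega) ((Fm.fits_congr ψ hφ.2 hB).2 hs.2) ?_).mono le_rfl ?_
    · intro x hx
      rw [hB.1 x (Fm.qvars_lt ψ hφ.2 x hx), hq₂ x hx]
    rintro s₂ ⟨ha₂, hv₂⟩
    have hv₃ : s₂.var o = if φ.Holds s then 1 else 0 := by rw [ha₂.1 o (by omega), hv₁]
    rw [Fm.holds_congr ψ hφ.2 hB] at hv₂
    refine (Runs.assign ?_ ?_)
    · simp only [Expr.Fits, Expr.eval, hv₃, hv₂]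
      split_ifs <;> simp <;> omega
    · refine ⟨⟨fun y hy => ?_, ?_⟩, ?_⟩
      · simp [hy.ne, ha₂.1 y (by omega), ha₁.1 y hy]
      · simp [ha₂.2, ha₁.2]
      · simp only [State.setV_var, if_true, Expr.eval, hv₃, hv₂, Fm.Holds]
        split_ifs <;> simp_all
  | neg φ ih =>
    refine (Runs.seq (t₂ := 4) ((ih hφ ho hs hq).mono le_rfl fun s₁ h₁ => ?_)).mono
      (by simp only [Fm.cost]; omega) fun _ h => h
    obtain ⟨ha₁, hv₁⟩ := h₁
    refine (Runs.assign ?_ ?_)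
    · simp only [Expr.Fits, hv₁]
      split_ifs <;> simp <;> omega
    · refine ⟨⟨fun y hy => ?_, ?_⟩, ?_⟩
      · simp [hy.ne, ha₁.1 y hy]
      · simp [ha₁.2]
      · simp only [State.setV_var, if_true, Expr.eval, hv₁, Fm.Holds]
        split_ifs <;> simp_all
  | ex x b φ ih =>
    obtain ⟨hxB, hbB, hbx, hxq, hφ'⟩ := hφ
    obtain ⟨hbN, hfit⟩ := hs
    have hx0 : s.var x = 0 := hq x (by simp [Fm.qvars])
    refine (Runs.seq (t₁ := 2) (t₂ := s.var b * (φ.cost N + 6 + 8) + 6 + 2)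
      (Runs.assign (by simp [Expr.Fits]) (Runs.seq ?_))).mono ?_ fun _ h => h
    -- After `i` rounds `o` holds the disjunction over the first `i` values of `x`; only `x` itself
    -- may differ from the initial state below `o`.
    · refine (Runs.forP_of_invariant (N := s.var b) (fun i s' => s'.var x = i ∧
        (∀ y < o, y ≠ x → s'.var y = s.var y) ∧ s'.arr = s.arr ∧
          s'.var o = if ∃ j < i, φ.Holds (s.setV x j) then 1 else 0) (by omega) (by omega)
          ?_ ?_ ?_).mono le_rfl ?_
      · refine ⟨by simp, fun y hy hyx => by simp [hyx, hy.ne], rfl, ?_⟩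
        have : o ≠ x := by omega
        simp [this, Expr.eval]
      · rintro i s₁ ⟨h1, h2, -⟩
        exact ⟨h1, h2 b (by omega) hbx⟩
      · rintro i s₁ hi ⟨h1, h2, h3, h4⟩
        have hA : Agree B (s.setV x i) s₁ := by
          refine ⟨fun y hy => ?_, h3⟩
          by_cases hyx : y = x
          · simp [hyx, h1]
          · simp [hyx, h2 y (by omega) hyx]
        refine (Runs.seq (t₂ := 6) ((ih hφ' (o := o + 1) (by omega)
          ((Fm.fits_congr φ hφ' hA).2 (hfit i hi)) ?_).mono le_rfl fun s₂ h => ?_)).mono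
          (by omega) fun _ h => h
        · intro y hy
          have hyx : y ≠ x := fun h => hxq (h ▸ hy)
          rw [h2 y (by have := Fm.qvars_lt φ hφ' y hy; omega) hyx]
          exact hq y (by simp [Fm.qvars, hy])
        obtain ⟨ha₂, hv₂⟩ := h
        rw [Fm.holds_congr φ hφ' hA] at hv₂
        have hv₃ : s₂.var o = if ∃ j < i, φ.Holds (s.setV x j) then 1 else 0 := by
          rw [ha₂.1 o (by omega), h4]
        have hox : x ≠ o := by omega
        have hox' : o ≠ x := by omega
        refine Runs.assign ?_ ⟨?_, ?_, ?_, ?_, ?_⟩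
        · simp only [Expr.Fits, Expr.eval, hv₂, hv₃]
          split_ifs <;> simp <;> omega
        · simp [hox, ha₂.1 x (by omega), h1]
        · simp
        · intro y hy hyx
          simp [hyx, hy.ne, ha₂.1 y (by omega), h2 y hy hyx]
        · simp [ha₂.2, h3]
        · simp only [State.setV_var, if_true, if_neg hox', Expr.eval, hv₂, hv₃]
          have hex : (∃ j < i + 1, φ.Holds (s.setV x j)) ↔
              (∃ j < i, φ.Holds (s.setV x j)) ∨ φ.Holds (s.setV x i) := by
            constructor
            · rintro ⟨j, hj, h⟩
              rcases Nat.lt_succ_iff_lt_or_eq.1 hj with h' | rfl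
              · exact Or.inl ⟨j, h', h⟩
              · exact Or.inr h
            · rintro (⟨j, hj, h⟩ | h)
              · exact ⟨j, by omega, h⟩
              · exact ⟨i, by omega, h⟩
          by_cases hp : ∃ j < i, φ.Holds (s.setV x j)
          · rw [if_pos hp, if_pos (hex.2 (Or.inl hp)), if_pos (by omega)]
          · rw [if_neg hp]
            by_cases hr : φ.Holds (s.setV x i)
            · rw [if_pos hr, if_pos (hex.2 (Or.inr hr)), if_pos (by omega)]
            · rw [if_neg hr, if_neg fun h => (hex.1 h).elim hp hr, if_neg (by omega)]
      · rintro s₁ ⟨h1, h2, h3, h4⟩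
        -- Resetting `x` restores its original value, which is `0` by `hx0`.
        refine Runs.assign (by simp [Expr.Fits]) ⟨⟨fun y hy => ?_, ?_⟩, ?_⟩
        · by_cases hyx : y = x
          · simp [hyx, Expr.eval, hx0]
          · simp [hyx, h2 y hy hyx]
        · simp [h3]
        · have : o ≠ x := by omega
          simp only [State.setV_var, if_neg this, h4, Fm.Holds]
          congr
    · simp only [Fm.cost]
      have := Nat.mul_le_mul_right (φ.cost N + 14) hbN
      simp only [Nat.add_assoc, Nat.reduceAdd] at this ⊢
      omega


/-! ## Shortest paths as lists of vertices -/

section Lists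

variable {V : Type} {G : SimpleGraph V}

theorem dist_getVert_add_le (hG : G.Connected) {u v : V} (p : G.Walk u v) (i m : ℕ)
    (h : i + m ≤ p.length) : G.dist (p.getVert i) (p.getVert (i + m)) ≤ m := by
  induction m with
  | zero => simp
  | succ m ih =>
    have h1 : G.Adj (p.getVert (i + m)) (p.getVert (i + m + 1)) :=
      p.adj_getVert_succ (by omega)
    have h2 := hG.dist_triangle (u := p.getVert i) (v := p.getVert (i + m))
      (w := p.getVert (i + m + 1))
    have h3 := SimpleGraph.dist_eq_one_iff_adj.2 h1
    have := ih (by omega)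
    rw [← Nat.add_assoc]
    omega

/-- Consecutive vertices are adjacent, so the distances from the start to place `i`, from `i` to
`j`, and from `j` to the end are at most the differences of the places. These add up to the distance
of the ends, so the triangle inequality makes all of them equalities. -/
theorem isShortestPath_iff (hG : G.Connected) (P : List V) :
    IsShortestPath G P ↔ P ≠ [] ∧ ∀ (i j : ℕ) (hij : i ≤ j) (hj : j < P.length),
      G.dist (P[i]'(by omega)) P[j] = j - i := by
  constructor
  · rintro ⟨u, v, p, hp, rfl⟩
    refine ⟨p.support_ne_nil, fun i j hij hj => ?_⟩
    rw [p.length_support] at hj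
    simp only [SimpleGraph.Walk.support_getElem_eq_getVert]
    have h1 := dist_getVert_add_le hG p i (j - i) (by omega)
    have h2 := dist_getVert_add_le hG p 0 i (by omega)
    have h3 := dist_getVert_add_le hG p j (p.length - j) (by omega)
    rw [show i + (j - i) = j by omega] at h1
    rw [show j + (p.length - j) = p.length by omega, p.getVert_length] at h3
    rw [Nat.zero_add, p.getVert_zero] at h2
    have h4 := hG.dist_triangle (u := u) (v := p.getVert i) (w := v)
    have h5 := hG.dist_triangle (u := p.getVert i) (v := p.getVert j) (w := v)
    omega
  · rintro ⟨hne, h⟩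
    have hlen := List.length_pos_iff.2 hne
    have hc : P.IsChain G.Adj := by
      rw [List.isChain_iff_getElem]
      intro i hi
      exact SimpleGraph.dist_eq_one_iff_adj.1 (by rw [h i (i + 1) (by omega) hi]; omega)
    refine ⟨_, _, .ofSupport P hne hc, ?_, SimpleGraph.Walk.support_ofSupport hne hc⟩
    rw [SimpleGraph.Walk.length_ofSupport, List.head_eq_getElem, List.getLast_eq_getElem,
      h 0 (P.length - 1) (by omega) (by omega)]
    omega

theorem pathEcc_le_iff (hG : G.Connected) {P : List V} (k : ℕ) :
    pathEcc G P ≤ k ↔ ∀ u, ∃ s ∈ P, G.dist u s ≤ k := by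
  simp only [pathEcc, setEcc, distToSet, iSup_le_iff]
  refine forall_congr' fun u => ⟨fun h => ?_, ?_⟩
  · by_contra! hc
    have : ((k + 1 : ℕ) : ℕ∞) ≤ ⨅ s ∈ {v | v ∈ P}, G.edist u s := by
      refine le_iInf₂ fun s hs => ?_
      rw [← (hG u s).coe_dist_eq_edist]
      exact_mod_cast hc s hs
    have := this.trans h
    norm_cast at this
    omega
  · rintro ⟨s, hs, h⟩
    refine (iInf₂_le s hs).trans ?_
    rw [← (hG u s).coe_dist_eq_edist]
    exact_mod_cast h

/-- Lets eccentricities be compared through natural bounds `k`, for which `pathEcc_le_iff` describes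
them without infima. -/
theorem pathEcc_le_of_forall (P Q : List V)
    (h : ∀ k : ℕ, pathEcc G Q ≤ k → pathEcc G P ≤ k) : pathEcc G P ≤ pathEcc G Q := by
  cases hQ : pathEcc G Q with
  | top => exact le_top
  | coe k => exact h k hQ.le

theorem isShortestPath_pair {a b : V} (h : G.Adj a b) :
    IsShortestPath G [a, b] :=
  ⟨a, b, .cons h .nil, by simp [SimpleGraph.dist_eq_one_iff_adj.2 h], by simp⟩

theorem IsShortestPath.dist_getElem (hG : G.Connected) {P : List V} (hP : IsShortestPath G P)
    {i j : ℕ} (hi : i < P.length) (hj : j < P.length) :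
    G.dist P[i] P[j] = (j - i) + (i - j) := by
  rcases le_total i j with h | h
  · rw [((isShortestPath_iff hG P).1 hP).2 i j h hj]
    omega
  · rw [SimpleGraph.dist_comm, ((isShortestPath_iff hG P).1 hP).2 j i h hi]
    omega

theorem IsShortestPath.ne_nil {P : List V} (hP : IsShortestPath G P) : P ≠ [] := by
  obtain ⟨u, v, p, -, rfl⟩ := hP
  exact p.support_ne_nil

/-- A map that preserves the distances between the vertices of a shortest path maps it to a
shortest path. -/
theorem IsShortestPath.map {V' : Type} {G' : SimpleGraph V'} (hG : G.Connected)
    (hG' : G'.Connected) {P : List V} (hP : IsShortestPath G P) (g : V → V')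
    (h : ∀ x ∈ P, ∀ y ∈ P, G'.dist (g x) (g y) = G.dist x y) : IsShortestPath G' (P.map g) := by
  rw [isShortestPath_iff hG] at hP
  rw [isShortestPath_iff hG']
  refine ⟨by simpa using hP.1, fun i j hij hj => ?_⟩
  simp only [List.length_map] at hj
  simp only [List.getElem_map]
  rw [h _ (List.getElem_mem _) _ (List.getElem_mem _), hP.2 i j hij hj]

end Lists

/-! ## Graphs with a partition into modules -/

section Modules

/-- `f` maps the vertices of the connected graph `G` to the vertices of the pattern `T` in such a
way that `G` is the substitution of the vertices of `T` by the (nonempty) fibres of `f`. -/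
structure IsSubst {V ι : Type} (G : SimpleGraph V) (T : SimpleGraph ι) (f : V → ι) : Prop where
  connected : G.Connected
  surj : Function.Surjective f
  adj : ∀ x y, f x ≠ f y → (G.Adj x y ↔ T.Adj (f x) (f y))
  third : ∀ i j : ι, ∃ l, l ≠ i ∧ l ≠ j

namespace IsSubst

/-! ### Distances in a substitution. -/

variable {V ι : Type} {G : SimpleGraph V} {T : SimpleGraph ι} {f : V → ι}

/-- A step inside a module projects to no step at all. -/
theorem exists_walk_proj (h : IsSubst G T f) {x y : V} (p : G.Walk x y) :
    ∃ q : T.Walk (f x) (f y), q.length ≤ p.length := by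
  induction p with
  | nil => exact ⟨.nil, le_rfl⟩
  | @cons u v w hadj p ih =>
    obtain ⟨q, hq⟩ := ih
    by_cases huv : f u = f v
    · refine ⟨q.copy huv.symm rfl, ?_⟩
      simp only [SimpleGraph.Walk.length_copy, SimpleGraph.Walk.length_cons]
      omega
    · refine ⟨.cons ((h.adj u v huv).1 hadj) q, ?_⟩
      simp only [SimpleGraph.Walk.length_cons]
      omega

/-- Interior vertices of the lift are arbitrary. Distinct ends are needed: two vertices of one
module can be at distance two while the walk in the pattern is empty. -/
theorem exists_walk_lift (h : IsSubst G T f) {i j : ι} (q : T.Walk i j) (hij : i ≠ j) :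
    ∀ x y, f x = i → f y = j → ∃ p : G.Walk x y, p.length ≤ q.length := by
  induction q with
  | nil => exact absurd rfl hij
  | @cons u v w hadj q ih =>
    rintro x y rfl rfl
    by_cases hv : v = f y
    · subst hv
      exact ⟨.cons ((h.adj x y hij).2 hadj) .nil, by simp⟩
    · obtain ⟨z, rfl⟩ := h.surj v
      obtain ⟨p, hp⟩ := ih hv z y rfl rfl
      exact ⟨.cons ((h.adj x z hadj.ne).2 hadj) p, by simpa using hp⟩

theorem pattern_connected (h : IsSubst G T f) : T.Connected := by
  have : Nonempty ι := h.connected.nonempty.map f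
  refine ⟨fun i j => ?_⟩
  obtain ⟨x, rfl⟩ := h.surj i
  obtain ⟨y, rfl⟩ := h.surj j
  obtain ⟨p⟩ := h.connected x y
  exact ⟨(h.exists_walk_proj p).choose⟩

theorem dist_eq (h : IsSubst G T f) {x y : V} (hxy : f x ≠ f y) : G.dist x y = T.dist (f x) (f y) := by
  refine le_antisymm ?_ ?_
  · obtain ⟨q, hq⟩ := h.pattern_connected.exists_walk_length_eq_dist (f x) (f y)
    obtain ⟨p, hp⟩ := h.exists_walk_lift q hxy x y rfl rfl
    exact (SimpleGraph.dist_le p).trans (hp.trans hq.le)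
  · obtain ⟨p, hp⟩ := h.connected.exists_walk_length_eq_dist x y
    obtain ⟨q, hq⟩ := h.exists_walk_proj p
    exact (SimpleGraph.dist_le q).trans (hq.trans hp.le)

theorem dist_congr (h : IsSubst G T f) {x x' y : V} (hx : f x = f x') (hxy : f x ≠ f y) :
    G.dist x y = G.dist x' y := by
  rw [h.dist_eq hxy, h.dist_eq (hx ▸ hxy), hx]

theorem dist_congr_right (h : IsSubst G T f) {x y y' : V} (hy : f y = f y') (hxy : f x ≠ f y) :
    G.dist x y = G.dist x y' := by
  rw [h.dist_eq hxy, h.dist_eq (hy ▸ hxy), hy]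

/-- A walk from `a` to another module leaves the module of `a` somewhere, and the first vertex
outside is adjacent to all of that module. -/
theorem exists_adj (h : IsSubst G T f) (a : V) : ∃ w, f w ≠ f a ∧ G.Adj a w := by
  obtain ⟨l, hl, -⟩ := h.third (f a) (f a)
  obtain ⟨y, rfl⟩ := h.surj l
  obtain ⟨p⟩ := h.connected a y
  obtain ⟨d, -, hd₁, hd₂⟩ := p.exists_boundary_dart {z | f z = f a} rfl hl
  refine ⟨d.snd, hd₂, ?_⟩
  have h1 : f d.fst = f a := hd₁
  rw [h.adj _ _ (Ne.symm hd₂), ← h1, ← h.adj _ _ (by rw [h1]; exact Ne.symm hd₂)]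
  exact d.adj

theorem adj_congr (h : IsSubst G T f) {x x' y : V} (hx : f x = f x') (hxy : f x ≠ f y) (ha : G.Adj x y) :
    G.Adj x' y := by
  rwa [h.adj _ _ (hx ▸ hxy), ← hx, ← h.adj _ _ hxy]

/-- A set that is contained in a module and a further vertex does not contain all vertices. -/
theorem not_forall_mem_module_or_eq (h : IsSubst G T f) (i : ι) (w : V) : ∃ z, f z ≠ i ∧ z ≠ w := by
  obtain ⟨l, hl, hl'⟩ := h.third i (f w)
  obtain ⟨z, rfl⟩ := h.surj l
  exact ⟨z, hl, fun hz => hl' (congrArg f hz)⟩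

/-! ### Shortest paths and modules. -/

/-- A shortest path with two vertices in a module has at most one vertex outside of it. -/
theorem subset_of_mem_of_mem (h : IsSubst G T f) {P : List V} (hP : IsShortestPath G P) {x y : V}
    (hx : x ∈ P) (hy : y ∈ P) (hxy : x ≠ y) (hf : f x = f y) :
    ∃ w, f w ≠ f x ∧ G.Adj x w ∧ ∀ z ∈ P, f z = f x ∨ z = w := by
  by_cases hall : ∀ z ∈ P, f z = f x
  · obtain ⟨w, hw, ha⟩ := h.exists_adj x
    exact ⟨w, hw, ha, fun z hz => Or.inl (hall z hz)⟩
  push Not at hall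
  obtain ⟨w, hw, hwx⟩ := hall
  obtain ⟨s, hs, rfl⟩ := List.mem_iff_getElem.1 hx
  obtain ⟨t, ht, rfl⟩ := List.mem_iff_getElem.1 hy
  have hst : s ≠ t := by
    rintro rfl
    exact hxy rfl
  -- A vertex outside the module has the same distance from both vertices of the module. Read in
  -- terms of places on the path, it must lie midway between places `s` and `t`.
  have key : ∀ (q : ℕ) (hq : q < P.length), f P[q] ≠ f P[s] →
      (q - s) + (s - q) = (q - t) + (t - q) := by
    intro q hq hne
    rw [← hP.dist_getElem h.connected hs hq, ← hP.dist_getElem h.connected ht hq]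
    exact h.dist_congr hf hne.symm
  obtain ⟨q, hq, rfl⟩ := List.mem_iff_getElem.1 hw
  refine ⟨P[q], hwx, ?_, fun z hz => ?_⟩
  -- The two vertices have a common neighbour outside the module, hence are at distance at most two;
  -- the midpoint is then adjacent to both.
  · obtain ⟨w, hw, ha⟩ := h.exists_adj P[s]
    have h1 := h.connected.dist_triangle (u := P[s]) (v := w) (w := P[t])
    rw [SimpleGraph.dist_eq_one_iff_adj.2 ha,
      SimpleGraph.dist_eq_one_iff_adj.2 (h.adj_congr hf hw.symm ha).symm,
      hP.dist_getElem h.connected hs ht] at h1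
    rw [← SimpleGraph.dist_eq_one_iff_adj, hP.dist_getElem h.connected hs hq]
    have := key q hq hwx
    omega
  · by_contra! hc
    obtain ⟨q', hq', rfl⟩ := List.mem_iff_getElem.1 hz
    have h1 := key q hq hwx
    have h2 := key q' hq' hc.1
    have : q' = q := by omega
    subst this
    exact hc.2 rfl

/-- Every shortest path can be replaced by one that has at least two vertices and at most one in
each module. -/
theorem exists_injOn (h : IsSubst G T f) {P : List V} (hP : IsShortestPath G P) :
    ∃ Q, IsShortestPath G Q ∧ 2 ≤ Q.length ∧ (∀ x ∈ Q, ∀ y ∈ Q, f x = f y → x = y) ∧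
      pathEcc G Q ≤ pathEcc G P := by
  by_cases hc : 2 ≤ P.length ∧ ∀ x ∈ P, ∀ y ∈ P, f x = f y → x = y
  · exact ⟨P, hP, hc.1, hc.2, le_rfl⟩
  -- In both bad cases, two vertices in a module or a path with a single vertex, all of `P` except
  -- possibly `w` lies in the module of `a`. The edge from `a` to `w` replaces `P`.
  obtain ⟨a, ha, w, hw, haw, hsub⟩ : ∃ a ∈ P, ∃ w, f w ≠ f a ∧ G.Adj a w ∧
      ∀ z ∈ P, f z = f a ∨ z = w := by
    by_cases h2 : 2 ≤ P.length
    · have : ¬ ∀ x ∈ P, ∀ y ∈ P, f x = f y → x = y := fun h' => hc ⟨h2, h'⟩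
      push Not at this
      obtain ⟨x, hx, y, hy, hf, hxy⟩ := this
      exact ⟨x, hx, h.subset_of_mem_of_mem hP hx hy hxy hf⟩
    · obtain ⟨a, rfl⟩ : ∃ a, P = [a] := by
        have := List.length_pos_iff.2 hP.ne_nil
        exact List.length_eq_one_iff.1 (by omega)
      obtain ⟨w, hw, ha⟩ := h.exists_adj a
      exact ⟨a, by simp, w, hw, ha, by simp⟩
  refine ⟨[a, w], isShortestPath_pair haw, by simp, ?_, ?_⟩
  · simp [hw, hw.symm]
  refine pathEcc_le_of_forall _ _ fun k hk => ?_
  rw [pathEcc_le_iff h.connected] at hk ⊢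
  -- With `k = 0` the path would contain every vertex, but a third module has a vertex that is
  -- neither in the module of `a` nor equal to `w`.
  have hk1 : 1 ≤ k := by
    by_contra! hk0
    obtain ⟨z, hz₁, hz₂⟩ := h.not_forall_mem_module_or_eq (f a) w
    obtain ⟨s, hs, hd⟩ := hk z
    have : z = s := (h.connected.dist_eq_zero_iff).1 (by omega)
    subst this
    exact (hsub z hs).elim hz₁ hz₂
  intro u
  by_cases hu : f u = f a
  · refine ⟨w, by simp, ?_⟩
    rwa [SimpleGraph.dist_eq_one_iff_adj.2 (h.adj_congr hu.symm hw.symm haw)]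
  · obtain ⟨s, hs, hd⟩ := hk u
    rcases hsub s hs with hsa | rfl
    · exact ⟨a, by simp, by rwa [← h.dist_congr_right hsa (hsa ▸ hu)]⟩
    · exact ⟨s, by simp, hd⟩

theorem exists_isMinEccShortestPath_injOn (h : IsSubst G T f) :
    ∃ P, IsMinEccShortestPath G P ∧ ∀ x ∈ P, ∀ y ∈ P, f x = f y → x = y := by
  obtain ⟨v⟩ := h.connected.nonempty
  have hne : {P | IsShortestPath G P}.Nonempty := ⟨[v], v, v, .nil, by simp, rfl⟩
  have hmin := Function.argminOn_mem (pathEcc G) {P | IsShortestPath G P} hne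
  obtain ⟨Q, hQ, -, hinj, hle⟩ := h.exists_injOn hmin
  exact ⟨Q, ⟨hQ, fun R hR => hle.trans (Function.argminOn_le (pathEcc G) _ hR)⟩, hinj⟩

/-- A path that is not contained in a module has a vertex that is adjacent to all of it. -/
theorem exists_mem_adj (h : IsSubst G T f) {P : List V} (hP : IsShortestPath G P) {p : V} (hp : p ∈ P)
    (hx : ∃ x ∈ P, f x ≠ f p) : ∃ w ∈ P, f w ≠ f p ∧ ∀ u, f u = f p → G.Adj u w := by
  obtain ⟨x, hx, hxp⟩ := hx
  obtain ⟨u, v, W, -, rfl⟩ := hP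
  -- The path has a vertex inside and one outside the module of `p`, so one of its edges crosses the
  -- boundary, in one direction or the other.
  suffices H : ∃ d ∈ W.darts, (f d.fst = f p ∧ f d.snd ≠ f p) ∨ (f d.fst ≠ f p ∧ f d.snd = f p) by
    obtain ⟨d, hd, ⟨h1, h2⟩ | ⟨h1, h2⟩⟩ := H
    · exact ⟨d.snd, W.dart_snd_mem_support_of_mem_darts hd, h2, fun u hu =>
        h.adj_congr (h1.trans hu.symm) (h1 ▸ h2.symm) d.adj⟩
    · exact ⟨d.fst, W.dart_fst_mem_support_of_mem_darts hd, h1, fun u hu =>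
        h.adj_congr (h2.trans hu.symm) (h2 ▸ h1.symm) d.adj.symm⟩
  classical
  by_cases hu : f u = f p
  · obtain ⟨d, hd, h1, h2⟩ := (W.takeUntil x hx).exists_boundary_dart {z | f z = f p} hu hxp
    exact ⟨d, W.darts_takeUntil_subset_darts hx hd, Or.inl ⟨h1, h2⟩⟩
  · obtain ⟨d, hd, h1, h2⟩ := (W.takeUntil p hp).exists_boundary_dart {z | f z ≠ f p} hu
      (by simp)
    exact ⟨d, W.darts_takeUntil_subset_darts hp hd, Or.inr ⟨h1, not_not.1 h2⟩⟩

/-- A neighbour `w` of the module on the path stays on it and serves the whole module within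
distance one; all other vertices have equal distances from `p` and `p'`. It remains to see that
neither eccentricity is `0` when `p ≠ p'`. -/
theorem pathEcc_exchange (h : IsSubst G T f) {P : List V} (hP : IsShortestPath G P) {p p' : V} (hp : p ∈ P)
    (hf : f p = f p') (hx : ∃ x ∈ P, f x ≠ f p) :
    pathEcc G (exchange P p p') = pathEcc G P := by
  classical
  obtain ⟨w, hw, hwp, hadj⟩ := h.exists_mem_adj hP hp hx
  by_cases hpp : p = p'
  · subst hpp
    have : (fun x => if x = p then p else x) = id := funext fun x => by
      by_cases hx : x = p <;> simp [hx]
    rw [exchange, this, List.map_id]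
  have hmem : ∀ z ∈ P, z ≠ p → z ∈ exchange P p p' := fun z hz hzp =>
    List.mem_map.2 ⟨z, hz, by simp [hzp]⟩
  have hmem' : p' ∈ exchange P p p' := List.mem_map.2 ⟨p, hp, by simp⟩
  refine le_antisymm (pathEcc_le_of_forall _ _ fun k hk => ?_)
    (pathEcc_le_of_forall _ _ fun k hk => ?_)
  · rw [pathEcc_le_iff h.connected] at hk ⊢
    -- If `P` contained all vertices, it would contain both `p` and `p'`, hence have at most one
    -- vertex outside their module, contrary to the existence of a third module.
    have hk1 : 1 ≤ k := by
      by_contra! hk0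
      have hall : ∀ z, z ∈ P := by
        intro z
        obtain ⟨s, hs, hd⟩ := hk z
        have : z = s := (h.connected.dist_eq_zero_iff).1 (by omega)
        exact this ▸ hs
      obtain ⟨w', -, -, hsub⟩ := h.subset_of_mem_of_mem hP hp (hall p') hpp hf
      obtain ⟨z, hz₁, hz₂⟩ := h.not_forall_mem_module_or_eq (f p) w'
      exact (hsub z (hall z)).elim hz₁ hz₂
    intro u
    by_cases hu : f u = f p
    · refine ⟨w, hmem w hw fun h' => hwp (congrArg f h'), ?_⟩
      rwa [SimpleGraph.dist_eq_one_iff_adj.2 (hadj u hu)]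
    · obtain ⟨s, hs, hd⟩ := hk u
      by_cases hsp : s = p
      · subst hsp
        exact ⟨p', hmem', by rwa [← h.dist_congr_right hf hu]⟩
      · exact ⟨s, hmem s hs hsp, hd⟩
  · rw [pathEcc_le_iff h.connected] at hk ⊢
    have hcase : ∀ z ∈ exchange P p p', z = p' ∨ z ∈ P ∧ z ≠ p := by
      intro z hz
      obtain ⟨y, hy, rfl⟩ := List.mem_map.1 hz
      by_cases hyp : y = p
      · simp [hyp]
      · simp [hyp, hy]
    -- The vertex `p` no longer occurs after the exchange, so the eccentricity is not `0`.
    have hk1 : 1 ≤ k := by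
      by_contra! hk0
      obtain ⟨s, hs, hd⟩ := hk p
      have : p = s := (h.connected.dist_eq_zero_iff).1 (by omega)
      subst this
      exact (hcase p hs).elim hpp fun h' => h'.2 rfl
    intro u
    by_cases hu : f u = f p
    · refine ⟨w, hw, ?_⟩
      rwa [SimpleGraph.dist_eq_one_iff_adj.2 (hadj u hu)]
    · obtain ⟨s, hs, hd⟩ := hk u
      rcases hcase s hs with rfl | hs'
      · exact ⟨p, hp, by rwa [h.dist_congr_right hf hu]⟩
      · exact ⟨s, hs'.1, hd⟩

theorem isShortestPath_exchange (h : IsSubst G T f) {P : List V} (hP : IsShortestPath G P) {p p' : V}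
    (hf : f p = f p') (honly : ∀ x ∈ P, f x = f p → x = p) :
    IsShortestPath G (exchange P p p') := by
  refine hP.map h.connected h.connected _ fun x hx y hy => ?_
  by_cases hxp : x = p <;> by_cases hyp : y = p
  · simp [hxp, hyp]
  · have : f p ≠ f y := fun h' => hyp (honly y hy h'.symm)
    simp [hxp, hyp, h.dist_congr hf this]
  · have : f x ≠ f p := fun h' => hxp (honly x hx h')
    simp [hxp, hyp, h.dist_congr_right hf this]
  · simp [hxp, hyp]

/-- It suffices to consider the shortest paths of the pattern and one vertex of each module. -/
theorem yesInstance_iff (h : IsSubst G T f) {r : ι → V} (hr : ∀ i, f (r i) = i) (k : ℕ) :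
    YesInstance G k ↔ ∃ π : List ι, IsShortestPath T π ∧ 2 ≤ π.length ∧
      IsShortestPath G (π.map r) ∧ pathEcc G (π.map r) ≤ k := by
  constructor
  · rintro ⟨P₀, hP₀, hk₀⟩
    obtain ⟨P, hP, hlen, hinj, hle⟩ := h.exists_injOn hP₀
    have hk := hle.trans hk₀
    have hne : ∀ x ∈ P, ∀ y ∈ P, x ≠ y → f x ≠ f y := fun x hx y hy hxy hf =>
      hxy (hinj x hx y hy hf)
    refine ⟨P.map f, ?_, by simpa using hlen, ?_, ?_⟩
    · refine hP.map h.connected h.pattern_connected f fun x hx y hy => ?_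
      by_cases hxy : x = y
      · simp [hxy]
      · rw [h.dist_eq (hne x hx y hy hxy)]
    · rw [List.map_map]
      refine hP.map h.connected h.connected _ fun x hx y hy => ?_
      by_cases hxy : x = y
      · simp [hxy]
      · rw [h.dist_eq (hne x hx y hy hxy), h.dist_eq] <;> simp [hr, hne x hx y hy hxy]
    · rw [pathEcc_le_iff h.connected] at hk ⊢
      rw [List.map_map]
      intro u
      obtain ⟨s, hs, hd⟩ := hk u
      have hmem : ∀ s ∈ P, r (f s) ∈ P.map (r ∘ f) := fun s hs => List.mem_map.2 ⟨s, hs, rfl⟩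
      -- The representative of the module of `s` may be farther from `u` than `s` only if `u` lies
      -- in that module. Then the path, which leaves the module, offers a neighbour `w` outside, and
      -- its representative is adjacent to `u`.
      by_cases hus : f u = f s
      · by_cases hur : u = r (f s)
        · exact ⟨_, hmem s hs, by simp [← hur]⟩
        have hx : ∃ x ∈ P, f x ≠ f s := by
          by_contra! hc
          have h01 := hinj _ (List.getElem_mem (l := P) (n := 0) (by omega)) _
            (List.getElem_mem (l := P) (n := 1) (by omega))
            ((hc _ (List.getElem_mem _)).trans (hc _ (List.getElem_mem _)).symm)
          have := hP.dist_getElem h.connected (i := 0) (j := 1) (by omega) (by omega)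
          rw [h01] at this
          simp at this
        -- For `k = 0` the path contains the representative of the module; having one vertex in the
        -- module, it gives `u = s = r (f s)`, which was excluded.
        have hk1 : 1 ≤ k := by
          by_contra! hk0
          obtain ⟨s', hs', hd'⟩ := hk (r (f s))
          have h1 : r (f s) = s' := (h.connected.dist_eq_zero_iff).1 (by omega)
          have h2 : u = s := (h.connected.dist_eq_zero_iff).1 (by omega)
          have h3 := hinj s' hs' s hs (by rw [← h1, hr])
          exact hur (by rw [h1, h3, h2])
        obtain ⟨w, hw, hws, hadj⟩ := h.exists_mem_adj hP hs hx
        refine ⟨_, hmem w hw, ?_⟩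
        rw [← h.dist_congr_right (y := w) (by rw [hr]) (by rw [hus]; exact hws.symm),
          SimpleGraph.dist_eq_one_iff_adj.2 (hadj u hus)]
        exact hk1
      · refine ⟨_, hmem s hs, ?_⟩
        rwa [← h.dist_congr_right (y := s) (by rw [hr]) hus]
  · rintro ⟨π, -, -, hP, hk⟩
    exact ⟨_, hP, hk⟩

end IsSubst

theorem isSubst_substGraph {ι : Type} [Fintype ι] {T : SimpleGraph ι} {V : ι → Type}
    [∀ i, Nonempty (V i)] {H : ∀ i, SimpleGraph (V i)} (hι : 3 ≤ Fintype.card ι)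
    (hG : (substGraph T H).Connected) : IsSubst (substGraph T H) T Sigma.fst where
  connected := hG
  surj i := ⟨⟨i, Classical.arbitrary _⟩, rfl⟩
  adj := by
    rintro x y hxy
    refine ⟨?_, Or.inl⟩
    rintro (h | ⟨i, a, b, -, rfl, rfl⟩)
    · exact h
    · exact absurd rfl hxy
  third i j := by
    classical
    by_contra! hc
    have : (Finset.univ : Finset ι) ⊆ {i, j} := by
      intro l _
      by_cases hl : l = i
      · simp [hl]
      · simp [hc l hl]
    have := (Finset.card_le_card this).trans Finset.card_le_two
    rw [Finset.card_univ] at this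
    omega

end Modules

/-! ## Modules and the modular width -/

section Width

variable {V : Type} {G : SimpleGraph V}

/-- The vertices outside of `M` do not distinguish between the vertices of `M`. -/
def IsModule (G : SimpleGraph V) (M : Set V) : Prop :=
  ∀ x ∉ M, ∀ a ∈ M, ∀ b ∈ M, G.Adj x a → G.Adj x b

/-- Some module other than the set of all vertices contains both vertices. -/
def Together (G : SimpleGraph V) (a b : V) : Prop :=
  ∃ M, IsModule G M ∧ a ∈ M ∧ b ∈ M ∧ ∃ z, z ∉ M

/-- Some vertex or edge dominates the graph. -/
def Dominated (G : SimpleGraph V) : Prop :=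
  ∃ u v, (u = v ∨ G.Adj u v) ∧ ∀ x, (u = x ∨ G.Adj u x) ∨ (v = x ∨ G.Adj v x)

theorem Together.symm {a b : V} (h : Together G a b) : Together G b a := by
  obtain ⟨M, hM, ha, hb, hz⟩ := h
  exact ⟨M, hM, hb, ha, hz⟩

theorem Together.refl (hD : ¬ Dominated G) (a : V) : Together G a a := by
  refine ⟨{a}, ?_, rfl, rfl, ?_⟩
  · rintro x - _ rfl _ rfl h
    exact h
  · by_contra! hc
    exact hD ⟨a, a, Or.inl rfl, fun x => Or.inl (Or.inl (hc x).symm)⟩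

/-- Adjacency of an outer vertex passes from any vertex of the union to the common vertex `b`, and
from there to all others. -/
theorem IsModule.union {A B : Set V} (hA : IsModule G A) (hB : IsModule G B) {b : V}
    (hbA : b ∈ A) (hbB : b ∈ B) : IsModule G (A ∪ B) := by
  intro x hx y hy z hz hxy
  rw [Set.mem_union, not_or] at hx
  have hxb : G.Adj x b := hy.elim (fun h => hA x hx.1 y h b hbA hxy)
    fun h => hB x hx.2 y h b hbB hxy
  exact hz.elim (fun h => hA x hx.1 b hbA z h hxb) fun h => hB x hx.2 b hbB z h hxb

/-- Suppose that `A` and `B` cover the graph. An edge leaving `A` ends in some `t` in `B`, which is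
adjacent to all of `A`, in particular to a vertex `x` outside `B`. As `x` is adjacent to `t`, it is
adjacent to all of `B`, and the edge from `x` to `t` dominates the graph. -/
theorem exists_notMem_union (hG : G.Connected) (hD : ¬ Dominated G) {A B : Set V}
    (hA : IsModule G A) (hB : IsModule G B) (hA' : ∃ z, z ∉ A) (hB' : ∃ z, z ∉ B) :
    ∃ z, z ∉ A ∪ B := by
  by_contra! hc
  obtain ⟨y, hy⟩ := hA'
  obtain ⟨x, hx⟩ := hB'
  have hxA : x ∈ A := (hc x).resolve_right hx
  obtain ⟨p⟩ := hG x y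
  obtain ⟨d, -, hs, ht⟩ := p.exists_boundary_dart A hxA hy
  have htB : d.snd ∈ B := (hc _).resolve_left ht
  have htA : ∀ z ∈ A, G.Adj d.snd z := fun z hz => hA _ ht _ hs z hz d.adj.symm
  have hxt : G.Adj x d.snd := (htA x hxA).symm
  refine hD ⟨x, d.snd, Or.inr hxt, fun z => ?_⟩
  exact (hc z).elim (fun hz => Or.inr (Or.inr (htA z hz)))
    fun hz => Or.inl (Or.inr (hB x hx _ htB z hz hxt))

theorem Together.trans (hG : G.Connected) (hD : ¬ Dominated G) {a b c : V}
    (hab : Together G a b) (hbc : Together G b c) : Together G a c := by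
  obtain ⟨A, hA, ha, hb, hA'⟩ := hab
  obtain ⟨B, hB, hb', hc, hB'⟩ := hbc
  exact ⟨A ∪ B, hA.union hB hb hb', Or.inl ha, Or.inr hc, exists_notMem_union hG hD hA hB hA' hB'⟩

/-- Otherwise a maximal proper module containing `a` could be enlarged by its union with a proper
module containing `a` and a vertex outside. -/
theorem exists_not_together [Finite V] (hG : G.Connected) (hD : ¬ Dominated G) (a : V) :
    ∃ z, ¬ Together G z a := by
  by_contra! hc
  obtain ⟨M, hM, ha, -, hM'⟩ := Together.refl hD a
  obtain ⟨N, -, hN⟩ := (Set.toFinite {N | IsModule G N ∧ a ∈ N ∧ ∃ z, z ∉ N}).exists_le_maximal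
    ⟨hM, ha, hM'⟩
  obtain ⟨hNm, haN, z, hz⟩ := hN.prop
  obtain ⟨B, hB, hzB, haB, hB'⟩ := hc z
  have := hN.le_of_ge (y := N ∪ B) ⟨hNm.union hB haN haB, Or.inl haN,
    exists_notMem_union hG hD hNm hB ⟨z, hz⟩ hB'⟩ Set.subset_union_left
  exact hz (this (Or.inr hzB))

/-- The end of an edge in one module lies outside the module of the other end, so each end can be
moved within its module in turn. -/
theorem Together.adj_congr {x x' y y' : V} (hx : Together G x x')
    (hy : Together G y y') (hxy : ¬ Together G x y) (hx'y' : ¬ Together G x' y')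
    (h : G.Adj x' y') : G.Adj x y := by
  obtain ⟨M, hM, hxM, hxM', hM'⟩ := hx
  obtain ⟨N, hN, hyN, hyN', hN'⟩ := hy
  have h1 : y' ∉ M := fun hm => hx'y' ⟨M, hM, hxM', hm, hM'⟩
  have h2 : G.Adj y' x := hM y' h1 x' hxM' x hxM h.symm
  have h3 : x ∉ N := fun hm => hxy ⟨N, hN, hm, hyN, hN'⟩
  exact hN x h3 y' hyN' y hyN h2.symm

/-- The partition of a graph without dominating edges into maximal modules. -/
def togetherSetoid (hG : G.Connected) (hD : ¬ Dominated G) : Setoid V where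
  r := Together G
  iseqv := ⟨Together.refl hD, Together.symm, Together.trans hG hD⟩

theorem exists_isSubst [Finite V] (hG : G.Connected) (hD : ¬ Dominated G) :
    ∃ T : SimpleGraph (Quotient (togetherSetoid hG hD)),
      IsSubst G T (Quotient.mk (togetherSetoid hG hD)) := by
  have hadj : ∀ x y x' y', Together G x x' → Together G y y' → ¬ Together G x y →
      G.Adj x' y' → G.Adj x y := by
    intro x y x' y' hx hy hxy h
    have h1 : ¬ Together G x y' := fun h' => hxy (h'.trans hG hD hy.symm)
    exact Together.adj_congr hx hy hxy (fun h' => h1 (hx.trans hG hD h')) h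
  have hmk : ∀ x y, Quotient.mk (togetherSetoid hG hD) x = Quotient.mk _ y ↔ Together G x y :=
    fun x y => Quotient.eq
  let T : SimpleGraph (Quotient (togetherSetoid hG hD)) :=
    { Adj := fun i j => i ≠ j ∧ ∃ x y, Quotient.mk _ x = i ∧ Quotient.mk _ y = j ∧ G.Adj x y
      symm := ⟨by
        rintro i j ⟨hij, x, y, hx, hy, h⟩
        exact ⟨hij.symm, y, x, hy, hx, h.symm⟩⟩
      loopless := ⟨fun i hi => hi.1 rfl⟩ }
  refine ⟨T, hG, Quotient.mk_surjective, ?_, ?_⟩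
  · intro x y hxy
    refine ⟨fun h => ⟨hxy, x, y, rfl, rfl, h⟩, ?_⟩
    rintro ⟨-, x', y', hx, hy, h⟩
    rw [hmk] at hx hy
    exact hadj x y x' y' hx.symm hy.symm (fun h' => hxy ((hmk x y).2 h')) h
  -- If there were only the classes of `a` and `b`, one edge between them would make all pairs
  -- between them adjacent, and `a`, `b` would be a dominating edge.
  · intro i j
    obtain ⟨a, rfl⟩ := Quotient.mk_surjective i
    obtain ⟨b, rfl⟩ := Quotient.mk_surjective j
    by_contra! hc
    obtain ⟨z, hz⟩ := exists_not_together hG hD a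
    have hcl : ∀ l, ¬ Together G l a → Together G l b := fun l hl =>
      (hmk l b).1 (hc _ fun h => hl ((hmk l a).1 h))
    have hzb := hcl z hz
    have hab : ¬ Together G a b := fun h => hz (hzb.trans hG hD h.symm)
    obtain ⟨p⟩ := hG a b
    obtain ⟨d, -, hs, ht⟩ := p.exists_boundary_dart {l | Together G l a} (Together.refl hD a)
      fun h : Together G b a => hab h.symm
    have ht' := hcl _ ht
    have hs' : Together G d.fst a := hs
    refine hD ⟨a, b, Or.inr (hadj a b _ _ hs'.symm ht'.symm hab d.adj), fun x => ?_⟩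
    by_cases hx : Together G x a
    · refine Or.inr (Or.inr (hadj x b _ _ (hx.trans hG hD hs'.symm) ht'.symm ?_ d.adj).symm)
      exact fun h => hab (hx.symm.trans hG hD h)
    · refine Or.inl (Or.inr (hadj a x _ _ hs'.symm ((hcl x hx).trans hG hD ht'.symm) ?_ d.adj))
      exact fun h => hx h.symm

/-! ### The number of maximal modules is at most the modular width. -/

/-- There are at most `w` vertices no two of which are in a common module. -/
def FewModules (G : SimpleGraph V) (w : ℕ) : Prop :=
  G.Connected → ¬ Dominated G → ∀ R : Finset V,
    (∀ x ∈ R, ∀ y ∈ R, Together G x y → x = y) → R.card ≤ w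

theorem FewModules.of_iso {V' : Type} {G' : SimpleGraph V'} (e : G ≃g G') {w : ℕ}
    (h : FewModules G w) : FewModules G' w := by
  intro hG' hD' R hR
  have hadj : ∀ a b, G.Adj a b ↔ G'.Adj (e a) (e b) := fun a b => e.map_adj_iff.symm
  have := h (e.connected_iff.2 hG') ?_ (R.map e.symm.toEquiv.toEmbedding) ?_
  · simpa using this
  · rintro ⟨u, v, huv, hx⟩
    refine hD' ⟨e u, e v, ?_, fun x => ?_⟩
    · rwa [← hadj, e.injective.eq_iff]
    · obtain ⟨x, rfl⟩ := e.surjective x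
      rw [← hadj, ← hadj, e.injective.eq_iff, e.injective.eq_iff]
      exact hx x
  · intro x hxR y hyR hxy
    obtain ⟨x, hx, rfl⟩ := Finset.mem_map.1 hxR
    obtain ⟨y, hy, rfl⟩ := Finset.mem_map.1 hyR
    obtain ⟨M, hM, hxM, hyM, z, hz⟩ := hxy
    refine congrArg _ (hR x hx y hy ⟨{v | e.symm v ∈ M}, ?_, hxM, hyM, e z, by simpa using hz⟩)
    intro v hv a ha b hb hva
    have h1 := hM (e.symm v) hv _ ha _ hb
    rw [hadj, hadj] at h1
    simpa using h1 (by simpa using hva)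

theorem ModExpr.nonempty_carrier (A : ModExpr) : Nonempty A.Carrier := by
  induction A with
  | vertex => exact ⟨()⟩
  | union A B ihA _ => exact ihA.map Sum.inl
  | join A B ihA _ => exact ihA.map Sum.inl
  | subst r T A ih => exact (ih 0).map fun a => ⟨0, a⟩

theorem dominated_joinGraph {W : Type} [Nonempty V] [Nonempty W] (G : SimpleGraph V)
    (H : SimpleGraph W) : Dominated (joinGraph G H) := by
  obtain ⟨v⟩ := ‹Nonempty V›
  obtain ⟨w⟩ := ‹Nonempty W›
  have hadj : ∀ v w, (joinGraph G H).Adj (Sum.inl v) (Sum.inr w) := fun v w =>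
    Or.inr (by simp)
  refine ⟨Sum.inl v, Sum.inr w, Or.inr (hadj v w), ?_⟩
  rintro (x | x)
  · exact Or.inr (Or.inr (hadj x w).symm)
  · exact Or.inl (Or.inr (hadj v x))

theorem not_connected_sum {W : Type} [Nonempty V] [Nonempty W] (G : SimpleGraph V)
    (H : SimpleGraph W) : ¬ (SimpleGraph.sum G H).Connected := by
  obtain ⟨v⟩ := ‹Nonempty V›
  obtain ⟨w⟩ := ‹Nonempty W›
  intro h
  obtain ⟨p⟩ := h (Sum.inl v) (Sum.inr w)
  obtain ⟨d, -, hs, ht⟩ := p.exists_boundary_dart (Set.range Sum.inl) ⟨v, rfl⟩ (by simp)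
  obtain ⟨x, hx⟩ := hs
  have := d.adj
  rw [← hx] at this
  cases hd : d.snd with
  | inl y => exact ht ⟨y, hd.symm⟩
  | inr y => simp [hd] at this

theorem isModule_fibre {ι : Type} (T : SimpleGraph ι) {V : ι → Type}
    (H : ∀ i, SimpleGraph (V i)) (i : ι) : IsModule (substGraph T H) {x | x.1 = i} := by
  rintro x hx a rfl b hb (h | ⟨j, c, d, -, rfl, rfl⟩)
  · exact Or.inl (by rwa [show b.1 = a.1 from hb])
  · exact absurd rfl hx

/-- Only a substitution can be connected and undominated. With two or more operands each operand is
a proper module, so representatives of different classes belong to different operands. -/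
theorem ModExpr.fewModules (A : ModExpr) : FewModules A.graph A.width := by
  induction A with
  | vertex =>
    intro _ hD
    exact absurd ⟨(), (), Or.inl rfl, fun x => Or.inl (Or.inl rfl)⟩ hD
  | union A B _ _ =>
    have := A.nonempty_carrier
    have := B.nonempty_carrier
    exact fun hG => absurd hG (not_connected_sum A.graph B.graph)
  | join A B _ _ =>
    have := A.nonempty_carrier
    have := B.nonempty_carrier
    exact fun _ hD => absurd (dominated_joinGraph A.graph B.graph) hD
  | subst r T A ih =>
    rcases r with _ | r
    -- The single fibre is the whole graph, not a proper module. The graph is isomorphic to its only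
    -- operand, to which the induction hypothesis applies.
    · let _ : Unique (Fin (0 + 1)) := inferInstanceAs (Unique (Fin 1))
      have e : (A 0).graph ≃g substGraph T (fun i => (A i).graph) := by
        refine ⟨(Equiv.uniqueSigma fun i => (A i).Carrier).symm, ?_⟩
        intro a b
        constructor
        · rintro (h | ⟨i, a', b', h, ha, hb⟩)
          · exact absurd h (T.loopless.irrefl _)
          · obtain rfl := Subsingleton.elim 0 i
            obtain rfl := eq_of_heq (Sigma.mk.inj ha).2
            obtain rfl := eq_of_heq (Sigma.mk.inj hb).2
            exact h
        · exact fun h => Or.inr ⟨0, a, b, h, rfl, rfl⟩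
      intro hG hD R hR
      refine (FewModules.of_iso e (ih 0) hG hD R hR).trans ?_
      exact (Finset.le_sup (f := fun i => (A i).width) (Finset.mem_univ 0)).trans
        (le_max_right _ _)
    · intro hG hD R hR
      have hcard : R.card ≤ (Finset.univ : Finset (Fin (r + 1 + 1))).card := by
        refine Finset.card_le_card_of_injOn Sigma.fst (fun _ _ => Finset.mem_coe.2
          (Finset.mem_univ _)) fun x hx y hy hxy => ?_
        refine hR x hx y hy ⟨{z | z.1 = x.1}, isModule_fibre T _ x.1, rfl, hxy.symm, ?_⟩
        obtain ⟨j, hj⟩ := exists_ne x.1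
        obtain ⟨c⟩ := (A j).nonempty_carrier
        exact ⟨⟨j, c⟩, hj⟩
      rw [Finset.card_univ, Fintype.card_fin] at hcard
      exact hcard.trans (le_max_left _ _)

theorem card_le_modularWidth {n : ℕ} (hn : 0 < n) (G : SimpleGraph (Fin n)) :
    FewModules G (modularWidth G) := by
  obtain ⟨A, hA, ⟨e⟩⟩ := exists_modExpr hn G
  exact fun hG hD R hR => (FewModules.of_iso e A.fewModules hG hD R hR).trans hA

end Width

/-! ## The distance matrix -/

/-- Nested counting loops, with an invariant that is a property of the arrays. -/
theorem Runs.forP_forP {W x y b N t : ℕ} {p : Prog} {s₀ : State}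
    (I : ℕ → ℕ → (ℕ → ℕ → ℕ) → Prop)
    (hx : x ∉ p.wv) (hy : y ∉ p.wv) (hb : b ∉ p.wv) (hxy : x ≠ y) (hbx : b ≠ x) (hby : b ≠ y)
    (hbN : s₀.var b = N) (hN : N ≤ W) (hW : 1 ≤ W) (h0 : I 0 0 s₀.arr)
    (hcarry : ∀ i a, I i N a → I (i + 1) 0 a)
    (step : ∀ i j s, i < N → j < N → s.var x = i → s.var y = j →
      (∀ z, z ∉ p.wv → z ≠ x → z ≠ y → s.var z = s₀.var z) →
      (∀ a, a ∉ p.wa → s.arr a = s₀.arr a) → I i j s.arr →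
      Runs W p s t (fun s' => I i (j + 1) s'.arr)) :
    Runs W (MESP.forP x b (MESP.forP y b p)) s₀ (N * (N * (t + 8) + 14) + 6)
      (fun s' => I N 0 s'.arr) := by
  refine (Runs.forP (t := N * (t + 8) + 6) (fun i s => I i 0 s.arr) ?_ ?_ hbx hbN hN hW h0
    ?_).mono (by simp [Nat.add_assoc]) fun _ h => h
  · simp [MESP.forP, Prog.wv, hx, hxy]
  · simp [MESP.forP, Prog.wv, hb, hby]
  intro i s hi hxi hv ha hI
  have hv' : ∀ z, z ∉ p.wv → z ≠ x → z ≠ y → s.var z = s₀.var z := fun z h1 h2 h3 =>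
    hv z (by simp [MESP.forP, Prog.wv, h1, h3]) h2
  have ha' : ∀ a, a ∉ p.wa → s.arr a = s₀.arr a := fun a h1 =>
    ha a (by simp [MESP.forP, Prog.wa, h1])
  refine (Runs.forP (fun j s => I i j s.arr) hy hb hby
    ((hv' b hb hbx hby).trans hbN) hN hW hI ?_).mono le_rfl fun _ h => hcarry _ _ h
  intro j s₁ hj hyj hv₁ ha₁ hI₁
  exact step i j s₁ hi hj ((hv₁ x hx hxy).trans hxi) hyj
    (fun z h1 h2 h3 => (hv₁ z h1 h3).trans (hv' z h1 h2 h3))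
    (fun a h1 => (ha₁ a h1).trans (ha' a h1)) hI₁

theorem index_inj {n i j i' j' : ℕ} (hj : j < n) (hj' : j' < n) :
    i * n + j = i' * n + j' ↔ i = i' ∧ j = j' := by
  refine ⟨fun h => ?_, by rintro ⟨rfl, rfl⟩; rfl⟩
  have h1 : i = i' := by
    have h2 : (i * n + j) / n = i := by
      rw [mul_comm, Nat.mul_add_div (by omega), Nat.div_eq_of_lt hj, add_zero]
    have h3 : (i' * n + j') / n = i' := by
      rw [mul_comm, Nat.mul_add_div (by omega), Nat.div_eq_of_lt hj', add_zero]
    rw [← h2, ← h3, h]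
  subst h1
  exact ⟨rfl, by omega⟩

theorem index_lt {n i j : ℕ} (hi : i < n) (hj : j < n) : i * n + j < n * n := by
  have := Nat.mul_le_mul_right n (Nat.succ_le_of_lt hi)
  rw [Nat.succ_mul] at this
  omega

/-- The entry of the matrix in array `a` whose row and column are the values of `e` and `f`; the
number of rows is in variable `0`. -/
def Expr.entry (a : ℕ) (e f : Expr) : Expr := .read a (.add (.mul e (.var 0)) f)

theorem Expr.eval_entry (a : ℕ) (e f : Expr) (s : State) :
    (Expr.entry a e f).eval s = s.arr a (e.eval s * s.var 0 + f.eval s) := rfl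

theorem Expr.cost_entry (a : ℕ) (e f : Expr) :
    (Expr.entry a e f).cost = e.cost + f.cost + 4 := by
  simp only [Expr.entry, Expr.cost]
  omega

theorem Expr.fits_entry {W a : ℕ} {e f : Expr} {s : State} (he : e.Fits W s) (hf : f.Fits W s)
    (hW : s.var 0 * s.var 0 ≤ W) (hes : e.eval s < s.var 0) (hfs : f.eval s < s.var 0)
    (ha : s.arr a (e.eval s * s.var 0 + f.eval s) ≤ W) : (Expr.entry a e f).Fits W s := by
  have h1 := index_lt hes hfs
  have h2 : s.var 0 ≤ s.var 0 * s.var 0 := Nat.le_mul_self _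
  refine ⟨⟨⟨he, ?_, ?_⟩, hf, ?_⟩, ha⟩ <;> simp only [Expr.Fits, Expr.eval] <;> omega

section Distance

variable {n : ℕ} {G : SimpleGraph (Fin n)}

/-- The matrix `D` bounds the lengths of the paths all of whose inner vertices are less than
`k`. -/
def PathBound (G : SimpleGraph (Fin n)) (k : ℕ) (D : ℕ → ℕ) : Prop :=
  ∀ (i j : Fin n) (p : G.Walk i j), p.IsPath → (∀ x ∈ p.support, x ≠ i → x ≠ j → x.val < k) →
    D (i * n + j) ≤ p.length

/-- A path without inner vertices has at most one edge. -/
theorem PathBound.zero {D : ℕ → ℕ} (h₀ : ∀ i : Fin n, D (i * n + i) = 0)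
    (h₁ : ∀ i j, G.Adj i j → D (i * n + j) ≤ 1) : PathBound G 0 D := by
  intro i j p hp hx
  cases p with
  | nil => simp [h₀]
  | @cons _ v _ hadj q =>
    cases q with
    | nil => simpa using h₁ _ _ hadj
    | @cons _ w _ hadj' q =>
      rw [SimpleGraph.Walk.cons_isPath_iff] at hp
      obtain ⟨hp, hi⟩ := hp
      rw [SimpleGraph.Walk.cons_isPath_iff] at hp
      refine absurd (hx v (by simp) hadj.ne.symm ?_) (Nat.not_lt_zero _)
      rintro rfl
      exact hp.2 q.end_mem_support

/-- A path through the inner vertex `k` is cut there. As it visits `k` only once, the inner vertices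
of both pieces are less than `k`; this is why the bound is stated for paths and not for walks. -/
theorem PathBound.succ {D D' : ℕ → ℕ} (k : Fin n) (h : PathBound G k D)
    (hle : ∀ i j : Fin n, D' (i * n + j) ≤ D (i * n + j))
    (hk : ∀ i j : Fin n, D' (i * n + j) ≤ D (i * n + k) + D (k * n + j)) :
    PathBound G (k + 1) D' := by
  intro i j p hp hx
  have hx' : ∀ x ∈ p.support, x ≠ i → x ≠ j → x ≠ k → x.val < k := fun x h1 h2 h3 h4 => by
    have := hx x h1 h2 h3
    have := Fin.val_ne_of_ne h4
    omega
  by_cases hkp : k ∈ p.support ∧ k ≠ i ∧ k ≠ j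
  · obtain ⟨hkp, hki, hkj⟩ := hkp
    have hlen : (p.takeUntil k hkp).length + (p.dropUntil k hkp).length = p.length := by
      rw [← SimpleGraph.Walk.length_append, p.take_spec hkp]
    refine (hk i j).trans (hlen ▸ Nat.add_le_add (h i k _ (hp.takeUntil hkp) ?_)
      (h k j _ (hp.dropUntil hkp) ?_))
    · intro x h1 h2 h3
      refine hx' x (p.support_takeUntil_subset_support hkp h1) h2 ?_ h3
      rintro rfl
      exact SimpleGraph.Walk.endpoint_notMem_support_takeUntil hp hkp hkj.symm h1
    · intro x h1 h2 h3
      refine hx' x (p.support_dropUntil_subset_support hkp h1) ?_ h3 h2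
      rintro rfl
      have hnd := hp.support_nodup
      rw [← p.take_spec hkp, SimpleGraph.Walk.support_append, List.nodup_append] at hnd
      rw [← SimpleGraph.Walk.cons_tail_support, List.mem_cons] at h1
      exact hnd.2.2 _ (SimpleGraph.Walk.start_mem_support _) _ (h1.resolve_left hki.symm) rfl
  · refine (hle i j).trans (h i j p hp fun x h1 h2 h3 => hx' x h1 h2 h3 ?_)
    rintro rfl
    exact hkp ⟨h1, h2, h3⟩

theorem PathBound.le_dist (hG : G.Connected) {D : ℕ → ℕ} (h : PathBound G n D) (i j : Fin n) :
    D (i * n + j) ≤ G.dist i j := by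
  obtain ⟨p, hp, hlen⟩ := hG.exists_path_of_dist i j
  exact hlen ▸ h i j p hp fun x _ _ _ => x.2

/-- The program that computes the distance matrix (Floyd and Warshall) in array `1`. -/
def distProg : Prog :=
  .seq
    (forP 2 0 (forP 3 0 (.write 1 (.add (.mul (.var 2) (.var 0)) (.var 3))
      (.mul (.sub (.const 1) (.eq (.var 2) (.var 3)))
        (.add (.entry 0 (.var 2) (.var 3))
          (.mul (.sub (.const 1) (.entry 0 (.var 2) (.var 3))) (.var 0)))))))
    (forP 4 0 (forP 2 0 (forP 3 0
      (.ite (.lt (.add (.entry 1 (.var 2) (.var 4)) (.entry 1 (.var 4) (.var 3)))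
          (.entry 1 (.var 2) (.var 3)))
        (.write 1 (.add (.mul (.var 2) (.var 0)) (.var 3))
          (.add (.entry 1 (.var 2) (.var 4)) (.entry 1 (.var 4) (.var 3))))
        .skip))))

/-- The matrix in an array is between the distance matrix and `n`. -/
def DistBound (G : SimpleGraph (Fin n)) (D : ℕ → ℕ) : Prop :=
  ∀ i j : Fin n, G.dist i j ≤ D (i * n + j) ∧ D (i * n + j) ≤ n

theorem dist_lt (hG : G.Connected) (i j : Fin n) : G.dist i j < n := by
  obtain ⟨p, hp, hlen⟩ := hG.exists_path_of_dist i j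
  rw [← hlen]
  simpa using hp.length_lt

/-- The array `0` holds the adjacency matrix and variable `0` the number of vertices. -/
def HasInput (G : SimpleGraph (Fin n)) (s : State) : Prop :=
  s.var 0 = n ∧ ∀ i j : Fin n, (G.Adj i j → s.arr 0 (i * n + j) = 1) ∧
    (¬ G.Adj i j → s.arr 0 (i * n + j) = 0)

theorem HasInput.le_one {s : State} (h : HasInput G s) {i j : ℕ} (hi : i < n) (hj : j < n) :
    s.arr 0 (i * n + j) ≤ 1 := by
  by_cases ha : G.Adj ⟨i, hi⟩ ⟨j, hj⟩
  · exact ((h.2 _ _).1 ha).le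
  · exact ((h.2 _ _).2 ha).le.trans zero_le_one

theorem runs_distInit (hG : G.Connected) {W : ℕ} (hW : n * n + n + 1 ≤ W) {s : State}
    (hs : HasInput G s) :
    Runs W (forP 2 0 (forP 3 0 (.write 1 (.add (.mul (.var 2) (.var 0)) (.var 3))
      (.mul (.sub (.const 1) (.eq (.var 2) (.var 3)))
        (.add (.entry 0 (.var 2) (.var 3))
          (.mul (.sub (.const 1) (.entry 0 (.var 2) (.var 3))) (.var 0))))))) s
      (n * (n * (29 + 8) + 14) + 6)
      (fun s' => DistBound G (s'.arr 1) ∧ PathBound G 0 (s'.arr 1)) := by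
  have h0 : 0 < n := Fin.pos_iff_nonempty.2 hG.nonempty
  -- Pairs of distinct non-adjacent vertices receive the entry `n`, which exceeds every distance and
  -- so serves as infinity within small words.
  refine (Runs.forP_forP (N := n) (fun i j a => ∀ i' j' : Fin n, (i'.val < i ∨ i'.val = i ∧ j'.val < j) →
      (G.dist i' j' ≤ a 1 (i' * n + j') ∧ a 1 (i' * n + j') ≤ n) ∧
      (i' = j' → a 1 (i' * n + j') = 0) ∧ (G.Adj i' j' → a 1 (i' * n + j') ≤ 1))
    (by decide) (by decide) (by decide) (by decide) (by decide) (by decide) hs.1 (by omega)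
    (by omega) ?_ ?_ ?_).mono le_rfl ?_
  · intro i' j' h
    omega
  · intro i a h i' j' hij
    exact h i' j' (by have := j'.2; omega)
  · intro i j s₁ hi hj h2 h3 hv ha hI
    have hs₁ : HasInput G s₁ := by
      rw [HasInput, hv 0 (by decide) (by decide) (by decide), ha 0 (by decide)]
      exact hs
    have hA := hs₁.le_one hi hj
    have hidx := index_lt hi hj
    have hin := hs₁.1
    have hn2 : i * n ≤ n * n := Nat.mul_le_mul_right n hi.le
    have hf : (Expr.entry 0 (.var 2) (.var 3)).Fits W s₁ := by
      refine Expr.fits_entry ?_ ?_ ?_ ?_ ?_ ?_ <;>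
        simp only [Expr.Fits, Expr.eval, h2, h3, hin] <;> omega
    have hmul : (1 - s₁.arr 0 (i * n + j)) * n ≤ n := by
      calc _ ≤ 1 * n := Nat.mul_le_mul_right n (by omega)
        _ = n := one_mul n
    set e : Expr := (.mul (.sub (.const 1) (.eq (.var 2) (.var 3)))
        (.add (.entry 0 (.var 2) (.var 3))
          (.mul (.sub (.const 1) (.entry 0 (.var 2) (.var 3))) (.var 0)))) with he
    have hval : e.eval s₁ = (1 - if i = j then 1 else 0) *
        (s₁.arr 0 (i * n + j) + (1 - s₁.arr 0 (i * n + j)) * n) := by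
      simp only [he, Expr.eval, Expr.eval_entry, h2, h3, hin]
    refine (Runs.write (e := e) ?_ ?_ ?_).mono ?_ fun _ h => h
    · simp only [Expr.Fits, Expr.eval, h2, h3, hin]
      omega
    · simp only [he, Expr.Fits, hf, Expr.eval, Expr.eval_entry, h2, h3, hin, true_and, and_true]
      refine ⟨by omega, by omega, ?_⟩
      split_ifs
      · simp
      · omega
    · intro i' j' hij
      simp only [State.setA_arr, Expr.eval, h2, h3, hin, true_and, index_inj j'.2 hj]
      by_cases hc : i'.val = i ∧ j'.val = j
      · rw [if_pos hc, hval]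
        obtain ⟨rfl, rfl⟩ := hc
        by_cases hd : i' = j'
        · subst hd
          simp
        have hd' : i'.val ≠ j'.val := fun h => hd (Fin.ext h)
        rw [if_neg hd']
        by_cases hadj : G.Adj i' j'
        · have h1 := SimpleGraph.dist_eq_one_iff_adj.2 hadj
          simp [(hs₁.2 i' j').1 hadj, hd, h1]
          omega
        · have := dist_lt hG i' j'
          simp [(hs₁.2 i' j').2 hadj, hd, hadj]
          omega
      · rw [if_neg hc]
        exact hI i' j' (by omega)
    · simp only [he, Expr.cost, Expr.cost_entry]
      omega
  · intro s' h
    exact ⟨fun i j => (h i j (Or.inl i.2)).1,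
      .zero (fun i => (h i i (Or.inl i.2)).2.1 rfl) fun i j => (h i j (Or.inl i.2)).2.2⟩

theorem runs_distRound (hG : G.Connected) {W : ℕ} (hW : n * n + 2 * n + 1 ≤ W) {s : State}
    (hn : s.var 0 = n) (k : Fin n) (hk : s.var 4 = k) (hD : DistBound G (s.arr 1))
    (hP : PathBound G k (s.arr 1)) :
    Runs W (forP 2 0 (forP 3 0
      (.ite (.lt (.add (.entry 1 (.var 2) (.var 4)) (.entry 1 (.var 4) (.var 3)))
          (.entry 1 (.var 2) (.var 3)))
        (.write 1 (.add (.mul (.var 2) (.var 0)) (.var 3))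
          (.add (.entry 1 (.var 2) (.var 4)) (.entry 1 (.var 4) (.var 3))))
        .skip))) s
      (n * (n * (40 + 8) + 14) + 6)
      (fun s' => DistBound G (s'.arr 1) ∧ PathBound G (k + 1) (s'.arr 1)) := by
  have h0 : 0 < n := k.pos
  -- The matrix is updated in place, so row and column `k` may change during the round. The bounds
  -- therefore refer to the entries at the start of the round, and it suffices that entries never
  -- increase.
  refine (Runs.forP_forP (N := n) (fun i j a => DistBound G (a 1) ∧
      (∀ i' j' : Fin n, a 1 (i' * n + j') ≤ s.arr 1 (i' * n + j')) ∧
      ∀ i' j' : Fin n, (i'.val < i ∨ i'.val = i ∧ j'.val < j) →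
        a 1 (i' * n + j') ≤ s.arr 1 (i' * n + k) + s.arr 1 (k * n + j'))
    (by decide) (by decide) (by decide) (by decide) (by decide) (by decide) hn (by omega)
    (by omega) ⟨hD, fun _ _ => le_rfl, fun i' j' h => by omega⟩ ?_ ?_).mono le_rfl ?_
  · rintro i a ⟨h1, h2, h3⟩
    exact ⟨h1, h2, fun i' j' hij => h3 i' j' (by have := j'.2; omega)⟩
  · rintro i j s₁ hi hj h2 h3 hv ha ⟨hD₁, hle, hI⟩
    have hn₁ : s₁.var 0 = n := (hv 0 (by decide) (by decide) (by decide)).trans hn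
    have hk₁ : s₁.var 4 = k := (hv 4 (by decide) (by decide) (by decide)).trans hk
    obtain ⟨i, rfl⟩ : ∃ i' : Fin n, i'.val = i := ⟨⟨i, hi⟩, rfl⟩
    obtain ⟨j, rfl⟩ : ∃ i' : Fin n, i'.val = j := ⟨⟨j, hj⟩, rfl⟩
    have hik := hD₁ i k
    have hkj := hD₁ k j
    have hij := hD₁ i j
    have hik' := hle i k
    have hkj' := hle k j
    have htri := hG.dist_triangle (u := i) (v := k) (w := j)
    have hidx := index_lt hi hj
    have hkn := k.2
    have hn2 : i.val * n ≤ n * n := Nat.mul_le_mul_right n hi.le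
    have hfik : (Expr.entry 1 (.var 2) (.var 4)).Fits W s₁ := by
      refine Expr.fits_entry ?_ ?_ ?_ ?_ ?_ ?_ <;>
        simp only [Expr.Fits, Expr.eval, h2, hn₁, hk₁] <;> omega
    have hfkj : (Expr.entry 1 (.var 4) (.var 3)).Fits W s₁ := by
      refine Expr.fits_entry ?_ ?_ ?_ ?_ ?_ ?_ <;>
        simp only [Expr.Fits, Expr.eval, h3, hn₁, hk₁] <;> omega
    have hfij : (Expr.entry 1 (.var 2) (.var 3)).Fits W s₁ := by
      refine Expr.fits_entry ?_ ?_ ?_ ?_ ?_ ?_ <;>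
        simp only [Expr.Fits, Expr.eval, h2, h3, hn₁] <;> omega
    have hfsum : (Expr.add (.entry 1 (.var 2) (.var 4)) (.entry 1 (.var 4) (.var 3))).Fits W s₁ := by
      simp only [Expr.Fits, hfik, hfkj, Expr.eval_entry, Expr.eval, h2, h3, hn₁, hk₁, true_and]
      omega
    refine (Runs.ite (t := 19) ?_ (fun h => ?_) fun h => ?_).mono
      (by simp only [Expr.cost, Expr.cost_entry]; omega) fun _ h => h
    · exact ⟨hfsum, hfij, by omega⟩
    · replace h : s₁.arr 1 (i * n + k) + s₁.arr 1 (k * n + j) < s₁.arr 1 (i * n + j) := by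
        simpa [Expr.eval, Expr.eval_entry, h2, h3, hn₁, hk₁] using h
      refine (Runs.write ?_ hfsum ?_).mono
        (by simp only [Expr.cost, Expr.cost_entry]; omega) fun _ h => h
      · simp only [Expr.Fits, Expr.eval, h2, h3, hn₁]
        omega
      · have hnew : ∀ i' j' : Fin n, (s₁.setA 1
            ((Expr.add (.mul (.var 2) (.var 0)) (.var 3)).eval s₁)
            ((Expr.add (.entry 1 (.var 2) (.var 4)) (.entry 1 (.var 4) (.var 3))).eval s₁)).arr 1
              (i' * n + j') = if i' = i ∧ j' = j then s₁.arr 1 (i * n + k) + s₁.arr 1 (k * n + j)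
                else s₁.arr 1 (i' * n + j') := by
          intro i' j'
          simp only [State.setA_arr, Expr.eval, Expr.eval_entry, h2, h3, hn₁, hk₁, true_and,
            index_inj j'.2 hj, Fin.ext_iff]
        refine ⟨fun i' j' => ?_, fun i' j' => ?_, fun i' j' hc => ?_⟩
        · rw [hnew]
          split_ifs with hc
          · obtain ⟨rfl, rfl⟩ := hc
            omega
          · exact hD₁ i' j'
        · rw [hnew]
          split_ifs with hc
          · obtain ⟨rfl, rfl⟩ := hc
            have := hle i' j'
            omega
          · exact hle i' j'
        · rw [hnew]
          split_ifs with hc'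
          · obtain ⟨rfl, rfl⟩ := hc'
            omega
          · exact hI i' j' (by rw [Fin.ext_iff, Fin.ext_iff] at hc'; omega)
    · replace h : s₁.arr 1 (i * n + j) ≤ s₁.arr 1 (i * n + k) + s₁.arr 1 (k * n + j) := by
        simpa [Expr.eval, Expr.eval_entry, h2, h3, hn₁, hk₁] using h
      refine (Runs.skip ⟨hD₁, hle, fun i' j' hc => ?_⟩).mono (by omega) fun _ h => h
      by_cases hc' : i' = i ∧ j' = j
      · obtain ⟨rfl, rfl⟩ := hc'
        omega
      · exact hI i' j' (by rw [Fin.ext_iff, Fin.ext_iff] at hc'; omega)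
  · rintro s' ⟨h1, h2, h3⟩
    exact ⟨h1, hP.succ k h2 fun i j => h3 i j (Or.inl i.2)⟩

theorem runs_distProg (hG : G.Connected) {W : ℕ} (hW : n * n + 2 * n + 1 ≤ W) {s : State}
    (hs : HasInput G s) :
    Runs W distProg s (200 * n ^ 3)
      (fun s' => ∀ i j : Fin n, s'.arr 1 (i * n + j) = G.dist i j) := by
  have h0 : 0 < n := Fin.pos_iff_nonempty.2 hG.nonempty
  refine (Runs.seq (t₂ := n * ((n * (n * (40 + 8) + 14) + 6) + 8) + 6)
    ((runs_distInit hG (by omega) hs).frame.mono le_rfl ?_)).mono ?_ fun _ h => h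
  · rintro s₁ ⟨hF, hD, hP⟩
    refine (Runs.forP (fun i s' => DistBound G (s'.arr 1) ∧ PathBound G i (s'.arr 1))
      (by decide) (by decide) (by decide) ((hF.1 0 (by decide)).trans hs.1) (by omega) (by omega)
      ⟨hD, hP⟩ ?_).mono le_rfl ?_
    · rintro i s₂ hi h4 hv - ⟨hD₂, hP₂⟩
      exact runs_distRound hG hW (((hv 0 (by decide) (by decide)).trans
        (hF.1 0 (by decide))).trans hs.1) ⟨i, hi⟩ h4 hD₂ hP₂
    · rintro s₂ ⟨hD₂, hP₂⟩ i j
      exact le_antisymm (hP₂.le_dist hG i j) (hD₂ i j).1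
  · have h1 : n ≤ n ^ 3 := Nat.le_self_pow (by norm_num) n
    have h2 : n ^ 2 ≤ n ^ 3 := Nat.pow_le_pow_right h0 (by norm_num)
    have h3 : 1 ≤ n ^ 3 := Nat.one_le_pow _ _ h0
    nlinarith

end Distance

/-! ## Representatives of the maximal modules -/

section Closure

variable {n : ℕ} {G : SimpleGraph (Fin n)}

/-- The state of the computation of the least module that contains `r` and `v`: the array `M`
marks the vertices that have been found, which are listed by the first `q` entries of `Q`. The
first `h` of them, and the first `x` vertices for the next one, have been processed. -/
structure ClosureInv (G : SimpleGraph (Fin n)) (r v : Fin n) (h x q : ℕ) (M Q : ℕ → ℕ) :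
    Prop where
  lt : ∀ j < q, Q j < n
  inj : ∀ i < q, ∀ j < q, Q i = Q j → i = j
  mark : ∀ y < n, (M y = 1 ∧ ∃ j < q, Q j = y) ∨ (M y = 0 ∧ ∀ j < q, Q j ≠ y)
  mem_left : ∃ j < q, Q j = r
  mem_right : ∃ j < q, Q j = v
  least : ∀ N, IsModule G N → r ∈ N → v ∈ N → ∀ j < q, ∀ y : Fin n, Q j = y → y ∈ N
  done : ∀ j < q, ∀ m y : Fin n, (j < h ∨ j = h ∧ y.val < x) → Q j = m → M y = 0 →
    (G.Adj m y ↔ G.Adj r y)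

namespace ClosureInv

variable {r v : Fin n} {h x q : ℕ} {M Q : ℕ → ℕ}

theorem le (H : ClosureInv G r v h x q M Q) : q ≤ n := by
  have := Fintype.card_le_of_injective (fun i : Fin q => (⟨Q i, H.lt i i.2⟩ : Fin n))
    fun i j hij => Fin.ext (H.inj i i.2 j j.2 (Fin.mk.inj hij))
  simpa using this

theorem keep (H : ClosureInv G r v h x q M Q) {m y : Fin n} (hm : Q h = m) (hy : y.val = x)
    (hxy : M y = 0 → (G.Adj m y ↔ G.Adj r y)) : ClosureInv G r v h (x + 1) q M Q := by
  refine ⟨H.lt, H.inj, H.mark, H.mem_left, H.mem_right, H.least, fun j hj m' y' hc hm' hM => ?_⟩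
  by_cases hc' : j = h ∧ y' = y
  · obtain ⟨rfl, rfl⟩ := hc'
    obtain rfl : m = m' := Fin.ext (hm.symm.trans hm')
    exact hxy hM
  · exact H.done j hj m' y' (by rw [Fin.ext_iff] at hc'; omega) hm' hM

/-- A module that contains `m` and `r` contains every vertex that is adjacent to exactly one of
them, so adding `y` keeps the found set inside the least module. -/
theorem extend (H : ClosureInv G r v h x q M Q) (hq : h < q) {m y : Fin n} (hm : Q h = m)
    (hy : y.val = x) (hM : M y = 0) (hxy : ¬ (G.Adj m y ↔ G.Adj r y)) {M' Q' : ℕ → ℕ}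
    (hM' : ∀ z, M' z = if z = y then 1 else M z) (hQ' : ∀ j, Q' j = if j = q then y.val else Q j) :
    ClosureInv G r v h (x + 1) (q + 1) M' Q' := by
  have hold : ∀ j < q, Q' j = Q j := fun j hj => by rw [hQ', if_neg hj.ne]
  have hnew : Q' q = y := by rw [hQ', if_pos rfl]
  have hfresh : ∀ j < q, Q j ≠ y := by
    rcases H.mark y y.2 with ⟨h1, -⟩ | ⟨-, h1⟩
    · omega
    · exact h1
  have hcase : ∀ j < q + 1, j < q ∨ j = q := fun j hj => by omega
  refine ⟨?_, ?_, ?_, ?_, ?_, ?_, ?_⟩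
  · intro j hj
    rcases hcase j hj with hj | rfl
    · rw [hold j hj]
      exact H.lt j hj
    · rw [hnew]
      exact y.2
  · intro i hi j hj hij
    rcases hcase i hi with hi | rfl <;> rcases hcase j hj with hj | rfl
    · rw [hold i hi, hold j hj] at hij
      exact H.inj i hi j hj hij
    · rw [hold i hi, hnew] at hij
      exact absurd hij (hfresh i hi)
    · rw [hold j hj, hnew] at hij
      exact absurd hij.symm (hfresh j hj)
    · rfl
  · intro z hz
    by_cases hzy : z = y
    · exact Or.inl ⟨by rw [hM', if_pos hzy], q, by omega, hnew.trans hzy.symm⟩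
    · rw [hM', if_neg hzy]
      refine (H.mark z hz).imp (fun ⟨h1, j, hj, hj'⟩ => ⟨h1, j, by omega, (hold j hj).trans hj'⟩)
        fun ⟨h1, h2⟩ => ⟨h1, fun j hj => ?_⟩
      rcases hcase j hj with hj | rfl
      · rw [hold j hj]
        exact h2 j hj
      · rw [hnew]
        exact fun h' => hzy h'.symm
  · obtain ⟨j, hj, hj'⟩ := H.mem_left
    exact ⟨j, by omega, (hold j hj).trans hj'⟩
  · obtain ⟨j, hj, hj'⟩ := H.mem_right
    exact ⟨j, by omega, (hold j hj).trans hj'⟩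
  · intro N hN hr hv j hj z hz
    rcases hcase j hj with hj | rfl
    · exact H.least N hN hr hv j hj z ((hold j hj).symm.trans hz)
    · obtain rfl : y = z := Fin.ext (hnew.symm.trans hz)
      by_contra hyN
      have hmN := H.least N hN hr hv h hq m hm
      exact hxy ⟨fun h' => (hN y hyN m hmN r hr h'.symm).symm,
        fun h' => (hN y hyN r hr m hmN h'.symm).symm⟩
  · intro j hj m' z hc hm' hz
    have hzy : z ≠ y := by
      rintro rfl
      rw [hM', if_pos rfl] at hz
      omega
    have hz' : z.val ≠ y.val := fun h' => hzy (Fin.ext h')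
    rw [hM', if_neg hz'] at hz
    have hjq : j < q := by omega
    exact H.done j hjq m' z (by omega) ((hold j hjq).symm.trans hm') hz

theorem next_row (H : ClosureInv G r v h n q M Q) : ClosureInv G r v (h + 1) 0 q M Q :=
  ⟨H.lt, H.inj, H.mark, H.mem_left, H.mem_right, H.least,
    fun j hj m y hc => H.done j hj m y (by have := y.2; omega)⟩

theorem next_of_le (H : ClosureInv G r v h 0 q M Q) (hq : q ≤ h) :
    ClosureInv G r v (h + 1) 0 q M Q :=
  ⟨H.lt, H.inj, H.mark, H.mem_left, H.mem_right, H.least,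
    fun j hj m y _ => H.done j hj m y (by omega)⟩

/-- Once all found vertices have been compared with `r`, no vertex outside distinguishes any of them
from `r`, so they form a module. It lies in every module containing `r` and `v`, so it is proper as
soon as some such module is. -/
theorem lt_iff (H : ClosureInv G r v n 0 q M Q) : q < n ↔ Together G r v := by
  constructor
  · intro hq
    obtain ⟨j, hj, hjr⟩ := H.mem_left
    obtain ⟨j', hj', hjv⟩ := H.mem_right
    refine ⟨{y | ∃ j < q, Q j = y}, ?_, ⟨j, hj, hjr⟩, ⟨j', hj', hjv⟩, ?_⟩
    · rintro x hx a ⟨i, hi, ha⟩ b ⟨i', hi', hb⟩ hxa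
      have hx0 : M x = 0 := (H.mark x x.2).elim (fun h' => absurd h'.2 hx) fun h' => h'.1
      have h1 := H.done i hi a x (Or.inl (hi.trans hq)) ha hx0
      have h2 := H.done i' hi' b x (Or.inl (hi'.trans hq)) hb hx0
      exact (h2.2 (h1.1 hxa.symm)).symm
    · by_contra! hc
      have hsurj : Function.Surjective fun i : Fin q => (⟨Q i, H.lt i i.2⟩ : Fin n) := by
        intro y
        obtain ⟨j, hj, hjy⟩ := hc y
        exact ⟨⟨j, hj⟩, Fin.ext hjy⟩
      have := Fintype.card_le_of_surjective _ hsurj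
      simp only [Fintype.card_fin] at this
      omega
  · rintro ⟨N, hN, hr, hv, z, hz⟩
    refine lt_of_le_of_ne H.le ?_
    rintro rfl
    -- With `q = n` the list runs through all vertices, so the missing vertex `z` would be in it and
    -- hence in `N`.
    have hinj : Function.Injective fun i : Fin q => (⟨Q i, H.lt i i.2⟩ : Fin q) :=
      fun i j hij => Fin.ext (H.inj i i.2 j j.2 (Fin.mk.inj hij))
    obtain ⟨j, hj⟩ := (Finite.injective_iff_surjective.1 hinj) z
    exact hz (H.least N hN hr hv j j.2 z (congrArg Fin.val hj))

theorem start (hrv : r ≠ v) {M Q : ℕ → ℕ} (hM : ∀ y < n, M y = if y = r ∨ y = v then 1 else 0)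
    (h0 : Q 0 = r) (h1 : Q 1 = v) : ClosureInv G r v 0 0 2 M Q := by
  have hrv' : r.val ≠ v.val := fun h => hrv (Fin.ext h)
  have hcase : ∀ j < 2, j = 0 ∨ j = 1 := fun j hj => by omega
  refine ⟨?_, ?_, ?_, ⟨0, by omega, h0⟩, ⟨1, by omega, h1⟩, ?_, fun j _ m y hc => by omega⟩
  · intro j hj
    rcases hcase j hj with rfl | rfl
    · exact h0 ▸ r.2
    · exact h1 ▸ v.2
  · intro i hi j hj hij
    rcases hcase i hi with rfl | rfl <;> rcases hcase j hj with rfl | rfl <;> omega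
  · intro y hy
    rw [hM y hy]
    split_ifs with hc
    · exact Or.inl ⟨rfl, hc.elim (fun h => ⟨0, by omega, h0.trans h.symm⟩)
        fun h => ⟨1, by omega, h1.trans h.symm⟩⟩
    · refine Or.inr ⟨rfl, fun j hj => ?_⟩
      rcases hcase j hj with rfl | rfl <;> omega
  · intro N _ hr hv j hj y hy
    rcases hcase j hj with rfl | rfl
    · rwa [← Fin.ext (h0.symm.trans hy)]
    · rwa [← Fin.ext (h1.symm.trans hy)]

end ClosureInv

/-! ### The program for the least module containing two vertices. -/

/-- The condition that the vertex in variable `8` is unmarked and distinguishes the vertices in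
the variables `5` and `10`. -/
def splitExpr : Expr :=
  .mul (.eq (.read 2 (.var 8)) (.const 0))
    (.sub (.const 1) (.eq (.entry 0 (.var 10) (.var 8)) (.entry 0 (.var 5) (.var 8))))

/-- Handle the vertex in variable `10` for all vertices. -/
def closureRow : Prog :=
  forP 8 0 (.ite splitExpr
    (.seq (.write 2 (.var 8) (.const 1)) (.seq (.write 3 (.var 9) (.var 8))
      (.assign 9 (.add (.var 9) (.const 1)))))
    .skip)

/-- The program that computes the least module that contains the vertices in the variables `5`
and `6`, and its size in variable `9`. -/
def closureProg : Prog :=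
  .seq (forP 8 0 (.write 2 (.var 8) (.const 0)))
    (.seq (.write 2 (.var 5) (.const 1)) (.seq (.write 2 (.var 6) (.const 1))
    (.seq (.write 3 (.const 0) (.var 5)) (.seq (.write 3 (.const 1) (.var 6))
    (.seq (.assign 9 (.const 2))
    (forP 7 0 (.ite (.lt (.var 7) (.var 9))
      (.seq (.assign 10 (.read 3 (.var 7))) closureRow)
      .skip)))))))

theorem HasInput.entry_eq_iff {s : State} (hs : HasInput G s) (a b c d : Fin n) :
    s.arr 0 (a * n + b) = s.arr 0 (c * n + d) ↔ (G.Adj a b ↔ G.Adj c d) := by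
  by_cases h1 : G.Adj a b <;> by_cases h2 : G.Adj c d
  · simp [(hs.2 a b).1 h1, (hs.2 c d).1 h2, h1, h2]
  · simp [(hs.2 a b).1 h1, (hs.2 c d).2 h2, h1, h2]
  · simp [(hs.2 a b).2 h1, (hs.2 c d).1 h2, h1, h2]
  · simp [(hs.2 a b).2 h1, (hs.2 c d).2 h2, h1, h2]

theorem runs_closureRow {W : ℕ} (hW : n * n + n + 2 ≤ W) {s : State} (hs : HasInput G s)
    {r v m : Fin n} (hr : s.var 5 = r) {h : ℕ} (hm : s.var 10 = m) (hmq : s.arr 3 h = m)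
    (hh : h < s.var 9) (H : ClosureInv G r v h 0 (s.var 9) (s.arr 2) (s.arr 3)) :
    Runs W closureRow s (n * (31 + 8) + 6)
      (fun s' => ClosureInv G r v (h + 1) 0 (s'.var 9) (s'.arr 2) (s'.arr 3)) := by
  refine (Runs.forP (fun x s' => h < s'.var 9 ∧ s'.arr 3 h = m ∧
    ClosureInv G r v h x (s'.var 9) (s'.arr 2) (s'.arr 3)) (by decide) (by decide) (by decide)
    hs.1 (by omega) (by omega) (by simpa using ⟨hh, hmq, H⟩) ?_).mono le_rfl
    fun _ h => h.2.2.next_row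
  rintro x s₁ hx hx8 hv ha ⟨hh₁, hmq₁, H₁⟩
  obtain ⟨x, rfl⟩ : ∃ x' : Fin n, x'.val = x := ⟨⟨x, hx⟩, rfl⟩
  have hs₁ : HasInput G s₁ := by
    rw [HasInput, hv 0 (by decide) (by decide), ha 0 (by decide)]
    exact hs
  have h0 := hs₁.1
  have h5 : s₁.var 5 = r := (hv 5 (by decide) (by decide)).trans hr
  have h10 : s₁.var 10 = m := (hv 10 (by decide) (by decide)).trans hm
  have hq := H₁.le
  have hA₁ := hs₁.le_one m.2 x.2
  have hA₂ := hs₁.le_one r.2 x.2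
  have hM : s₁.arr 2 x ≤ 1 := (H₁.mark x x.2).elim (fun h => h.1.le) fun h => h.1.le.trans zero_le_one
  have hxn := x.2
  have hmn := m.2
  have hrn := r.2
  have hf₁ : (Expr.entry 0 (.var 10) (.var 8)).Fits W s₁ := by
    refine Expr.fits_entry ?_ ?_ ?_ ?_ ?_ ?_ <;>
      simp only [Expr.Fits, Expr.eval, h10, hx8, h0] <;> omega
  have hf₂ : (Expr.entry 0 (.var 5) (.var 8)).Fits W s₁ := by
    refine Expr.fits_entry ?_ ?_ ?_ ?_ ?_ ?_ <;>
      simp only [Expr.Fits, Expr.eval, h5, hx8, h0] <;> omega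
  have hval : splitExpr.eval s₁ ≠ 0 ↔ s₁.arr 2 x = 0 ∧ ¬ (G.Adj m x ↔ G.Adj r x) := by
    rw [← hs₁.entry_eq_iff]
    simp only [splitExpr, Expr.eval, Expr.eval_entry, h10, hx8, h0, h5]
    split_ifs <;> simp_all
  refine (Runs.ite (t := 10) ?_ (fun hc => ?_) fun hc => ?_).mono
    (by simp only [splitExpr, Expr.cost, Expr.cost_entry]; omega) fun _ h => h
  · simp only [splitExpr, Expr.Fits, hf₁, hf₂, Expr.eval, hx8, true_and]
    refine ⟨⟨⟨by omega, by omega⟩, by omega, by omega⟩, ⟨by omega, by omega⟩, ?_⟩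
    refine (Nat.mul_le_mul (n₂ := 1) (m₂ := 1) ?_ (Nat.sub_le _ _)).trans (by omega)
    split_ifs <;> omega
  · obtain ⟨h1, h2⟩ := hval.1 hc
    refine (Runs.seq (t₁ := 3) (t₂ := 7) (Runs.write ?_ ?_ (Runs.seq (t₁ := 3) (t₂ := 4)
      (Runs.write ?_ ?_ (Runs.assign ?_ ?_))))).mono le_rfl fun _ h => h
    · simp only [Expr.Fits, hx8]; omega
    · simp only [Expr.Fits]; omega
    · simp only [Expr.Fits, State.setA_var]; omega
    · simp only [Expr.Fits, State.setA_var]; omega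
    · simp only [Expr.Fits, Expr.eval, State.setA_var]; omega
    -- New vertices are appended behind place `h`, so the vertex being processed stays in place.
    · have hn : h ≠ s₁.var 9 := hh₁.ne
      refine ⟨?_, ?_, ?_⟩
      · simp [Expr.eval]; omega
      · simp [Expr.eval, hn, hmq₁]
      · simp only [State.setV_var, State.setV_arr, State.setA_var, Expr.eval, hx8]
        exact H₁.extend hh₁ hmq₁ rfl h1 h2 (fun z => by simp) fun j => by simp
  · refine (Runs.skip ⟨hh₁, hmq₁, ?_⟩).mono (by omega) fun _ h => h
    refine H₁.keep hmq₁ rfl fun hM0 => ?_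
    by_contra hne
    exact hval.2 ⟨hM0, hne⟩ hc

/-- Comparing every found vertex only with `r` rather than with all others keeps the number of steps
quadratic. -/
theorem runs_closureProg {W : ℕ} (hW : n * n + n + 2 ≤ W) {s : State} (hs : HasInput G s)
    {r v : Fin n} (hrv : r ≠ v) (hr : s.var 5 = r) (hv : s.var 6 = v) :
    Runs W closureProg s (100 * n ^ 2)
      (fun s' => s'.var 9 ≤ n ∧ (s'.var 9 < n ↔ Together G r v)) := by
  have hpos : 0 < n := r.pos
  have hrn := r.2
  have hvn := v.2
  refine (Runs.seq (t₁ := n * (3 + 8) + 6) (t₂ := 14 + (n * ((n * (31 + 8) + 13) + 8) + 6))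
    ((Runs.frame (Runs.forP (fun x s' => ∀ y < x, s'.arr 2 y = 0) (by decide) (by decide)
    (by decide) hs.1 (by omega) (by omega) (by simp) ?_)).mono le_rfl ?_)).mono ?_ fun _ h => h
  · intro x s₁ hx hx8 _ _ hI
    refine Runs.write (by simp only [Expr.Fits]; omega) (by simp [Expr.Fits]) fun y hy => ?_
    simp only [State.setV_arr, State.setA_arr, Expr.eval, hx8, true_and]
    split_ifs with hc
    · rfl
    · exact hI y (by omega)
  · rintro s₁ ⟨hF, hM⟩
    have h0₁ : s₁.var 0 = n := (hF.1 0 (by decide)).trans hs.1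
    have h5₁ : s₁.var 5 = r := (hF.1 5 (by decide)).trans hr
    have h6₁ : s₁.var 6 = v := (hF.1 6 (by decide)).trans hv
    have ha₁ : s₁.arr 0 = s.arr 0 := hF.2 0 (by decide)
    refine (Runs.seq (t₁ := 3) (Runs.write ?_ ?_ (Runs.seq (t₁ := 3) (Runs.write ?_ ?_
      (Runs.seq (t₁ := 3) (Runs.write ?_ ?_ (Runs.seq (t₁ := 3) (Runs.write ?_ ?_
      (Runs.seq (t₁ := 2) (t₂ := n * ((n * (31 + 8) + 13) + 8) + 6)
        (Runs.assign ?_ ?_)))))))))).mono (by omega) fun _ h => h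
    any_goals simp only [Expr.Fits, State.setA_var, h5₁, h6₁]; omega
    -- The list grows during the loop, so the loop runs over all `n` possible places and does
    -- nothing at those beyond the current end.
    refine (Runs.forP (fun h s' => ClosureInv G r v h 0 (s'.var 9) (s'.arr 2) (s'.arr 3))
      (by decide) (by decide) (by decide) (N := n) (by simpa using h0₁) (by omega) (by omega)
      ?_ ?_).mono le_rfl fun s' H => ⟨H.le, H.lt_iff⟩
    · simp only [State.setV_var, State.setV_arr, State.setA_var, Expr.eval]
      refine ClosureInv.start hrv (fun y hy => ?_) ?_ ?_
      · simp [h5₁, h6₁, hM y hy]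
        by_cases h1 : y = r <;> by_cases h2 : y = v <;> simp [h1, h2]
      · simp [h5₁]
      · simp [h6₁]
    · intro h s₂ hh h7 hv₂ ha₂ H
      have h0₂ : s₂.var 0 = n := by
        rw [hv₂ 0 (by decide) (by decide)]
        simpa using h0₁
      have h5₂ : s₂.var 5 = r := by
        rw [hv₂ 5 (by decide) (by decide)]
        simpa using h5₁
      have ha0 : s₂.arr 0 = s.arr 0 := by
        rw [ha₂ 0 (by decide)]
        funext i
        simp [ha₁]
      have hq := H.le
      refine (Runs.ite (t := n * (31 + 8) + 9) ?_ (fun hc => ?_) fun hc => ?_).mono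
        (by simp only [Expr.cost]; omega) fun _ h => h
      · simp only [Expr.Fits]
        omega
      · have hhq : h < s₂.var 9 := by simpa [Expr.eval, h7] using hc
        have hlt := H.lt h hhq
        refine (Runs.seq (t₁ := 3) (t₂ := n * (31 + 8) + 6) (Runs.assign ?_ ?_)).mono (by omega)
          fun _ h => h
        · simp only [Expr.Fits, Expr.eval, h7]
          omega
        · refine (runs_closureRow (G := G) (r := r) (v := v) (m := ⟨s₂.arr 3 h, hlt⟩) (h := h)
            hW ?_ ?_ ?_ ?_ ?_ ?_).mono le_rfl fun _ H' => by simpa using H'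
          · refine ⟨by simpa using h0₂, ?_⟩
            rw [State.setV_arr, ha0]
            exact hs.2
          · simpa using h5₂
          · simp [Expr.eval, h7]
          · rfl
          · simpa using hhq
          · simpa using H
      · refine (Runs.skip ?_).mono (by omega) fun _ h => h
        exact H.next_of_le (by simpa [Expr.eval, h7] using hc)
  · nlinarith

/-! ### One representative of each class. -/

/-- The first `t` entries of `R` are vertices less than `v`, one of each class of vertices less
than `v` with a common module. -/
structure RepsInv (G : SimpleGraph (Fin n)) (v t : ℕ) (R : ℕ → ℕ) : Prop where
  vertex : ∀ i < t, ∃ x : Fin n, R i = x ∧ x.val < v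
  inj : ∀ i < t, ∀ j < t, ∀ x y : Fin n, R i = x → R j = y → Together G x y → i = j
  cover : ∀ u : Fin n, u.val < v → ∃ i < t, ∃ x : Fin n, R i = x ∧ Together G x u

theorem RepsInv.exists_finset {v t : ℕ} {R : ℕ → ℕ} (h : RepsInv G v t R)
    (hD : ¬ Dominated G) : ∃ S : Finset (Fin n), S.card = t ∧
      ∀ x ∈ S, ∀ y ∈ S, Together G x y → x = y := by
  choose g hg _ using fun i : Fin t => h.vertex i i.2
  have hinj : Function.Injective g := fun i j hij => Fin.ext
    (h.inj i i.2 j j.2 (g i) (g j) (hg i) (hg j) (hij ▸ Together.refl hD _))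
  refine ⟨Finset.univ.map ⟨g, hinj⟩, by simp, fun x hx y hy hxy => ?_⟩
  obtain ⟨i, -, rfl⟩ := Finset.mem_map.1 hx
  obtain ⟨j, -, rfl⟩ := Finset.mem_map.1 hy
  have : i = j := Fin.ext (h.inj i i.2 j j.2 _ _ (hg i) (hg j) hxy)
  rw [this]

/-- This is how the modular width enters the step count: it bounds the number of representatives at
every moment, although the program does not know it. -/
theorem RepsInv.le_width {v t : ℕ} {R : ℕ → ℕ} (h : RepsInv G v t R) (hG : G.Connected)
    (hD : ¬ Dominated G) : t ≤ modularWidth G := by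
  obtain ⟨S, rfl, hS⟩ := h.exists_finset hD
  exact card_le_modularWidth (Fin.pos_iff_nonempty.2 hG.nonempty) G hG hD S hS

theorem RepsInv.le {v t : ℕ} {R : ℕ → ℕ} (h : RepsInv G v t R) (hD : ¬ Dominated G) :
    t ≤ n := by
  obtain ⟨S, rfl, -⟩ := h.exists_finset hD
  simpa using Finset.card_le_univ S

theorem RepsInv.keep {t : ℕ} {v : Fin n} {R : ℕ → ℕ} (h : RepsInv G v t R)
    (hv : ∃ i < t, ∃ x : Fin n, R i = x ∧ Together G x v) : RepsInv G (v + 1) t R := by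
  refine ⟨fun i hi => ?_, h.inj, fun u hu => ?_⟩
  · obtain ⟨x, h1, h2⟩ := h.vertex i hi
    exact ⟨x, h1, by omega⟩
  · by_cases huv : u = v
    · exact huv ▸ hv
    · exact h.cover u (by rw [Fin.ext_iff] at huv; omega)

theorem RepsInv.extend {t : ℕ} {v : Fin n} {R R' : ℕ → ℕ} (h : RepsInv G v t R)
    (hD : ¬ Dominated G) (hv : ¬ ∃ i < t, ∃ x : Fin n, R i = x ∧ Together G x v)
    (hR : ∀ i, R' i = if i = t then v.val else R i) : RepsInv G (v + 1) (t + 1) R' := by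
  have hold : ∀ i < t, R' i = R i := fun i hi => by rw [hR, if_neg hi.ne]
  have hnew : R' t = v := by rw [hR, if_pos rfl]
  have hcase : ∀ j < t + 1, j < t ∨ j = t := fun j hj => by omega
  refine ⟨fun i hi => ?_, fun i hi j hj x y hx hy hxy => ?_, fun u hu => ?_⟩
  · rcases hcase i hi with hi | rfl
    · obtain ⟨x, h1, h2⟩ := h.vertex i hi
      exact ⟨x, (hold i hi).trans h1, by omega⟩
    · exact ⟨v, hnew, by omega⟩
  · rcases hcase i hi with hi | rfl <;> rcases hcase j hj with hj | rfl
    · exact h.inj i hi j hj x y ((hold i hi).symm.trans hx) ((hold j hj).symm.trans hy) hxy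
    · obtain rfl : v = y := Fin.ext (hnew.symm.trans hy)
      exact absurd ⟨i, hi, x, (hold i hi).symm.trans hx, hxy⟩ hv
    · obtain rfl : v = x := Fin.ext (hnew.symm.trans hx)
      exact absurd ⟨j, hj, y, (hold j hj).symm.trans hy, hxy.symm⟩ hv
    · rfl
  · by_cases huv : u = v
    · exact ⟨t, by omega, v, hnew, huv ▸ Together.refl hD _⟩
    · obtain ⟨i, hi, x, hx, hxu⟩ := h.cover u (by rw [Fin.ext_iff] at huv; omega)
      exact ⟨i, by omega, x, (hold i hi).trans hx, hxu⟩

/-- Set variable `11` to `1` if the vertex in variable `6` is in a common module with one of the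
representatives found before. -/
def coveredProg : Prog :=
  forP 12 13 (.seq (.assign 5 (.read 4 (.var 12))) (.seq closureProg
    (.ite (.lt (.var 9) (.var 0)) (.assign 11 (.const 1)) .skip)))

/-- The program that computes one vertex of each maximal module in array `4`, and their number in
variable `13`. -/
def repsProg : Prog :=
  .seq (.assign 13 (.const 0)) (forP 6 0 (.seq (.assign 11 (.const 0)) (.seq coveredProg
    (.ite (.var 11) .skip (.seq (.write 4 (.var 13) (.var 6))
      (.assign 13 (.add (.var 13) (.const 1))))))))

theorem runs_coveredProg {W : ℕ} (hW : n * n + n + 2 ≤ W) (hD : ¬ Dominated G) {s : State}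
    (hs : HasInput G s) {v : Fin n} (hv : s.var 6 = v) (h11 : s.var 11 = 0)
    (H : RepsInv G v (s.var 13) (s.arr 4)) :
    Runs W coveredProg s (s.var 13 * ((100 * n ^ 2 + 9) + 8) + 6)
      (fun s' => s'.var 11 ≤ 1 ∧ (s'.var 11 ≠ 0 ↔
        ∃ i < s.var 13, ∃ x : Fin n, s.arr 4 i = x ∧ Together G x v)) := by
  have ht := H.le hD
  refine (Runs.forP (fun i s' => s'.var 11 ≤ 1 ∧ (s'.var 11 ≠ 0 ↔
        ∃ j < i, ∃ x : Fin n, s.arr 4 j = x ∧ Together G x v))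
    (by decide) (by decide) (by decide) rfl (by omega) (by omega) (by simp [h11]) ?_)
  rintro i s₁ hi h12 hv₁ ha₁ ⟨hle, hiff⟩
  obtain ⟨x, hx, hxv⟩ := H.vertex i hi
  have hxn := x.2
  have hR : s₁.arr 4 = s.arr 4 := ha₁ 4 (by decide)
  have h0 : s₁.var 0 = n := (hv₁ 0 (by decide) (by decide)).trans hs.1
  have hx' : s₁.arr 4 i = x := by rw [hR, hx]
  refine (Runs.seq (t₁ := 3) (t₂ := 100 * n ^ 2 + 6) (Runs.assign ?_ (Runs.seq (t₂ := 6)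
    ((runs_closureProg (r := x) (v := v) (G := G) hW ?_ ?_ ?_ ?_).frame.mono le_rfl ?_)))).mono
    (by omega) fun _ h => h
  · simp only [Expr.Fits, Expr.eval, h12, hx']
    omega
  · refine ⟨by simpa using h0, ?_⟩
    rw [State.setV_arr, ha₁ 0 (by decide)]
    exact hs.2
  -- Earlier representatives are less than `v`, so the two generators of the module are distinct.
  · rintro rfl
    omega
  · simp [Expr.eval, h12, hx']
  · have := hv₁ 6 (by decide) (by decide)
    simp [this, hv]
  · rintro s₂ ⟨hF, hq, hT⟩
    have h0₂ : s₂.var 0 = n := by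
      rw [hF.1 0 (by decide)]
      simpa using h0
    have h11₂ : s₂.var 11 = s₁.var 11 := by
      rw [hF.1 11 (by decide)]
      simp
    have hstep : (∃ j < i + 1, ∃ x : Fin n, s.arr 4 j = x ∧ Together G x v) ↔
        (∃ j < i, ∃ x : Fin n, s.arr 4 j = x ∧ Together G x v) ∨ Together G x v := by
      constructor
      · rintro ⟨j, hj, y, hy, hyv⟩
        rcases Nat.lt_succ_iff_lt_or_eq.1 hj with h' | rfl
        · exact Or.inl ⟨j, h', y, hy, hyv⟩
        · exact Or.inr ((Fin.ext (hx.symm.trans hy) : x = y) ▸ hyv)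
      · rintro (⟨j, hj, h⟩ | h)
        · exact ⟨j, by omega, h⟩
        · exact ⟨i, by omega, x, hx, h⟩
    refine (Runs.ite (t := 2) ?_ (fun hc => ?_) fun hc => ?_).mono (by simp [Expr.cost])
      fun _ h => h
    · simp only [Expr.Fits, h0₂]
      omega
    · have hlt : s₂.var 9 < n := by simpa [Expr.eval, h0₂] using hc
      refine Runs.assign (by simp only [Expr.Fits]; omega) ?_
      simp only [hstep, hT.1 hlt]
      simp [Expr.eval]
    · have hlt : ¬ s₂.var 9 < n := by simpa [Expr.eval, h0₂] using hc
      refine (Runs.skip ?_).mono (by omega) fun _ h => h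
      have hT' : ¬ Together G x v := fun h => hlt (hT.2 h)
      simp only [hstep, hT', or_false, State.setV_var]
      simpa [h11₂] using ⟨hle, hiff⟩

theorem runs_repsProg {W : ℕ} (hW : n * n + n + 2 ≤ W) (hG : G.Connected)
    (hD : ¬ Dominated G) {s : State} (hs : HasInput G s) :
    Runs W repsProg s (200 * (2 ^ modularWidth G * n ^ 3))
      (fun s' => RepsInv G n (s'.var 13) (s'.arr 4)) := by
  set w := modularWidth G
  have hpos : 0 < n := Fin.pos_iff_nonempty.2 hG.nonempty
  refine (Runs.seq (t₁ := 2) (t₂ := n * ((w * (100 * n ^ 2 + 17) + 17) + 8) + 6)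
    (Runs.assign (by simp [Expr.Fits]) ((Runs.forP (N := n)
    (fun v s' => RepsInv G v (s'.var 13) (s'.arr 4)) (by decide) (by decide) (by decide)
    (by simpa using hs.1) (by omega) (by omega) ?_ ?_).mono le_rfl fun _ h => h))).mono ?_
    fun _ h => h
  · simp only [State.setV_var, State.setV_arr, Expr.eval]
    exact ⟨fun i hi => by simp at hi, fun i hi => by simp at hi, fun u hu => by simp at hu⟩
  · intro v s₁ hv h6 hv₁ ha₁ H
    have ht := H.le hD
    have htw := H.le_width hG hD
    have h0₁ : s₁.var 0 = n := by
      rw [hv₁ 0 (by decide) (by decide)]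
      simpa using hs.1
    have ha0 : s₁.arr 0 = s.arr 0 := by rw [ha₁ 0 (by decide), State.setV_arr]
    refine (Runs.seq (t₁ := 2) (t₂ := w * (100 * n ^ 2 + 17) + 6 + 9)
      (Runs.assign (by simp [Expr.Fits]) (Runs.seq (((runs_coveredProg (v := ⟨v, hv⟩) hW hD
        (G := G) ⟨by simpa using h0₁, ?_⟩ ?_ ?_ ?_).frame).mono ?_ ?_)))).mono (by omega)
        fun _ h => h
    · rw [State.setV_arr, ha0]
      exact hs.2
    · simpa using h6
    · simp [Expr.eval]
    · simpa using H
    · simp only [State.setV_var]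
      have := Nat.mul_le_mul_right (100 * n ^ 2 + 17) htw
      simpa [Nat.add_assoc] using this
    · rintro s₂ ⟨hF, hle, hiff⟩
      have h13 : s₂.var 13 = s₁.var 13 := by
        rw [hF.1 13 (by decide)]
        simp
      have hR : s₂.arr 4 = s₁.arr 4 := by rw [hF.2 4 (by decide), State.setV_arr]
      have h6₂ : s₂.var 6 = v := by
        rw [hF.1 6 (by decide)]
        simpa using h6
      simp only [State.setV_var, State.setV_arr] at hiff
      refine (Runs.ite (t := 7) ?_ (fun hc => ?_) fun hc => ?_).mono (by simp [Expr.cost])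
        fun _ h => h
      · simp only [Expr.Fits]
        omega
      · refine (Runs.skip ?_).mono (by omega) fun _ h => h
        have := hiff.1 hc
        simp only [State.setV_var, State.setV_arr, h13, hR]
        exact RepsInv.keep (v := ⟨v, hv⟩) H (by simpa using this)
      · have hc' : ¬ ∃ i < s₁.var 13, ∃ x : Fin n, s₁.arr 4 i = x ∧ Together G x ⟨v, hv⟩ :=
          fun h => hiff.2 (by simpa using h) hc
        refine (Runs.seq (t₁ := 3) (t₂ := 4) (Runs.write ?_ ?_ (Runs.assign ?_ ?_))).mono
          le_rfl fun _ h => h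
        · simp only [Expr.Fits]; omega
        · simp only [Expr.Fits]; omega
        · simp only [Expr.Fits, Expr.eval, State.setA_var]; omega
        · simp only [State.setV_var, State.setV_arr, State.setA_var, Expr.eval, h13, h6₂]
          exact RepsInv.extend (v := ⟨v, hv⟩) H hD hc' fun i => by simp [hR]
  -- At most `w` tests of `O(n ^ 2)` steps for each of `n` vertices; the factor `w` is absorbed into
  -- `2 ^ w`.
  · have hw : w ≤ 2 ^ w := Nat.lt_two_pow_self.le
    have h1 : n ≤ n ^ 3 := Nat.le_self_pow (by norm_num) n
    have h3 : 1 ≤ n ^ 3 := Nat.one_le_pow _ _ hpos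
    have h4 : 1 ≤ 2 ^ w := Nat.one_le_two_pow
    have h5 : w * n ^ 3 ≤ 2 ^ w * n ^ 3 := Nat.mul_le_mul_right _ hw
    have h6 : w * n ≤ 2 ^ w * n ^ 3 := Nat.mul_le_mul hw h1
    have h7 : n ^ 3 ≤ 2 ^ w * n ^ 3 := Nat.le_mul_of_pos_left _ (by omega)
    nlinarith

end Closure

/-! ## Sets of representatives that form a shortest path -/

section Sets

variable {n : ℕ} {G : SimpleGraph (Fin n)}

/-- The vertices `ρ x` with `x < t` and `β x` are those of a shortest path of eccentricity at
most `k`. -/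
def SetCond (G : SimpleGraph (Fin n)) (k t : ℕ) (ρ : ℕ → Fin n) (β : ℕ → Prop) : Prop :=
  (∃ u < t, β u ∧ ∀ x < t,
    (∀ y < t, β x → β y → G.dist (ρ x) (ρ y) =
      (G.dist (ρ u) (ρ x) - G.dist (ρ u) (ρ y)) + (G.dist (ρ u) (ρ y) - G.dist (ρ u) (ρ x))) ∧
    ∃ z < t, β x → G.dist (ρ u) (ρ x) = 0 ∨ β z ∧ G.dist (ρ u) (ρ z) + 1 = G.dist (ρ u) (ρ x)) ∧
  ∀ v < n, ∃ x < t, β x ∧ ∃ v' : Fin n, v'.val = v ∧ G.dist (ρ x) v' < k + 1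

theorem SetCond.congr {k t : ℕ} {ρ : ℕ → Fin n} {β β' : ℕ → Prop}
    (h : ∀ x < t, (β x ↔ β' x)) (hβ : SetCond G k t ρ β) : SetCond G k t ρ β' := by
  obtain ⟨⟨u, hu, hbu, h1⟩, h2⟩ := hβ
  refine ⟨⟨u, hu, (h u hu).1 hbu, fun x hx => ⟨fun y hy hbx hby => ?_, ?_⟩⟩, fun v hv => ?_⟩
  · exact (h1 x hx).1 y hy ((h x hx).2 hbx) ((h y hy).2 hby)
  · obtain ⟨z, hz, h3⟩ := (h1 x hx).2
    exact ⟨z, hz, fun hbx => (h3 ((h x hx).2 hbx)).imp id fun h4 => ⟨(h z hz).1 h4.1, h4.2⟩⟩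
  · obtain ⟨x, hx, hbx, h3⟩ := h2 v hv
    exact ⟨x, hx, (h x hx).1 hbx, h3⟩

/-- The distance from `ρ u` is a coordinate on the chosen vertices. By the first clause their
distances are the differences of coordinates, and by the second one every positive coordinate has a
predecessor. So the coordinates fill an interval from `0`, and listing the vertices by coordinate
gives a shortest path. -/
theorem SetCond.yesInstance (hG : G.Connected) {k t : ℕ} {ρ : ℕ → Fin n} {β : ℕ → Prop}
    (h : SetCond G k t ρ β) : YesInstance G k := by
  classical
  obtain ⟨⟨u, hu, hbu, h1⟩, h2⟩ := h
  have hdown : ∀ (m x : ℕ), x < t → β x → G.dist (ρ u) (ρ x) = m → ∀ l ≤ m,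
      ∃ z < t, β z ∧ G.dist (ρ u) (ρ z) = l := by
    intro m
    induction m with
    | zero => exact fun x hx hbx hm l hl => ⟨x, hx, hbx, by omega⟩
    | succ m ih =>
      intro x hx hbx hm l hl
      by_cases hlm : l = m + 1
      · exact ⟨x, hx, hbx, by omega⟩
      · obtain ⟨z, hz, h3⟩ := (h1 x hx).2
        rcases h3 hbx with h4 | ⟨hbz, h4⟩
        · omega
        · exact ih z hz hbz (by omega) l (by omega)
  -- A chosen vertex farthest from `ρ u` is the other end of the path.
  obtain ⟨xm, hxm, hmax⟩ := ((Finset.range t).filter β).exists_max_image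
    (fun x => G.dist (ρ u) (ρ x)) ⟨u, by simp [hu, hbu]⟩
  simp only [Finset.mem_filter, Finset.mem_range] at hxm hmax
  set m := G.dist (ρ u) (ρ xm) with hm
  choose! g hgt hgb hgd using hdown m xm hxm.1 hxm.2 rfl
  have hdist : ∀ x < t, β x → ∀ y < t, β y → G.dist (ρ x) (ρ y) =
      (G.dist (ρ u) (ρ x) - G.dist (ρ u) (ρ y)) + (G.dist (ρ u) (ρ y) - G.dist (ρ u) (ρ x)) :=
    fun x hx hbx y hy hby => (h1 x hx).1 y hy hbx hby
  refine ⟨(List.range (m + 1)).map fun l => ρ (g l), ?_, ?_⟩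
  · rw [isShortestPath_iff hG]
    refine ⟨by simp, fun i j hij hj => ?_⟩
    simp only [List.length_map, List.length_range] at hj
    simp only [List.getElem_map, List.getElem_range]
    rw [hdist _ (hgt i (by omega)) (hgb i (by omega)) _ (hgt j (by omega)) (hgb j (by omega)),
      hgd i (by omega), hgd j (by omega)]
    omega
  · rw [pathEcc_le_iff hG]
    intro v
    obtain ⟨x, hx, hbx, v', hv', hd⟩ := h2 v v.2
    obtain rfl : v' = v := Fin.ext hv'
    have hle := hmax x ⟨hx, hbx⟩
    refine ⟨ρ x, List.mem_map.2 ⟨G.dist (ρ u) (ρ x), by simp; omega, ?_⟩, ?_⟩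
    -- Two chosen vertices with the same coordinate are at distance `0`, so the vertex at this place
    -- of the path is `ρ x`.
    · refine hG.dist_eq_zero_iff.1 ?_
      rw [hdist _ (hgt _ hle) (hgb _ hle) _ hx hbx, hgd _ hle]
      omega
    · rw [SimpleGraph.dist_comm]
      omega

/-- The representatives meet every class of the quotient, so part (c) yields a shortest path
consisting of representatives. Its first vertex plays the role of `ρ u`, and coordinates are places
on the path. -/
theorem exists_setCond (hG : G.Connected) (hD : ¬ Dominated G) {k t : ℕ} {R : ℕ → ℕ}
    {ρ : ℕ → Fin n} (hR : RepsInv G n t R) (hρ : ∀ i < t, R i = ρ i) (hk : YesInstance G k) :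
    ∃ β, SetCond G k t ρ β := by
  obtain ⟨T, hT⟩ := exists_isSubst hG hD
  have hr : ∀ q : Quotient (togetherSetoid hG hD), ∃ i < t, Quotient.mk _ (ρ i) = q := by
    intro q
    obtain ⟨u, rfl⟩ := Quotient.mk_surjective q
    obtain ⟨i, hi, x, hx, hxu⟩ := hR.cover u u.2
    obtain rfl : ρ i = x := Fin.ext ((hρ i hi).symm.trans hx)
    exact ⟨i, hi, Quotient.sound hxu⟩
  choose c hct hcq using hr
  obtain ⟨π, -, hlen, hP, hecc⟩ := (hT.yesInstance_iff (r := fun q => ρ (c q)) hcq k).1 hk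
  set P := π.map fun q => ρ (c q) with hPdef
  have hpos : ∀ (i : ℕ) (hi : i < P.length), ∃ x < t, ρ x = P[i] := by
    intro i hi
    obtain ⟨q, -, hq⟩ := List.mem_map.1 (List.getElem_mem hi)
    exact ⟨c q, hct q, hq⟩
  have hlen' : 0 < P.length := by
    rw [hPdef, List.length_map]
    omega
  obtain ⟨u, hu, hu0⟩ := hpos 0 hlen'
  have hdu : ∀ (i : ℕ) (hi : i < P.length), G.dist (ρ u) P[i] = i := by
    intro i hi
    rw [hu0, hP.dist_getElem hG hlen' hi]
    omega
  have hmem : ∀ {x i : ℕ} {hi : i < P.length}, ρ x = P[i] → ρ x ∈ P :=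
    fun h => h ▸ List.getElem_mem _
  rw [pathEcc_le_iff hG] at hecc
  refine ⟨fun x => ρ x ∈ P, ⟨u, hu, hmem hu0, fun x hx => ⟨fun y hy hbx hby => ?_,
    ?_⟩⟩, fun v hv => ?_⟩
  · obtain ⟨i, hi, hix⟩ := List.mem_iff_getElem.1 hbx
    obtain ⟨j, hj, hjy⟩ := List.mem_iff_getElem.1 hby
    rw [← hix, ← hjy, hdu, hdu, hP.dist_getElem hG hi hj]
    omega
  · by_cases hbx : ρ x ∈ P
    · obtain ⟨i, hi, hix⟩ := List.mem_iff_getElem.1 hbx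
      rcases i with _ | i
      · exact ⟨u, hu, fun _ => Or.inl (by rw [← hix, hdu])⟩
      · obtain ⟨z, hz, hzi⟩ := hpos i (by omega)
        refine ⟨z, hz, fun _ => Or.inr ⟨hmem hzi, ?_⟩⟩
        rw [hzi, ← hix, hdu, hdu]
    -- The quantifier over `z` stands before the condition that `x` is chosen, so some value is
    -- needed in this case too.
    · exact ⟨u, hu, fun h => absurd h hbx⟩
  · obtain ⟨s, hs, hd⟩ := hecc ⟨v, hv⟩
    obtain ⟨i, hi, rfl⟩ := List.mem_iff_getElem.1 hs
    obtain ⟨x, hx, hxi⟩ := hpos i hi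
    refine ⟨x, hx, hmem hxi, ⟨v, hv⟩, rfl, ?_⟩
    rw [hxi, SimpleGraph.dist_comm]
    omega

theorem exists_bits (t : ℕ) (β : ℕ → Prop) :
    ∃ c < 2 ^ t, ∀ i < t, (c / 2 ^ i % 2 ≠ 0 ↔ β i) := by
  classical
  refine ⟨Nat.ofBits fun i : Fin t => decide (β i), Nat.ofBits_lt_two_pow _, fun i hi => ?_⟩
  have h := Nat.testBit_ofBits_lt (fun i : Fin t => decide (β i)) i hi
  rw [Nat.testBit_eq_decide_div_mod_eq] at h
  have h2 := Nat.mod_two_eq_zero_or_one ((Nat.ofBits fun i : Fin t => decide (β i)) / 2 ^ i)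
  rw [← decide_eq_decide.1 h]
  omega

/-! ## The formulas -/

/-- The memory holds the number `n` of vertices, the bound `k`, the number `t` of
representatives, the distance matrix, the representatives and one bit for each of them. -/
structure Table (G : SimpleGraph (Fin n)) (k t : ℕ) (ρ : ℕ → Fin n) (s : State) : Prop where
  n_eq : s.var 0 = n
  k_eq : s.var 1 = k
  t_eq : s.var 13 = t
  dist : ∀ i j : Fin n, s.arr 1 (i * n + j) = G.dist i j
  reps : ∀ i < t, s.arr 4 i = ρ i
  bits : ∀ i < t, s.arr 5 i ≤ 1

theorem Table.setV {k t : ℕ} {ρ : ℕ → Fin n} {s : State} (h : Table G k t ρ s) {x : ℕ}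
    (hx : 13 < x) (v : ℕ) : Table G k t ρ (s.setV x v) := by
  have h0 : 0 ≠ x := by omega
  have h1 : 1 ≠ x := by omega
  have h2 : 13 ≠ x := by omega
  exact ⟨by simpa [h0] using h.n_eq, by simpa [h1] using h.k_eq, by simpa [h2] using h.t_eq,
    h.dist, h.reps, h.bits⟩

/-- The representative whose number is in variable `x`. -/
def repExpr (x : ℕ) : Expr := .read 4 (.var x)

/-- The bit of the representative whose number is in variable `x`. -/
def bitExpr (x : ℕ) : Expr := .read 5 (.var x)

/-- The distance of the representatives whose numbers are in the variables `x` and `y`. -/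
def repDist (x y : ℕ) : Expr := .entry 1 (repExpr x) (repExpr y)

section

variable {W k t : ℕ} {ρ : ℕ → Fin n} {s : State}

theorem Table.eval_repDist (h : Table G k t ρ s) {x y : ℕ} (hx : s.var x < t) (hy : s.var y < t) :
    (repDist x y).eval s = G.dist (ρ (s.var x)) (ρ (s.var y)) := by
  simp only [repDist, repExpr, Expr.eval_entry, Expr.eval, h.n_eq, h.reps _ hx, h.reps _ hy, h.dist]

theorem Table.fits_bitExpr (h : Table G k t ρ s) (hW : n * n + 2 * n + k + 20 ≤ W) (ht : t ≤ n) {x : ℕ}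
    (hx : s.var x < t) : (bitExpr x).Fits W s := by
  have := h.bits _ hx
  simp only [bitExpr, Expr.Fits, Expr.eval]
  omega

theorem Table.fits_repExpr (h : Table G k t ρ s) (hW : n * n + 2 * n + k + 20 ≤ W) (ht : t ≤ n) {x : ℕ}
    (hx : s.var x < t) : (repExpr x).Fits W s := by
  have := h.reps _ hx
  have := (ρ (s.var x)).2
  simp only [repExpr, Expr.Fits, Expr.eval]
  omega

theorem Table.fits_repDist (h : Table G k t ρ s) (hG : G.Connected) (hW : n * n + 2 * n + k + 20 ≤ W) (ht : t ≤ n)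
    {x y : ℕ} (hx : s.var x < t) (hy : s.var y < t) : (repDist x y).Fits W s := by
  have h1 := h.eval_repDist hx hy
  have h2 := dist_lt hG (ρ (s.var x)) (ρ (s.var y))
  have h3 := h.n_eq
  refine Expr.fits_entry (h.fits_repExpr hW ht hx) (h.fits_repExpr hW ht hy) (by rw [h3]; omega)
    ?_ ?_ ?_
  · simp only [repExpr, Expr.eval, h.reps _ hx, h3]
    exact (ρ _).2
  · simp only [repExpr, Expr.eval, h.reps _ hy, h3]
    exact (ρ _).2
  · change (repDist x y).eval s ≤ W
    omega

theorem Table.eval_vertexDist (h : Table G k t ρ s) {x v : ℕ} (hx : s.var x < t) (v' : Fin n) (hv : s.var v = v') :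
    (Expr.entry 1 (repExpr x) (.var v)).eval s = G.dist (ρ (s.var x)) v' := by
  simp only [repExpr, Expr.eval_entry, Expr.eval, h.n_eq, h.reps _ hx, hv, h.dist]

theorem Table.fits_vertexDist (h : Table G k t ρ s) (hG : G.Connected) (hW : n * n + 2 * n + k + 20 ≤ W) (ht : t ≤ n)
    {x v : ℕ} (hx : s.var x < t) (v' : Fin n) (hv : s.var v = v') :
    (Expr.entry 1 (repExpr x) (.var v)).Fits W s := by
  have h1 := h.eval_vertexDist hx v' hv
  have h2 := dist_lt hG (ρ (s.var x)) v'
  have h3 := h.n_eq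
  have h4 := v'.2
  refine Expr.fits_entry (h.fits_repExpr hW ht hx) ?_ (by rw [h3]; omega) ?_ ?_ ?_
  · simp only [Expr.Fits]
    omega
  · simp only [repExpr, Expr.eval, h.reps _ hx, h3]
    exact (ρ _).2
  · simp only [Expr.eval]
    omega
  · change (Expr.entry 1 (repExpr x) (.var v)).eval s ≤ W
    omega

end

/-- The distance of two chosen representatives is the difference of their distances from the
representative in variable `20`. -/
def isometryExpr : Expr :=
  .add (.add (.sub (.const 1) (bitExpr 21)) (.sub (.const 1) (bitExpr 22)))
    (.eq (repDist 21 22) (.add (.sub (repDist 20 21) (repDist 20 22))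
      (.sub (repDist 20 22) (repDist 20 21))))

/-- The chosen representative in variable `23` precedes that in variable `21`. -/
def precedesExpr : Expr :=
  .add (.add (.sub (.const 1) (bitExpr 21)) (.eq (repDist 20 21) (.const 0)))
    (.mul (bitExpr 23) (.eq (.add (repDist 20 23) (.const 1)) (repDist 20 21)))

/-- The chosen representative in variable `21` is near to the vertex in variable `24`. -/
def nearExpr : Expr :=
  .mul (bitExpr 21) (.lt (.entry 1 (repExpr 21) (.var 24)) (.add (.var 1) (.const 1)))

/-- The formula that says that the chosen representatives form a shortest path of eccentricity at
most `k`. -/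
def setFm : Fm :=
  .and (.ex 20 13 (.and (.atom (bitExpr 20)) (.all 21 13 (.and (.all 22 13 (.atom isometryExpr))
    (.ex 23 13 (.atom precedesExpr))))))
  (.all 24 0 (.ex 21 13 (.atom nearExpr)))

theorem setFm_wf : setFm.WF 30 := by
  simp [setFm, Fm.all, Fm.WF, Fm.qvars, isometryExpr, precedesExpr, nearExpr, bitExpr, repDist,
    repExpr, Expr.entry, Expr.VarsLt]

/-- In arithmetic expressions a sum acts as a disjunction, a product as a conjunction, and `1 - b`
as the negation of a bit. The absolute difference is the sum of the two truncated differences. -/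
theorem Table.isometryExpr_iff {k t : ℕ} {ρ : ℕ → Fin n} {s : State} (h : Table G k t ρ s)
    (hu : s.var 20 < t) (hx : s.var 21 < t) (hy : s.var 22 < t) :
    isometryExpr.eval s ≠ 0 ↔ (s.arr 5 (s.var 21) ≠ 0 → s.arr 5 (s.var 22) ≠ 0 →
      G.dist (ρ (s.var 21)) (ρ (s.var 22)) =
        (G.dist (ρ (s.var 20)) (ρ (s.var 21)) - G.dist (ρ (s.var 20)) (ρ (s.var 22))) +
        (G.dist (ρ (s.var 20)) (ρ (s.var 22)) - G.dist (ρ (s.var 20)) (ρ (s.var 21)))) := by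
  have h1 := h.bits _ hx
  have h2 := h.bits _ hy
  simp only [isometryExpr, Expr.eval, h.eval_repDist hx hy, h.eval_repDist hu hx,
    h.eval_repDist hu hy, bitExpr]
  split_ifs <;> omega

theorem Table.precedesExpr_iff {k t : ℕ} {ρ : ℕ → Fin n} {s : State} (h : Table G k t ρ s)
    (hu : s.var 20 < t) (hx : s.var 21 < t) (hz : s.var 23 < t) :
    precedesExpr.eval s ≠ 0 ↔ (s.arr 5 (s.var 21) ≠ 0 →
      G.dist (ρ (s.var 20)) (ρ (s.var 21)) = 0 ∨ s.arr 5 (s.var 23) ≠ 0 ∧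
        G.dist (ρ (s.var 20)) (ρ (s.var 23)) + 1 = G.dist (ρ (s.var 20)) (ρ (s.var 21))) := by
  have h1 := h.bits _ hx
  have h2 := h.bits _ hz
  simp only [precedesExpr, Expr.eval, h.eval_repDist hu hx, h.eval_repDist hu hz, bitExpr]
  split_ifs <;> omega

theorem Table.nearExpr_iff {k t : ℕ} {ρ : ℕ → Fin n} {s : State} (h : Table G k t ρ s)
    (hx : s.var 21 < t) (hv : s.var 24 < n) :
    nearExpr.eval s ≠ 0 ↔ s.arr 5 (s.var 21) ≠ 0 ∧
      ∃ v' : Fin n, v'.val = s.var 24 ∧ G.dist (ρ (s.var 21)) v' < k + 1 := by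
  have h1 := h.bits _ hx
  have h2 : (∃ v' : Fin n, v'.val = s.var 24 ∧ G.dist (ρ (s.var 21)) v' < k + 1) ↔
      G.dist (ρ (s.var 21)) ⟨s.var 24, hv⟩ < k + 1 := by
    constructor
    · rintro ⟨v', hv', h'⟩
      obtain rfl : v' = ⟨s.var 24, hv⟩ := Fin.ext hv'
      exact h'
    · exact fun h' => ⟨_, rfl, h'⟩
  simp only [nearExpr, Expr.eval, h.eval_vertexDist hx ⟨s.var 24, hv⟩ rfl, bitExpr, h2, h.k_eq]
  split_ifs <;> simp_all

theorem Table.holds_setFm {k t : ℕ} {ρ : ℕ → Fin n} {s : State} (h : Table G k t ρ s) :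
    setFm.Holds s ↔ SetCond G k t ρ fun x => s.arr 5 x ≠ 0 := by
  simp only [setFm, Fm.Holds, Fm.holds_all]
  have ht := h.t_eq
  have hn := h.n_eq
  refine and_congr ?_ ?_
  · simp only [ht]
    refine exists_congr fun u => and_congr_right fun hu => and_congr (by simp [bitExpr, Expr.eval]) ?_
    have h1 := h.setV (x := 20) (by omega) u
    simp only [h1.t_eq]
    refine forall₂_congr fun x hx => ?_
    have h2 := h1.setV (x := 21) (by omega) x
    simp only [h2.t_eq]
    refine and_congr (forall₂_congr fun y hy => ?_) (exists_congr fun z => and_congr_right fun hz => ?_)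
    · have h3 := h2.setV (x := 22) (by omega) y
      rw [h3.isometryExpr_iff] <;> simp [hu, hx, hy]
    · have h3 := h2.setV (x := 23) (by omega) z
      rw [h3.precedesExpr_iff] <;> simp [hu, hx, hz]
  · simp only [hn]
    refine forall₂_congr fun v hv => ?_
    have h1 := h.setV (x := 24) (by omega) v
    simp only [h1.t_eq]
    refine exists_congr fun x => and_congr_right fun hx => ?_
    have h2 := h1.setV (x := 21) (by omega) x
    rw [h2.nearExpr_iff] <;> simp [hx, hv]

theorem Table.fits_setFm {W k t : ℕ} {ρ : ℕ → Fin n} {s : State} (h : Table G k t ρ s)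
    (hG : G.Connected) (hW : n * n + 2 * n + k + 20 ≤ W) (ht : t ≤ n) :
    setFm.Fits W n s := by
  simp only [setFm, Fm.Fits, Fm.all, h.t_eq, h.n_eq]
  refine ⟨⟨ht, fun u hu => ?_⟩, le_rfl, fun v hv => ?_⟩
  · have h1 := h.setV (x := 20) (by omega) u
    refine ⟨h1.fits_bitExpr hW ht (by simpa using hu), by rwa [h1.t_eq], fun x hx => ?_⟩
    rw [h1.t_eq] at hx
    have h2 := h1.setV (x := 21) (by omega) x
    simp only [h2.t_eq]
    refine ⟨⟨ht, fun y hy => ?_⟩, ht, fun z hz => ?_⟩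
    · have h3 := h2.setV (x := 22) (by omega) y
      set s' := ((s.setV 20 u).setV 21 x).setV 22 y with hs'
      have hu' : s'.var 20 < t := by simpa [hs'] using hu
      have hx' : s'.var 21 < t := by simpa [hs'] using hx
      have hy' : s'.var 22 < t := by simpa [hs'] using hy
      have d1 := dist_lt hG (ρ (s'.var 20)) (ρ (s'.var 21))
      have d2 := dist_lt hG (ρ (s'.var 20)) (ρ (s'.var 22))
      simp only [isometryExpr, Expr.Fits, h3.fits_bitExpr hW ht hx', h3.fits_bitExpr hW ht hy',
        h3.fits_repDist hG hW ht hu' hx', h3.fits_repDist hG hW ht hu' hy',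
        h3.fits_repDist hG hW ht hx' hy', Expr.eval, h3.eval_repDist hu' hx',
        h3.eval_repDist hu' hy', true_and, and_true]
      refine ⟨⟨by omega, by omega, by omega⟩, ⟨by omega, by omega⟩, ?_⟩
      split_ifs <;> omega
    · have h3 := h2.setV (x := 23) (by omega) z
      set s' := ((s.setV 20 u).setV 21 x).setV 23 z with hs'
      have hu' : s'.var 20 < t := by simpa [hs'] using hu
      have hx' : s'.var 21 < t := by simpa [hs'] using hx
      have hz' : s'.var 23 < t := by simpa [hs'] using hz
      have d1 := dist_lt hG (ρ (s'.var 20)) (ρ (s'.var 23))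
      have hb := h3.bits _ hz'
      have hb' := h3.bits _ hx'
      simp only [precedesExpr, Expr.Fits,
        h3.fits_repDist hG hW ht hu' hx', h3.fits_repDist hG hW ht hu' hz', Expr.eval,
        h3.eval_repDist hu' hx', h3.eval_repDist hu' hz', true_and, bitExpr]
      split_ifs <;> omega
  · have h1 := h.setV (x := 24) (by omega) v
    refine ⟨by rwa [h1.t_eq], fun x hx => ?_⟩
    rw [h1.t_eq] at hx
    have h2 := h1.setV (x := 21) (by omega) x
    set s' := (s.setV 24 v).setV 21 x with hs'
    have hx' : s'.var 21 < t := by simpa [hs'] using hx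
    have hv' : s'.var 24 = v := by simp [hs']
    have hb := h2.bits _ hx'
    simp only [nearExpr, Expr.Fits,
      h2.fits_vertexDist hG hW ht hx' ⟨v, hv⟩ hv', Expr.eval, h2.k_eq, true_and, bitExpr]
    split_ifs <;> omega

/-- Quantifiers are nested at most three deep, and each runs over at most `n` values. -/
theorem cost_setFm (hn : 0 < n) : setFm.cost n ≤ 1000 * n ^ 3 := by
  have h1 : n ≤ n ^ 3 := Nat.le_self_pow (by norm_num) n
  have h2 : n ^ 2 ≤ n ^ 3 := Nat.pow_le_pow_right hn (by norm_num)
  have h3 : 1 ≤ n ^ 3 := Nat.one_le_pow _ _ hn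
  simp only [setFm, Fm.all, Fm.cost, isometryExpr, precedesExpr, nearExpr, bitExpr, repDist,
    repExpr, Expr.cost_entry, Expr.cost]
  nlinarith

end Sets

/-! ## The search over all sets of representatives -/

section Search

variable {n : ℕ} {G : SimpleGraph (Fin n)}

/-- Add one to the binary number in array `5`, the length of which is in variable `13`, and set
variable `14` to `0` in case of an overflow. -/
def incProg : Prog :=
  .seq (.assign 16 (.const 1)) (.seq
    (forP 17 13 (.seq (.assign 18 (.read 5 (.var 17)))
      (.seq (.write 5 (.var 17) (.sub (.const 1) (.eq (.var 18) (.var 16))))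
        (.assign 16 (.mul (.var 18) (.var 16))))))
    (.assign 14 (.sub (.const 1) (.var 16))))

/-- This is addition with a carry. The carry into place `i` is `1` exactly if `2 ^ i` divides `c +
1`; the new bit is the exclusive or of bit and carry, and the new carry is their product. The last
carry signals the overflow. -/
theorem runs_incProg {W t c : ℕ} (hW : t + 2 ≤ W) {s : State} (ht : s.var 13 = t)
    (hs : ∀ i < t, s.arr 5 i = c / 2 ^ i % 2) :
    Runs W incProg s (t * 22 + 12) (fun s' => (∀ i < t, s'.arr 5 i = (c + 1) / 2 ^ i % 2) ∧
      s'.var 14 = if 2 ^ t ∣ c + 1 then 0 else 1) := by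
  refine (Runs.seq (t₁ := 2) (t₂ := (t * (14 + 8) + 6) + 4) (Runs.assign ?_ (Runs.seq
    ((Runs.forP (N := t) (fun i s' => s'.var 16 = (if 2 ^ i ∣ c + 1 then 1 else 0) ∧
      ∀ j < t, s'.arr 5 j = (if j < i then c + 1 else c) / 2 ^ j % 2)
    (by decide) (by decide) (by decide) (by simpa using ht) (by omega) (by omega) ?_ ?_).mono le_rfl
    ?_)))).mono (by omega) fun _ h => h
  · simp only [Expr.Fits]
    omega
  · exact ⟨by simp [Expr.eval], by simpa using hs⟩
  · rintro i s₁ hi h17 - - ⟨h16, hbits⟩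
    have hb := hbits i hi
    rw [if_neg (lt_irrefl i)] at hb
    have hb2 : c / 2 ^ i % 2 < 2 := Nat.mod_lt _ two_pos
    have hle : s₁.var 16 ≤ 1 := by
      rw [h16]
      split_ifs <;> omega
    have hmul : c / 2 ^ i % 2 * s₁.var 16 ≤ 1 * 1 := Nat.mul_le_mul (by omega) hle
    have hdvd : 2 ^ (i + 1) ∣ c + 1 ↔ 2 ^ i ∣ c + 1 ∧ c / 2 ^ i % 2 = 1 := by
      constructor
      · intro h
        have h1 : 2 ^ i ∣ c + 1 := (pow_dvd_pow 2 (Nat.le_succ i)).trans h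
        refine ⟨h1, ?_⟩
        have h2 := Nat.succ_div_of_dvd h1
        have h3 : 2 ∣ (c + 1) / 2 ^ i := by
          obtain ⟨d, hd⟩ := h
          exact ⟨d, by rw [hd, pow_succ, mul_assoc, Nat.mul_div_cancel_left _ (by positivity)]⟩
        omega
      · rintro ⟨h1, h2⟩
        have h3 := Nat.succ_div_of_dvd h1
        have h4 : 2 ∣ (c + 1) / 2 ^ i := by omega
        rw [pow_succ]
        exact Nat.mul_dvd_of_dvd_div h1 h4
    refine (Runs.seq (t₁ := 3) (t₂ := 11) (Runs.assign ?_ (Runs.seq (t₁ := 7) (t₂ := 4)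
      (Runs.write ?_ ?_ (Runs.assign ?_ ⟨?_, ?_⟩))))).mono le_rfl fun _ h => h
    · simp only [Expr.Fits, Expr.eval, h17, hb]
      omega
    · simp only [Expr.Fits, State.setV_var]
      rw [if_neg (by decide), h17]
      omega
    · simp only [Expr.Fits, Expr.eval, State.setV_var, h17, hb]
      simp only [if_true, reduceIte, Nat.reduceEqDiff]
      omega
    · simp only [Expr.Fits, Expr.eval, State.setV_var, State.setA_var, h17, hb]
      simp only [if_true, reduceIte, Nat.reduceEqDiff]
      omega
    · simp only [Expr.eval, State.setV_var, State.setA_var, h17, hb]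
      simp only [if_true, reduceIte, Nat.reduceEqDiff, h16, hdvd]
      by_cases h1 : 2 ^ i ∣ c + 1
      · rcases Nat.mod_two_eq_zero_or_one (c / 2 ^ i) with h2 | h2 <;> simp [h1, h2]
      · simp [h1]
    · intro j hj
      simp only [Expr.eval, State.setV_var, State.setV_arr, State.setA_arr, State.setA_var, h17, hb]
      simp only [if_true, reduceIte, Nat.reduceEqDiff, h16, true_and]
      by_cases hji : j = i
      · subst hji
        rw [if_pos rfl, if_pos (Nat.lt_succ_self j), Nat.succ_div]
        rcases Nat.mod_two_eq_zero_or_one (c / 2 ^ j) with h2 | h2 <;>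
          split_ifs <;> omega
      · rw [if_neg hji, hbits j hj]
        have : j < i + 1 ↔ j < i := by omega
        simp only [this]
  · rintro s₁ ⟨h16, hbits⟩
    refine Runs.assign ?_ ⟨?_, ?_⟩
    · simp only [Expr.Fits, h16]
      split_ifs <;> omega
    · intro i hi
      rw [State.setV_arr, hbits i hi, if_pos hi]
    · simp only [Expr.eval, State.setV_var, if_true, h16]
      split_ifs <;> rfl

/-- The program that sets variable `15` to `1` if some set of representatives satisfies the
condition. -/
def searchProg : Prog :=
  .seq (.assign 15 (.const 0)) (.seq (.assign 14 (.const 1))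
    (.while (.var 14) (.seq (setFm.prog 30) (.seq
      (.ite (.var 30) (.assign 15 (.const 1)) .skip) incProg))))

open Classical in
theorem runs_searchProg {W k t : ℕ} {ρ : ℕ → Fin n} (hG : G.Connected)
    (hW : n * n + 2 * n + k + 20 ≤ W) (ht : t ≤ n) {s : State} (hs : Table G k t ρ s)
    (h0 : ∀ i < t, s.arr 5 i = 0) (hq : ∀ x, 20 ≤ x → x < 30 → s.var x = 0) :
    Runs W searchProg s (2000 * (2 ^ t * n ^ 3)) (fun s' => s'.var 15 =
      if ∃ c < 2 ^ t, SetCond G k t ρ (fun x => c / 2 ^ x % 2 ≠ 0) then 1 else 0) := by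
  have hn : 0 < n := Fin.pos_iff_nonempty.2 hG.nonempty
  -- With `m` rounds left, the sets coded by numbers less than `c = 2 ^ t - m` have been tried.
  -- Variable `14` controls the loop and variable `15` holds the answer so far.
  set I : ℕ → State → Prop := fun m s' => ∃ c, c + m = 2 ^ t ∧ Table G k t ρ s' ∧
    (0 < m → ∀ i < t, s'.arr 5 i = c / 2 ^ i % 2) ∧ (∀ x, 20 ≤ x → x < 30 → s'.var x = 0) ∧
    s'.var 14 = (if m = 0 then 0 else 1) ∧
    s'.var 15 = if ∃ d < c, SetCond G k t ρ (fun x => d / 2 ^ x % 2 ≠ 0) then 1 else 0 with hI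
  have hloop : ∀ s', I (2 ^ t) s' → Runs W (.while (.var 14) (.seq (setFm.prog 30) (.seq
      (.ite (.var 30) (.assign 15 (.const 1)) .skip) incProg))) s'
      (2 ^ t * (2 + (1000 * n ^ 3 + (4 + (n * 22 + 12)))) + 2) (I 0) := by
    refine fun s' hs' => Runs.while I ?_ ?_ ?_ (2 ^ t) s' hs'
    · rintro m s₁ ⟨c, -, -, -, -, h14, -⟩
      simp only [Expr.Fits, h14]
      split_ifs <;> omega
    · rintro m s₁ ⟨c, hc, hT, hbits, hz, h14, h15⟩
      refine ⟨by simp [Expr.eval, h14], Runs.seq (((Fm.runs_prog (N := n) (B := 30) (by omega)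
        (by omega) setFm setFm_wf le_rfl (hT.fits_setFm hG hW ht) ?_).mono
        (cost_setFm hn) ?_))⟩
      · intro x hx
        simp only [setFm, Fm.all, Fm.qvars] at hx
        simp at hx
        exact hz x (by omega) (by omega)
      · rintro s₂ ⟨⟨hv₂, ha₂⟩, h30⟩
        have hcond : setFm.Holds s₁ ↔ SetCond G k t ρ (fun x => c / 2 ^ x % 2 ≠ 0) := by
          rw [hT.holds_setFm]
          have : ∀ x < t, (s₁.arr 5 x ≠ 0 ↔ c / 2 ^ x % 2 ≠ 0) := fun x hx => by
            rw [hbits (Nat.succ_pos m) x hx]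
          exact ⟨SetCond.congr this, SetCond.congr fun x hx => (this x hx).symm⟩
        have hex : (∃ d < c + 1, SetCond G k t ρ (fun x => d / 2 ^ x % 2 ≠ 0)) ↔
            (∃ d < c, SetCond G k t ρ (fun x => d / 2 ^ x % 2 ≠ 0)) ∨
              SetCond G k t ρ (fun x => c / 2 ^ x % 2 ≠ 0) := by
          constructor
          · rintro ⟨d, hd, h⟩
            rcases Nat.lt_succ_iff_lt_or_eq.1 hd with h' | rfl
            · exact Or.inl ⟨d, h', h⟩
            · exact Or.inr h
          · rintro (⟨d, hd, h⟩ | h)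
            · exact ⟨d, by omega, h⟩
            · exact ⟨c, by omega, h⟩
        have hinc : ∀ s₃ : State, (∀ x < 30, x ≠ 15 → s₃.var x = s₁.var x) → s₃.arr = s₁.arr →
            s₃.var 15 = (if ∃ d < c + 1, SetCond G k t ρ (fun x => d / 2 ^ x % 2 ≠ 0) then 1
              else 0) → Runs W incProg s₃ (n * 22 + 12) (I m) := by
          intro s₃ hv₃ ha₃ h15₃
          have h13 : s₃.var 13 = t := (hv₃ 13 (by decide) (by decide)).trans hT.t_eq
          refine (runs_incProg (c := c) (by omega) h13 ?_).frame.mono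
            (by have := Nat.mul_le_mul_right 22 ht; omega) ?_
          · rw [ha₃]
            exact hbits (Nat.succ_pos m)
          · rintro s₄ ⟨hF, hb₄, h14₄⟩
            have hv₄ : ∀ x, x ∉ incProg.wv → x < 30 → x ≠ 15 → s₄.var x = s₁.var x :=
              fun x h1 h2 h3 => (hF.1 x h1).trans (hv₃ x h2 h3)
            have ha₄ : ∀ a, a ∉ incProg.wa → s₄.arr a = s₁.arr a := fun a h1 => by
              rw [hF.2 a h1, ha₃]
            refine ⟨c + 1, by omega, ⟨?_, ?_, ?_, ?_, ?_, ?_⟩, fun _ => hb₄, ?_, ?_, ?_⟩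
            · rw [hv₄ 0 (by decide) (by decide) (by decide), hT.n_eq]
            · rw [hv₄ 1 (by decide) (by decide) (by decide), hT.k_eq]
            · rw [hv₄ 13 (by decide) (by decide) (by decide), hT.t_eq]
            · rw [ha₄ 1 (by decide)]
              exact hT.dist
            · rw [ha₄ 4 (by decide)]
              exact hT.reps
            · intro i hi
              rw [hb₄ i hi]
              have := Nat.mod_lt ((c + 1) / 2 ^ i) two_pos
              omega
            · intro x h1 h2
              rw [hv₄ x ?_ h2 (by omega), hz x h1 h2]
              simp [incProg, forP, Prog.wv]
              omega
            · rw [h14₄]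
              -- Since `0 < c + 1 ≤ 2 ^ t`, divisibility means equality, so the counter overflows
              -- exactly after the last set.
              have : 2 ^ t ∣ c + 1 ↔ m = 0 := by
                constructor
                · intro hd
                  have := Nat.le_of_dvd (Nat.succ_pos c) hd
                  omega
                · rintro rfl
                  rw [hc]
              simp only [this]
            · rw [hF.1 15 (by decide), h15₃]
        refine Runs.seq (t₁ := 4) (Runs.ite (t := 2) (e := .var 30) ?_ (fun h => ?_) fun h => ?_)
        · simp only [Expr.Fits, h30]
          split_ifs <;> omega
        · have hh : setFm.Holds s₁ := by
            by_contra hh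
            simp [Expr.eval, h30, hh] at h
          refine Runs.assign (by simp only [Expr.Fits]; omega) (hinc _ ?_ ?_ ?_)
          · intro x h1 h2
            simp [h2, hv₂ x h1]
          · simp [ha₂]
          · rw [if_pos (hex.2 (Or.inr (hcond.1 hh)))]
            simp [Expr.eval]
        · have hh : ¬ setFm.Holds s₁ := by
            intro hh
            simp [Expr.eval, h30, hh] at h
          rw [hcond] at hh
          refine (Runs.skip (hinc _ (fun x h1 _ => hv₂ x h1) ha₂ ?_)).mono (by omega) fun _ h => h
          rw [hv₂ 15 (by decide), h15]
          simp only [hex, hh, or_false]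
    · rintro s₁ ⟨c, -, -, -, -, h14, -⟩
      simp [Expr.eval, h14]
  refine (Runs.seq (t₁ := 2) (Runs.assign (by simp [Expr.Fits]) (Runs.seq (t₁ := 2)
    (Runs.assign (by simp only [Expr.Fits]; omega) ((hloop _ ?_).mono le_rfl ?_))))).mono ?_
    fun _ h => h
  · refine ⟨0, by omega, (hs.setV (by decide) _).setV (by decide) _, fun _ i hi => ?_,
      fun x h1 h2 => ?_, ?_, ?_⟩
    · simpa using h0 i hi
    · have h3 : x ≠ 14 := by omega
      have h4 : x ≠ 15 := by omega
      simpa [h3, h4] using hq x h1 h2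
    · simp [Expr.eval]
    · simp [Expr.eval]
  · rintro s₁ ⟨c, hc, -, -, -, -, h15⟩
    obtain rfl : c = 2 ^ t := hc
    exact h15
  · have h1 : n ≤ n ^ 3 := Nat.le_self_pow (by norm_num) n
    have h3 : 1 ≤ n ^ 3 := Nat.one_le_pow _ _ hn
    have h4 : 1 ≤ 2 ^ t := Nat.one_le_two_pow
    have h5 : 2 ^ t * n ≤ 2 ^ t * n ^ 3 := Nat.mul_le_mul_left _ h1
    have h6 : 2 ^ t ≤ 2 ^ t * n ^ 3 := Nat.le_mul_of_pos_right _ (by omega)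
    nlinarith

end Search

/-! ## The program for the Minimum Eccentricity Shortest Path problem -/

section Main

variable {n : ℕ} {G : SimpleGraph (Fin n)}

/-- A path of eccentricity `0` contains all vertices, and a shortest path repeats none, so it has
`n` vertices and its ends are at distance `n - 1`. Conversely a path with `n` vertices misses none.
-/
theorem yesInstance_zero_iff (hG : G.Connected) :
    YesInstance G 0 ↔ ∃ u v, G.dist u v + 1 = n := by
  constructor
  · rintro ⟨P, hP, hk⟩
    rw [pathEcc_le_iff hG] at hk
    have hlen := List.length_pos_iff.2 hP.ne_nil
    have hinj : Function.Injective fun i : Fin P.length => P[i] := by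
      intro i j hij
      have h1 := hP.dist_getElem hG i.2 j.2
      have h2 : P[i.val] = P[j.val] := hij
      rw [h2, SimpleGraph.dist_self] at h1
      exact Fin.ext (by omega)
    have hsurj : Function.Surjective fun i : Fin P.length => P[i] := by
      intro v
      obtain ⟨s, hs, hd⟩ := hk v
      obtain rfl : v = s := hG.dist_eq_zero_iff.1 (by omega)
      obtain ⟨i, hi, hiv⟩ := List.mem_iff_getElem.1 hs
      exact ⟨⟨i, hi⟩, hiv⟩
    have hcard := Fintype.card_of_bijective ⟨hinj, hsurj⟩
    simp only [Fintype.card_fin] at hcard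
    refine ⟨P[0], P[P.length - 1], ?_⟩
    rw [hP.dist_getElem hG hlen (by omega)]
    omega
  · rintro ⟨u, v, huv⟩
    obtain ⟨p, hp, hlen⟩ := hG.exists_path_of_dist u v
    refine ⟨p.support, ⟨u, v, p, hlen, rfl⟩, ?_⟩
    rw [pathEcc_le_iff hG]
    have hcard : p.support.toFinset.card = Fintype.card (Fin n) := by
      rw [List.toFinset_card_of_nodup hp.support_nodup, p.length_support, Fintype.card_fin]
      omega
    rw [Finset.card_eq_iff_eq_univ] at hcard
    intro w
    refine ⟨w, ?_, by simp⟩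
    rw [← List.mem_toFinset, hcard]
    exact Finset.mem_univ w

theorem Dominated.yesInstance (hG : G.Connected) (h : Dominated G) {k : ℕ} (hk : 1 ≤ k) :
    YesInstance G k := by
  obtain ⟨u, v, huv, h⟩ := h
  have hle : ∀ a x, (a = x ∨ G.Adj a x) → G.dist x a ≤ k := by
    rintro a x (rfl | hax)
    · simp
    · rwa [SimpleGraph.dist_eq_one_iff_adj.2 hax.symm]
  rcases huv with rfl | huv
  · refine ⟨[u], ⟨u, u, .nil, by simp, rfl⟩, (pathEcc_le_iff hG k).2 fun x => ⟨u, by simp, ?_⟩⟩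
    exact hle u x ((h x).elim id id)
  · refine ⟨[u, v], isShortestPath_pair huv, (pathEcc_le_iff hG k).2 fun x => ?_⟩
    rcases h x with h | h
    · exact ⟨u, by simp, hle u x h⟩
    · exact ⟨v, by simp, hle v x h⟩

/-! ### The easy cases and the complete program. -/

/-- The distance of the vertices in the variables `x` and `y`. -/
def vertexDist (x y : ℕ) : Expr := .entry 1 (.var x) (.var y)

/-- The formula that says that some shortest path contains all vertices. -/
def spanningFm : Fm :=
  .ex 20 0 (.ex 21 0 (.atom (.eq (.add (vertexDist 20 21) (.const 1)) (.var 0))))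

/-- The formula that says that some vertex or edge dominates the graph. -/
def dominatedFm : Fm :=
  .ex 20 0 (.ex 21 0 (.and (.atom (.lt (vertexDist 20 21) (.const 2)))
    (.all 22 0 (.atom (.add (.lt (vertexDist 20 22) (.const 2))
      (.lt (vertexDist 21 22) (.const 2)))))))

theorem spanningFm_wf : spanningFm.WF 30 := by
  simp [spanningFm, Fm.WF, Fm.qvars, vertexDist, Expr.entry, Expr.VarsLt]

theorem dominatedFm_wf : dominatedFm.WF 30 := by
  simp [dominatedFm, Fm.all, Fm.WF, Fm.qvars, vertexDist, Expr.entry, Expr.VarsLt]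

/-- Variable `0` holds the number of vertices and array `1` the distance matrix. -/
def HasDist (G : SimpleGraph (Fin n)) (s : State) : Prop :=
  s.var 0 = n ∧ ∀ i j : Fin n, s.arr 1 (i * n + j) = G.dist i j

theorem HasDist.setV {s : State} (h : HasDist G s) {x : ℕ} (hx : 0 < x) (v : ℕ) :
    HasDist G (s.setV x v) := by
  have : 0 ≠ x := by omega
  exact ⟨by simpa [this] using h.1, h.2⟩

theorem HasDist.eval_vertexDist {s : State} (h : HasDist G s) {x y : ℕ} {a b : Fin n}
    (hx : s.var x = a) (hy : s.var y = b) : (vertexDist x y).eval s = G.dist a b := by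
  simp only [vertexDist, Expr.eval_entry, Expr.eval, h.1, hx, hy, h.2]

theorem HasDist.fits_vertexDist (hG : G.Connected) {W : ℕ} (hW : n * n + n ≤ W) {s : State}
    (h : HasDist G s) {x y : ℕ} {a b : Fin n} (hx : s.var x = a) (hy : s.var y = b) :
    (vertexDist x y).Fits W s := by
  have h1 := h.1
  have h2 := dist_lt hG a b
  have h3 := h.eval_vertexDist hx hy
  have ha := a.2
  have hb := b.2
  refine Expr.fits_entry ?_ ?_ (by rw [h1]; omega) ?_ ?_ ?_
  any_goals simp only [Expr.Fits, Expr.eval]; omega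
  change (vertexDist x y).eval s ≤ W
  omega

theorem exists_lt_iff {p : ℕ → Prop} : (∃ i < n, p i) ↔ ∃ i : Fin n, p i :=
  ⟨fun ⟨i, hi, h⟩ => ⟨⟨i, hi⟩, h⟩, fun ⟨i, h⟩ => ⟨i, i.2, h⟩⟩

theorem forall_lt_iff {p : ℕ → Prop} : (∀ i < n, p i) ↔ ∀ i : Fin n, p i :=
  ⟨fun h i => h i i.2, fun h i hi => h ⟨i, hi⟩⟩

theorem HasDist.holds_spanningFm {s : State} (h : HasDist G s) :
    spanningFm.Holds s ↔ ∃ u v, G.dist u v + 1 = n := by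
  simp only [spanningFm, Fm.Holds, h.1]
  rw [exists_lt_iff]
  refine exists_congr fun u => ?_
  have h1 := h.setV (x := 20) (by omega) u
  simp only [h1.1]
  rw [exists_lt_iff]
  refine exists_congr fun v => ?_
  have h2 := h1.setV (x := 21) (by omega) v
  simp only [Expr.eval, h2.eval_vertexDist (x := 20) (y := 21) (a := u) (b := v) (by simp) (by simp),
    h2.1]
  simp

theorem dist_lt_two_iff (hG : G.Connected) (u v : Fin n) :
    G.dist u v < 2 ↔ u = v ∨ G.Adj u v := by
  rw [← hG.dist_eq_zero_iff, ← SimpleGraph.dist_eq_one_iff_adj]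
  omega

theorem HasDist.holds_dominatedFm (hG : G.Connected) {s : State} (h : HasDist G s) :
    dominatedFm.Holds s ↔ Dominated G := by
  simp only [dominatedFm, Fm.Holds, Fm.holds_all, h.1, Dominated]
  rw [exists_lt_iff]
  refine exists_congr fun u => ?_
  have h1 := h.setV (x := 20) (by omega) u
  simp only [h1.1]
  rw [exists_lt_iff]
  refine exists_congr fun v => ?_
  have h2 := h1.setV (x := 21) (by omega) v
  simp only [Expr.eval, h2.eval_vertexDist (x := 20) (y := 21) (a := u) (b := v) (by simp) (by simp),
    h2.1]
  refine and_congr ?_ ?_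
  · rw [← dist_lt_two_iff hG]
    simp
  · rw [forall_lt_iff]
    refine forall_congr' fun x => ?_
    have h3 := h2.setV (x := 22) (by omega) x
    rw [h3.eval_vertexDist (x := 20) (y := 22) (a := u) (b := x) (by simp) (by simp),
      h3.eval_vertexDist (x := 21) (y := 22) (a := v) (b := x) (by simp) (by simp),
      ← dist_lt_two_iff hG, ← dist_lt_two_iff hG]
    split_ifs <;> simp_all

theorem HasDist.fits_spanningFm (hG : G.Connected) {W : ℕ} (hW : n * n + n + 2 ≤ W) {s : State}
    (h : HasDist G s) : spanningFm.Fits W n s := by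
  simp only [spanningFm, Fm.Fits, h.1]
  refine ⟨le_rfl, fun u hu => ?_⟩
  have h1 := h.setV (x := 20) (by omega) u
  simp only [h1.1]
  refine ⟨le_rfl, fun v hv => ?_⟩
  have h2 := h1.setV (x := 21) (by omega) v
  have hu' : ((s.setV 20 u).setV 21 v).var 20 = (⟨u, hu⟩ : Fin n) := by simp
  have hv' : ((s.setV 20 u).setV 21 v).var 21 = (⟨v, hv⟩ : Fin n) := by simp
  have hd := dist_lt hG ⟨u, hu⟩ ⟨v, hv⟩
  simp only [Expr.Fits, Expr.eval, h2.fits_vertexDist hG (W := W) (by omega) hu' hv',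
    h2.eval_vertexDist hu' hv', h2.1, true_and]
  omega

theorem HasDist.fits_dominatedFm (hG : G.Connected) {W : ℕ} (hW : n * n + n + 2 ≤ W) {s : State}
    (h : HasDist G s) : dominatedFm.Fits W n s := by
  simp only [dominatedFm, Fm.all, Fm.Fits, h.1]
  refine ⟨le_rfl, fun u hu => ?_⟩
  have h1 := h.setV (x := 20) (by omega) u
  simp only [h1.1]
  refine ⟨le_rfl, fun v hv => ?_⟩
  have h2 := h1.setV (x := 21) (by omega) v
  have hu' : ((s.setV 20 u).setV 21 v).var 20 = (⟨u, hu⟩ : Fin n) := by simp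
  have hv' : ((s.setV 20 u).setV 21 v).var 21 = (⟨v, hv⟩ : Fin n) := by simp
  simp only [Expr.Fits, h2.fits_vertexDist hG (W := W) (by omega) hu' hv', h2.1, true_and]
  refine ⟨by omega, le_rfl, fun x hx => ?_⟩
  have h3 := h2.setV (x := 22) (by omega) x
  set s' := ((s.setV 20 u).setV 21 v).setV 22 x with hs'
  have hu' : s'.var 20 = (⟨u, hu⟩ : Fin n) := by simp [hs']
  have hv' : s'.var 21 = (⟨v, hv⟩ : Fin n) := by simp [hs']
  have hx' : s'.var 22 = (⟨x, hx⟩ : Fin n) := by simp [hs']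
  have hle : ∀ a b : ℕ, (if a < b then 1 else 0) ≤ 1 := fun a b => by split_ifs <;> omega
  simp only [h3.fits_vertexDist hG (W := W) (by omega) hu' hx',
    h3.fits_vertexDist hG (W := W) (by omega) hv' hx', Expr.eval, true_and]
  exact ⟨by omega, by omega, (Nat.add_le_add (hle _ _) (hle _ _)).trans (by omega)⟩

theorem cost_spanningFm (hn : 0 < n) : spanningFm.cost n ≤ 100 * n ^ 3 := by
  have h1 : n ≤ n ^ 3 := Nat.le_self_pow (by norm_num) n
  have h2 : n ^ 2 ≤ n ^ 3 := Nat.pow_le_pow_right hn (by norm_num)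
  have h3 : 1 ≤ n ^ 3 := Nat.one_le_pow _ _ hn
  simp only [spanningFm, Fm.cost, vertexDist, Expr.cost_entry, Expr.cost]
  nlinarith

theorem cost_dominatedFm (hn : 0 < n) : dominatedFm.cost n ≤ 200 * n ^ 3 := by
  have h1 : n ≤ n ^ 3 := Nat.le_self_pow (by norm_num) n
  have h2 : n ^ 2 ≤ n ^ 3 := Nat.pow_le_pow_right hn (by norm_num)
  have h3 : 1 ≤ n ^ 3 := Nat.one_le_pow _ _ hn
  simp only [dominatedFm, Fm.all, Fm.cost, vertexDist, Expr.cost_entry, Expr.cost]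
  nlinarith

/-- The program that decides the Minimum Eccentricity Shortest Path problem. -/
def mespProg : Prog :=
  .seq distProg (.ite (.var 1)
    (.seq (dominatedFm.prog 30) (.ite (.var 30) (.assign 0 (.const 1))
      (.seq repsProg (.seq searchProg (.assign 0 (.var 15))))))
    (.seq (spanningFm.prog 30) (.assign 0 (.var 30))))

-- Every set accepted by the search is a shortest path of the graph. Conversely a yes-instance has a
-- suitable set of representatives, whose bits are those of some number less than `2 ^ t`.
open Classical in
theorem runs_repsProg_searchProg (hG : G.Connected) (hD : ¬ Dominated G) {W k : ℕ}
    (hW : n * n + 2 * n + k + 20 ≤ W) {s : State} (hs : HasInput G s) (hk : s.var 1 = k)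
    (hd : HasDist G s) (h5 : ∀ i, s.arr 5 i = 0) (hq : ∀ x, 20 ≤ x → x < 30 → s.var x = 0) :
    Runs W (.seq repsProg (.seq searchProg (.assign 0 (.var 15)))) s
      (2300 * (2 ^ modularWidth G * n ^ 3)) (fun s' => s'.var 0 = if YesInstance G k then 1 else 0) := by
  have hn : 0 < n := Fin.pos_iff_nonempty.2 hG.nonempty
  have hpos : 1 ≤ 2 ^ modularWidth G * n ^ 3 :=
    Nat.mul_pos (by positivity) (by positivity)
  refine (Runs.seq (t₂ := 2000 * (2 ^ modularWidth G * n ^ 3) + 2)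
    ((runs_repsProg (by omega) hG hD hs).frame.mono le_rfl ?_)).mono (by omega) fun _ h => h
  rintro s₁ ⟨hF, hR⟩
  -- Only the entries before place `t` are known to be vertices; beyond them `ρ` may take the
  -- default value `0`.
  have hρ : ∃ ρ : ℕ → Fin n, ∀ i < s₁.var 13, s₁.arr 4 i = ρ i := by
    refine ⟨fun i => if h : s₁.arr 4 i < n then ⟨_, h⟩ else ⟨0, hn⟩, fun i hi => ?_⟩
    obtain ⟨x, hx, -⟩ := hR.vertex i hi
    have : s₁.arr 4 i < n := hx ▸ x.2
    simp [this]
  obtain ⟨ρ, hρ⟩ := hρ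
  have h5₁ : ∀ i, s₁.arr 5 i = 0 := by
    rw [hF.2 5 (by decide)]
    exact h5
  have hT : Table G k (s₁.var 13) ρ s₁ := by
    refine ⟨(hF.1 0 (by decide)).trans hs.1, (hF.1 1 (by decide)).trans hk, rfl, ?_, hρ,
      fun i _ => (h5₁ i).le.trans zero_le_one⟩
    rw [hF.2 1 (by decide)]
    exact hd.2
  have hq₁ : ∀ x, 20 ≤ x → x < 30 → s₁.var x = 0 := by
    intro x h1 h2
    rw [hF.1 x ?_, hq x h1 h2]
    simp [repsProg, coveredProg, closureProg, closureRow, forP, Prog.wv]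
    omega
  have hle : 2000 * (2 ^ s₁.var 13 * n ^ 3) ≤ 2000 * (2 ^ modularWidth G * n ^ 3) :=
    Nat.mul_le_mul_left _ (Nat.mul_le_mul_right _
      (Nat.pow_le_pow_right two_pos (hR.le_width hG hD)))
  refine Runs.seq ((runs_searchProg hG hW (hR.le hD) hT (fun i _ => h5₁ i) hq₁).mono hle ?_)
  intro s₂ h15
  have hiff : (∃ c < 2 ^ s₁.var 13, SetCond G k (s₁.var 13) ρ fun x => c / 2 ^ x % 2 ≠ 0) ↔
      YesInstance G k := by
    constructor
    · rintro ⟨c, -, h⟩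
      exact h.yesInstance hG
    · intro h
      obtain ⟨β, hβ⟩ := exists_setCond hG hD hR hρ h
      obtain ⟨c, hc, hcβ⟩ := exists_bits (s₁.var 13) β
      exact ⟨c, hc, hβ.congr fun x hx => (hcβ x hx).symm⟩
  simp only [hiff] at h15
  refine Runs.assign ?_ ?_
  · simp only [Expr.Fits, h15]
    split_ifs <;> omega
  · simp [Expr.eval, h15]

theorem hasInput_inputState (k : ℕ) : HasInput G (inputState G k) := by
  refine ⟨by simp [inputState], fun i j => ⟨fun h => ?_, fun h => ?_⟩⟩
  · simp only [inputState, true_and]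
    exact if_pos ⟨rfl, i, j, rfl, h⟩
  · simp only [inputState, true_and]
    refine if_neg ?_
    rintro ⟨-, i', j', h1, h2⟩
    obtain ⟨h3, h4⟩ := (index_inj j.2 j'.2).1 h1
    rw [Fin.ext h3, Fin.ext h4] at h
    exact h h2

-- For `k ≥ 1` a dominating vertex or edge gives the answer yes; only without one do the classes of
-- vertices with a common proper module exist. The case `k = 0` is decided by distances alone, since
-- domination does not help there.
open Classical in
theorem runs_mespProg (hG : G.Connected) {W k : ℕ} (hW : n * n + 2 * n + k + 20 ≤ W) :
    Runs W mespProg (inputState G k) (3000 * (2 ^ modularWidth G * n ^ 3))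
      (fun s' => s'.var 0 = if YesInstance G k then 1 else 0) := by
  have hn : 0 < n := Fin.pos_iff_nonempty.2 hG.nonempty
  have h3 : 1 ≤ n ^ 3 := Nat.one_le_pow _ _ hn
  have hle : n ^ 3 ≤ 2 ^ modularWidth G * n ^ 3 := Nat.le_mul_of_pos_left _ (by positivity)
  have hin := hasInput_inputState (G := G) k
  refine (Runs.seq (t₂ := 2 + (200 * n ^ 3 + (2 + 2300 * (2 ^ modularWidth G * n ^ 3))))
    ((runs_distProg (W := W) hG (by omega) hin).frame.mono le_rfl ?_)).mono (by omega) fun _ h => h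
  rintro s₁ ⟨hF, hdist⟩
  have h0 : s₁.var 0 = n := (hF.1 0 (by decide)).trans hin.1
  have h1 : s₁.var 1 = k := by
    rw [hF.1 1 (by decide)]
    simp [inputState]
  have hd : HasDist G s₁ := ⟨h0, hdist⟩
  have hq : ∀ x, 20 ≤ x → x < 30 → s₁.var x = 0 := by
    intro x h4 h5
    have h6 : x ≠ 0 := by omega
    have h7 : x ≠ 1 := by omega
    rw [hF.1 x ?_]
    · simp [inputState, h6, h7]
    · simp [distProg, forP, Prog.wv]
      omega
  refine Runs.ite ?_ (fun hk => ?_) fun hk => ?_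
  · simp only [Expr.Fits]
    omega
  · replace hk : 1 ≤ k := by
      simp only [Expr.eval, h1] at hk
      omega
    refine Runs.seq ((Fm.runs_prog (N := n) (B := 30) (by omega) (by omega) dominatedFm
      dominatedFm_wf le_rfl (hd.fits_dominatedFm hG (by omega)) ?_).mono (cost_dominatedFm hn) ?_)
    · intro x hx
      simp [dominatedFm, Fm.all, Fm.qvars] at hx
      exact hq x (by omega) (by omega)
    rintro s₂ ⟨⟨hv₂, ha₂⟩, h30⟩
    rw [hd.holds_dominatedFm hG] at h30
    refine Runs.ite ?_ (fun hc => ?_) fun hc => ?_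
    · simp only [Expr.Fits, h30]
      split_ifs <;> omega
    · have hD : Dominated G := by
        by_contra hD
        simp [Expr.eval, h30, hD] at hc
      refine (Runs.assign (by simp only [Expr.Fits]; omega) ?_).mono
        (by simp only [Expr.cost]; omega) fun _ h => h
      simp [Expr.eval, hD.yesInstance hG hk]
    · have hD : ¬ Dominated G := by
        intro hD
        simp [Expr.eval, h30, hD] at hc
      have h0₂ : s₂.var 0 = n := (hv₂ 0 (by decide)).trans h0
      refine runs_repsProg_searchProg hG hD hW ⟨h0₂, ?_⟩ ((hv₂ 1 (by decide)).trans h1)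
        ⟨h0₂, ?_⟩ ?_ fun x h4 h5 => (hv₂ x h5).trans (hq x h4 h5)
      · rw [ha₂, hF.2 0 (by decide)]
        exact hin.2
      · rw [ha₂]
        exact hdist
      · rw [ha₂, hF.2 5 (by decide)]
        simp [inputState]
  · obtain rfl : k = 0 := by simpa [Expr.eval, h1] using hk
    refine (Runs.seq (t₂ := 2) ((Fm.runs_prog (N := n) (B := 30) (by omega) (by omega) spanningFm
      spanningFm_wf le_rfl (hd.fits_spanningFm hG (by omega)) ?_).mono (cost_spanningFm hn) ?_)).mono
      (by omega) fun _ h => h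
    · intro x hx
      simp [spanningFm, Fm.qvars] at hx
      exact hq x (by omega) (by omega)
    rintro s₂ ⟨-, h30⟩
    rw [hd.holds_spanningFm] at h30
    refine Runs.assign ?_ ?_
    · simp only [Expr.Fits, h30]
      split_ifs <;> omega
    · simp only [Expr.eval, State.setV_var, if_true, h30, yesInstance_zero_iff hG]
      congr

/-- The base is at least `3`, so its square is at least `9`, and the fourth power leaves room for
all additive constants. -/
theorem word_bound (hn : 0 < n) (k : ℕ) : n * n + 2 * n + k + 20 ≤ (n + k + 2) ^ 4 := by
  set m := n + k + 2 with hm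
  have h1 : 3 * 3 ≤ m * m := Nat.mul_le_mul (by omega) (by omega)
  have h2 : m * m * 9 ≤ m * m * (m * m) := Nat.mul_le_mul_left _ h1
  have h3 : n * n ≤ m * m := Nat.mul_le_mul (by omega) (by omega)
  have h4 : 3 * m ≤ m * m := Nat.mul_le_mul_right _ (by omega)
  calc n * n + 2 * n + k + 20 ≤ m * m * 9 := by omega
    _ ≤ m * m * (m * m) := h2
    _ = m ^ 4 := by ring

theorem decidesWithin_mespProg (hG : G.Connected) (k : ℕ) :
    DecidesWithin mespProg G k ((n + k + 2) ^ 4) (3000 * (2 ^ modularWidth G * n ^ 3)) := by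
  obtain ⟨s', t', he, ht, h⟩ := runs_mespProg hG
    (word_bound (Fin.pos_iff_nonempty.2 hG.nonempty) k)
  exact ⟨s', t', he, ht, fun hy => by rw [h, if_pos hy], fun hy => by rw [h, if_neg hy]⟩

end Main
end MESP

theorem mainTheorem1 :
    -- MESP is decided in time `O(2 ^ w * n ^ 3)` with words of `O(log (n + k))` bits
    (∃ (p : MESP.Prog) (c C : ℕ), ∀ (n : ℕ) (G : SimpleGraph (Fin n)) (k : ℕ), G.Connected →
      MESP.DecidesWithin p G k ((n + k + 2) ^ c) (C * (2 ^ MESP.modularWidth G * n ^ 3))) ∧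
    -- the structure of connected graphs that arise by a substitution
    (∀ (ι : Type) [Fintype ι] (T : SimpleGraph ι) (V : ι → Type) [∀ i, Fintype (V i)]
      [∀ i, Nonempty (V i)] (H : ∀ i, SimpleGraph (V i)),
      3 ≤ Fintype.card ι → (MESP.substGraph T H).Connected →
      -- some optimal path has at most one vertex in each module
      (∃ P : List (Σ i, V i), MESP.IsMinEccShortestPath (MESP.substGraph T H) P ∧
        ∀ x ∈ P, ∀ y ∈ P, x.1 = y.1 → x = y) ∧
      -- vertices of the same module are interchangeable
      (∀ (P : List (Σ i, V i)) (i : ι) (p p' : V i),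
        MESP.IsShortestPath (MESP.substGraph T H) P → (⟨i, p⟩ : Σ i, V i) ∈ P →
        (∃ x ∈ P, x.1 ≠ i) →
        MESP.pathEcc (MESP.substGraph T H) (MESP.exchange P ⟨i, p⟩ ⟨i, p'⟩) =
            MESP.pathEcc (MESP.substGraph T H) P ∧
          ((∀ x ∈ P, x.1 = i → x = ⟨i, p⟩) →
            MESP.IsShortestPath (MESP.substGraph T H) (MESP.exchange P ⟨i, p⟩ ⟨i, p'⟩))) ∧
      -- it suffices to enumerate the shortest paths of the pattern graph
      (∀ (r : ∀ i, V i) (k : ℕ), MESP.YesInstance (MESP.substGraph T H) k ↔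
        ∃ π : List ι, MESP.IsShortestPath T π ∧ 2 ≤ π.length ∧
          MESP.IsShortestPath (MESP.substGraph T H) (π.map fun i => ⟨i, r i⟩) ∧
          MESP.pathEcc (MESP.substGraph T H) (π.map fun i => ⟨i, r i⟩) ≤ k)) := by
  refine ⟨⟨MESP.mespProg, 4, 3000, fun n G k hG => MESP.decidesWithin_mespProg hG k⟩, ?_⟩
  intro ι _ T V _ _ H hι hG
  have h := MESP.isSubst_substGraph hι hG
  refine ⟨h.exists_isMinEccShortestPath_injOn, ?_, fun r k => ?_⟩
  · intro P i p p' hP hp hx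
    exact ⟨h.pathEcc_exchange hP hp rfl hx, h.isShortestPath_exchange (p := ⟨i, p⟩) hP rfl⟩
  · exact h.yesInstance_iff (r := fun i => ⟨i, r i⟩) (fun _ => rfl) k
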